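/- Let $\sigma>1$, let $\Omega\subseteq\mathbb R^m$ be a non-empty open set, and write $\tau=3\sigma-1$. **Notation.** $E^{s}(\Omega)$ is the space of $f\in C^\infty(\Omega)$ such that for every compact $K\subset\Omega$ there is $c>0$ with $\sup_K|\partial^\alpha f|\le c^{|\alpha|+1}(\alpha!)^{s}$ for all multi-indices $\alpha$; $D^{s}(\Omega)=E^{s}(\Omega)\cap C_0^\infty(\Omega)$; $E'_{s}(\Omega)$ and $D'_{s}(\Omega)$ are their topological duals. A net $(f_\varepsilon)_{\varepsilon\in]0,1]}$ in $C^\infty(\Omega)$ is *moderate* if for every compact $K\subset\Omega$ and every $\alpha$ there are $k,c>0$ and $\varepsilon_0\in]0,1]$ with $\sup_K|\partial^\alpha f_\varepsilon|\le c\exp(k\varepsilon^{-1/(2\sigma-1)})$ for $\varepsilon\le\varepsilon_0$; it belongs to $\mathcal N^\sigma(\Omega)$ if for every compact $K\subset\Omega$, every $\alpha$ and every $k>0$ there are $c>0$ and $\varepsilon_0\in]0,1]$ with $\sup_K|\partial^\alpha f_\varepsilon|\le c\exp(-k\varepsilon^{-1/(2\sigma-1)})$ for $\varepsilon\le\varepsilon_0$.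 $\mathcal G^\sigma(\Omega)$ is the algebra of moderate nets modulo the ideal $\mathcal N^\sigma(\Omega)$, and $cl$ denotes the class of a net. Let $\phi\in C^\infty(\mathbb R^m)$ satisfy $$\sup_{\alpha,\beta}\int\frac{|x|^{|\beta|}}{b^{|\alpha+\beta|}\alpha!^\sigma\beta!^\sigma}|\partial^\alpha\phi(x)|\,dx<\infty\ \text{ for all } b>0,\qquad \int\phi=1,\qquad \int x^\alpha\phi(x)\,dx=0\ (\alpha\ne0),$$ and put $\phi_\varepsilon=\varepsilon^{-m}\phi(\cdot/\varepsilon)$. For $\varphi\in D^\sigma(B(0,2))$ with $0\le\varphi\le1$ and $\varphi=1$ on $B(0,1)$, put $\rho_\varepsilon(x)=\varepsilon^{-m}\phi(x/\varepsilon)\,\varphi(x|\ln\varepsilon|)$. **Statement.** 1. For every $f\in D^\sigma(\Omega)$, $\big(f-(f*\phi_\varepsilon)_{/\Omega}\big)_\varepsilon\in\mathcal N^\sigma(\Omega)$. Moreover, for every compact $K\subset\Omega$ and every $k>0$ there are $c>0$ and $\varepsilon_0\in]0,1]$ such that for all $\alpha$ and all $\varepsilon\le\varepsilon_0$ $$\sup_{x\in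 K}|\partial^\alpha(f*\phi_\varepsilon-f)(x)|\le c^{|\alpha|+1}\,\alpha!^{\sigma}\exp\big(-k\varepsilon^{-1/(2\sigma-1)}\big).$$ 2. The linear map $J_0:E'_{\tau}(\Omega)\to\mathcal G^\sigma(\Omega)$, $J_0(T)=cl\big((T*\phi_\varepsilon)_{/\Omega}\big)_\varepsilon$, is well defined (the nets are moderate). For every $\varphi$ as above there is a well-defined linear map $J:D'_{\tau}(\Omega)\to\mathcal G^\sigma(\Omega)$, $J(T)=cl(T*\rho_\varepsilon)_\varepsilon$, where $(T*\rho_\varepsilon)(x)=\langle T,\rho_\varepsilon(x-\cdot)\rangle$. Here, since near a given compact $K\subset\Omega$ the function $T*\rho_\varepsilon$ is only defined, and then smooth, for small $\varepsilon$, $J(T)$ is the unique element of $\mathcal G^\sigma(\Omega)$ with a representative $(g_\varepsilon)_\varepsilon$ such that for every compact $K\subset\Omega$, every $\alpha$ and every $k>0$ there are $c>0$, $\varepsilon_0\in]0,1]$ with $\sup_K|\partial^\alpha(T*\rho_\varepsilon-g_\varepsilon)|\le c\exp(-k\varepsilon^{-1/(2\sigma-1)})$ for $\varepsilon\le\varepsilon_0$.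 3. $J$ coincides with $J_0$ on $E'_{\tau}(\Omega)$: for $T\in E'_{\tau}(\Omega)$ one has $J_0(T)=cl\big((T*\rho_\varepsilon)_{/\Omega}\big)_\varepsilon$, and $J(T_{|D^{\tau}(\Omega)})=J_0(T)$. 4. The diagram of embeddings $$\begin{array}{ccc}E^\sigma(\Omega)&\xrightarrow{\ I\ }&\mathcal G^\sigma(\Omega)\\ {\scriptstyle\iota}\downarrow&\nearrow{\scriptstyle J}&\\ D'_{3\sigma-1}(\Omega)&&\end{array}$$ is commutative, where $I(f)=cl(f)_\varepsilon$ (constant net) and $\langle\iota(f),\psi\rangle=\int_\Omega f\psi\,dx$; that is, $J\circ\iota=I$, and $I$, $\iota$, $J$ are injective. -/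

import Mathlib

open Set MeasureTheory
open scoped ContDiff ENNReal

noncomputable section

namespace Gevrey

/-- The Euclidean space `ℝ^m`. -/
abbrev E (m : ℕ) : Type := EuclideanSpace ℝ (Fin m)

/-! ### Multi-indices and partial derivatives -/

/-- The length `|α|` of a multi-index. -/
def len {m : ℕ} (α : Fin m → ℕ) : ℕ := ∑ i, α i

/-- The factorial `α! = ∏ αᵢ!`, as a real number. -/
def mfact {m : ℕ} (α : Fin m → ℕ) : ℝ := ∏ i, (Nat.factorial (α i) : ℝ)

/-- The monomial `x^α`. -/
def mpow {m : ℕ} (x : E m) (α : Fin m → ℕ) : ℝ := ∏ i, x i ^ α i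

/-- The partial derivative `∂ f / ∂ xᵢ`. -/
def pderiv {m : ℕ} (i : Fin m) (f : E m → ℂ) : E m → ℂ :=
  fun x => fderiv ℝ f x (EuclideanSpace.single i 1)

/-- Successive partial derivatives in the directions listed in `w`. -/
def wordDeriv {m : ℕ} (w : List (Fin m)) (f : E m → ℂ) : E m → ℂ :=
  w.foldl (fun g i => pderiv i g) f

/-- The list of directions `0, …, 0, 1, …, 1, …` in which `i` occurs `αᵢ` times. -/
def word {m : ℕ} (α : Fin m → ℕ) : List (Fin m) :=
  (List.finRange m).flatMap fun i => List.replicate (α i) i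

/-- The partial derivative `∂^α f`. -/
def mderiv {m : ℕ} (α : Fin m → ℕ) (f : E m → ℂ) : E m → ℂ := wordDeriv (word α) f

section helpers

variable {m : ℕ}

theorem wordDeriv_cons (i : Fin m) (w : List (Fin m)) (f : E m → ℂ) :
    wordDeriv (i :: w) f = wordDeriv w (pderiv i f) := rfl

theorem wordDeriv_append (w v : List (Fin m)) (f : E m → ℂ) :
    wordDeriv (w ++ v) f = wordDeriv v (wordDeriv w f) := by
  simp [wordDeriv, List.foldl_append]

variable {Ω : TopologicalSpace.Opens (E m)}

theorem differentiableAt_of {f : E m → ℂ} (hf : ContDiffOn ℝ ∞ f Ω) {x : E m} (hx : x ∈ Ω) :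
    DifferentiableAt ℝ f x :=
  (hf.contDiffAt (Ω.isOpen.mem_nhds hx)).differentiableAt (by simp)

theorem contDiffOn_pderiv (i : Fin m) {f : E m → ℂ} (hf : ContDiffOn ℝ ∞ f Ω) :
    ContDiffOn ℝ ∞ (pderiv i f) Ω :=
  (hf.fderiv_of_isOpen Ω.isOpen (by simp)).clm_apply contDiffOn_const

theorem pderiv_congr (i : Fin m) {f g : E m → ℂ} (h : EqOn f g Ω) :
    EqOn (pderiv i f) (pderiv i g) Ω := by
  intro x hx
  have : f =ᶠ[nhds x] g := h.eventuallyEq_of_mem (Ω.isOpen.mem_nhds hx)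
  simp only [pderiv, this.fderiv_eq]

theorem wordDeriv_congr (w : List (Fin m)) {f g : E m → ℂ} (h : EqOn f g Ω) :
    EqOn (wordDeriv w f) (wordDeriv w g) Ω := by
  induction w generalizing f g with
  | nil => exact h
  | cons i w ih => exact ih (pderiv_congr i h)

theorem contDiffOn_wordDeriv (w : List (Fin m)) {f : E m → ℂ} (hf : ContDiffOn ℝ ∞ f Ω) :
    ContDiffOn ℝ ∞ (wordDeriv w f) Ω := by
  induction w generalizing f with
  | nil => exact hf
  | cons i w ih => exact ih (contDiffOn_pderiv i hf)

theorem pderiv_add (i : Fin m) {f g : E m → ℂ} (hf : ContDiffOn ℝ ∞ f Ω)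
    (hg : ContDiffOn ℝ ∞ g Ω) : EqOn (pderiv i (f + g)) (pderiv i f + pderiv i g) Ω := by
  intro x hx
  simp [pderiv, fderiv_add (differentiableAt_of hf hx) (differentiableAt_of hg hx)]

theorem wordDeriv_add (w : List (Fin m)) {f g : E m → ℂ} (hf : ContDiffOn ℝ ∞ f Ω)
    (hg : ContDiffOn ℝ ∞ g Ω) :
    EqOn (wordDeriv w (f + g)) (wordDeriv w f + wordDeriv w g) Ω := by
  induction w generalizing f g with
  | nil => intro x _; rfl
  | cons i w ih =>
    exact (wordDeriv_congr w (pderiv_add i hf hg)).trans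
      (ih (contDiffOn_pderiv i hf) (contDiffOn_pderiv i hg))

theorem pderiv_mul (i : Fin m) {f g : E m → ℂ} (hf : ContDiffOn ℝ ∞ f Ω)
    (hg : ContDiffOn ℝ ∞ g Ω) :
    EqOn (pderiv i (f * g)) (f * pderiv i g + pderiv i f * g) Ω := by
  intro x hx
  simp [pderiv, fderiv_mul (differentiableAt_of hf hx) (differentiableAt_of hg hx)]
  ring

theorem pderiv_const (i : Fin m) (a : ℂ) : pderiv i (fun _ : E m => a) = fun _ => 0 := by
  funext x; simp [pderiv]

theorem wordDeriv_smul (w : List (Fin m)) (a : ℂ) {f : E m → ℂ} (hf : ContDiffOn ℝ ∞ f Ω) :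
    EqOn (wordDeriv w (a • f)) (a • wordDeriv w f) Ω := by
  induction w generalizing f with
  | nil => intro x _; rfl
  | cons i w ih =>
    have h : EqOn (pderiv i (a • f)) (a • pderiv i f) Ω := by
      intro x hx
      simp [pderiv, fderiv_const_smul (differentiableAt_of hf hx)]
    exact (wordDeriv_congr w h).trans (ih (contDiffOn_pderiv i hf))

theorem pderiv_comm (i j : Fin m) {f : E m → ℂ} (hf : ContDiffOn ℝ ∞ f Ω) :
    EqOn (pderiv i (pderiv j f)) (pderiv j (pderiv i f)) Ω := by
  intro x hx
  have hc := hf.contDiffAt (Ω.isOpen.mem_nhds hx)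
  have hd : DifferentiableAt ℝ (fderiv ℝ f) x :=
    (hc.fderiv_right (m := 1) (by norm_cast)).differentiableAt (by simp)
  have hs : IsSymmSndFDerivAt ℝ f x := hc.isSymmSndFDerivAt (by simp only [minSmoothness_of_isRCLikeNormedField]; norm_cast)
  have key : ∀ a b : Fin m, pderiv a (pderiv b f) x =
      fderiv ℝ (fderiv ℝ f) x (EuclideanSpace.single a 1) (EuclideanSpace.single b 1) := by
    intro a b
    unfold pderiv
    rw [fderiv_clm_apply hd (differentiableAt_const _)]
    simp
  rw [key, key]
  exact hs _ _

theorem wordDeriv_perm {w v : List (Fin m)} (h : w.Perm v) {f : E m → ℂ}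
    (hf : ContDiffOn ℝ ∞ f Ω) : EqOn (wordDeriv w f) (wordDeriv v f) Ω := by
  induction h generalizing f with
  | nil => intro x _; rfl
  | cons i _ ih => exact ih (contDiffOn_pderiv i hf)
  | swap i j l => exact wordDeriv_congr l (pderiv_comm i j hf)
  | trans _ _ ih1 ih2 => exact (ih1 hf).trans (ih2 hf)

theorem perm_word (w : List (Fin m)) : w.Perm (word fun i => w.count i) := by
  rw [List.perm_iff_count]
  intro a
  have h : ∀ l : List (Fin m), l.Nodup → List.count a (l.flatMap fun i =>
      List.replicate (w.count i) i) = if a ∈ l then w.count a else 0 := by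
    intro l
    induction l with
    | nil => simp
    | cons b l ih =>
      intro hl
      rw [List.nodup_cons] at hl
      rw [List.flatMap_cons, List.count_append, ih hl.2, List.count_replicate]
      by_cases hab : b = a
      · subst hab; simp [hl.1]
      · simp [hab, Ne.symm hab]
  rw [word, h _ (List.nodup_finRange m)]
  simp

theorem forall_wordDeriv {f : E m → ℂ} (hf : ContDiffOn ℝ ∞ f Ω) (w : List (Fin m)) :
    EqOn (wordDeriv w f) (mderiv (fun i => w.count i) f) Ω :=
  wordDeriv_perm (perm_word w) hf

theorem mfact_rpow_nonneg (α : Fin m → ℕ) (σ : ℝ) : 0 ≤ mfact α ^ σ :=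
  Real.rpow_nonneg (Finset.prod_nonneg fun _ _ => Nat.cast_nonneg _) σ

end helpers

/-! ### Gevrey functions and ultradistributions

A function on the open set `Ω` is represented by a function on the whole space, of which only
the values on `Ω` matter. -/

/-- The space `E^σ(Ω)` of Gevrey functions of order `σ`. -/
def gevrey (σ : ℝ) {m : ℕ} (Ω : TopologicalSpace.Opens (E m)) : Submodule ℂ (E m → ℂ) where
  carrier := {f | ContDiffOn ℝ ∞ f Ω ∧ ∀ K : Set (E m), IsCompact K → K ⊆ Ω →
    ∃ c > 0, ∀ α, ∀ x ∈ K, ‖mderiv α f x‖ ≤ c ^ (len α + 1) * mfact α ^ σ}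
  zero_mem' := by
    refine ⟨contDiffOn_const, fun K _ _ => ⟨1, one_pos, fun α x _ => ?_⟩⟩
    have : ∀ w : List (Fin m), wordDeriv w (0 : E m → ℂ) = 0 := by
      intro w
      induction w with
      | nil => rfl
      | cons i w ih =>
        rw [wordDeriv_cons, show pderiv i (0 : E m → ℂ) = 0 from pderiv_const i 0, ih]
    simp [mderiv, this, mfact_rpow_nonneg]
  add_mem' := by
    rintro f g ⟨hf, hf'⟩ ⟨hg, hg'⟩
    refine ⟨hf.add hg, fun K hK hKΩ => ?_⟩
    obtain ⟨c, hc, h1⟩ := hf' K hK hKΩ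
    obtain ⟨d, hd, h2⟩ := hg' K hK hKΩ
    refine ⟨c + d, by positivity, fun α x hx => ?_⟩
    have e : mderiv α (f + g) x = mderiv α f x + mderiv α g x :=
      wordDeriv_add (word α) hf hg (hKΩ hx)
    rw [e]
    refine (norm_add_le _ _).trans ((add_le_add (h1 α x hx) (h2 α x hx)).trans ?_)
    rw [← add_mul]
    exact mul_le_mul_of_nonneg_right
      (pow_add_pow_le hc.le hd.le (Nat.succ_ne_zero _)) (mfact_rpow_nonneg α σ)
  smul_mem' := by
    rintro a f ⟨hf, hf'⟩
    refine ⟨contDiffOn_const.smul hf, fun K hK hKΩ => ?_⟩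
    obtain ⟨c, hc, h1⟩ := hf' K hK hKΩ
    refine ⟨(1 + ‖a‖) * c, by positivity, fun α x hx => ?_⟩
    have e : mderiv α (a • f) x = a • mderiv α f x := wordDeriv_smul (word α) a hf (hKΩ hx)
    rw [e, norm_smul, mul_pow, mul_assoc]
    have ha : ‖a‖ ≤ (1 + ‖a‖) ^ (len α + 1) :=
      (by linarith [norm_nonneg a] : ‖a‖ ≤ 1 + ‖a‖).trans
        (le_self_pow₀ (by linarith [norm_nonneg a]) (Nat.succ_ne_zero _))
    exact mul_le_mul ha (h1 α x hx) (norm_nonneg _) (by positivity)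

/-- The space `D^σ(Ω)` of Gevrey functions with compact support in `Ω` (extended by zero to the
whole space). -/
def gevreyTest (σ : ℝ) {m : ℕ} (Ω : TopologicalSpace.Opens (E m)) : Submodule ℂ (E m → ℂ) where
  carrier := {f | f ∈ gevrey σ Ω ∧ HasCompactSupport f ∧ tsupport f ⊆ Ω}
  zero_mem' := ⟨zero_mem _, HasCompactSupport.zero, by simp [tsupport]⟩
  add_mem' := by
    rintro f g ⟨hf, hf', hf''⟩ ⟨hg, hg', hg''⟩
    exact ⟨add_mem hf hg, hf'.add hg', (tsupport_add f g).trans (union_subset hf'' hg'')⟩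
  smul_mem' := by
    rintro a f ⟨hf, hf', hf''⟩
    exact ⟨Submodule.smul_mem _ a hf, hf'.smul_left (f := fun _ => a),
      (tsupport_smul_subset_right (fun _ => a) f).trans hf''⟩

theorem gevreyTest_le (σ : ℝ) {m : ℕ} (Ω : TopologicalSpace.Opens (E m)) :
    gevreyTest σ Ω ≤ gevrey σ Ω := fun _ hf => hf.1

/-- The topological dual `E'_τ(Ω)` of `E^τ(Ω) = proj lim_L ind lim_h E^{τ,h}(L)`: the linear forms
`T` for which there is a compact `L ⊆ Ω` such that for every `h > 0` there is `c` with
`|T f| ≤ c sup_{α, x ∈ L} |∂^α f(x)| / (h^|α| α!^τ)`. -/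
def compactUltradist (τ : ℝ) {m : ℕ} (Ω : TopologicalSpace.Opens (E m)) :
    Submodule ℂ (gevrey τ Ω →ₗ[ℂ] ℂ) where
  carrier := {T | ∃ L : Set (E m), IsCompact L ∧ L ⊆ Ω ∧ ∀ h > 0, ∃ c > 0,
    ∀ (f : gevrey τ Ω) (M : ℝ), 0 ≤ M →
      (∀ α, ∀ x ∈ L, ‖mderiv α (f : E m → ℂ) x‖ ≤ M * h ^ len α * mfact α ^ τ) → ‖T f‖ ≤ c * M}
  zero_mem' := ⟨∅, isCompact_empty, empty_subset _, fun _ _ => ⟨1, one_pos, fun f M hM _ => by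
    simpa using hM⟩⟩
  add_mem' := by
    rintro S T ⟨K, hK, hKΩ, hS⟩ ⟨L, hL, hLΩ, hT⟩
    refine ⟨K ∪ L, hK.union hL, union_subset hKΩ hLΩ, fun h hh => ?_⟩
    obtain ⟨c, hc, h1⟩ := hS h hh
    obtain ⟨d, hd, h2⟩ := hT h hh
    refine ⟨c + d, by positivity, fun f M hM hf => ?_⟩
    rw [add_mul]
    exact (norm_add_le _ _).trans (add_le_add
      (h1 f M hM fun α x hx => hf α x (Or.inl hx)) (h2 f M hM fun α x hx => hf α x (Or.inr hx)))
  smul_mem' := by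
    rintro a T ⟨L, hL, hLΩ, hT⟩
    refine ⟨L, hL, hLΩ, fun h hh => ?_⟩
    obtain ⟨c, hc, h1⟩ := hT h hh
    refine ⟨(1 + ‖a‖) * c, by positivity, fun f M hM hf => ?_⟩
    rw [LinearMap.smul_apply, norm_smul, mul_assoc]
    exact mul_le_mul (by linarith) (h1 f M hM hf) (norm_nonneg _) (by positivity)

/-- The topological dual `D'_τ(Ω)` of `D^τ(Ω) = ind lim_{K, h} D^{τ,h}_K`, the space of Gevrey
ultradistributions of order `τ`: the linear forms `T` such that for every compact `K ⊆ Ω` and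
every `h > 0` there is `c` with `|T f| ≤ c sup_{α, x} |∂^α f(x)| / (h^|α| α!^τ)` for all `f`
with support in `K`. -/
def ultradist (τ : ℝ) {m : ℕ} (Ω : TopologicalSpace.Opens (E m)) :
    Submodule ℂ (gevreyTest τ Ω →ₗ[ℂ] ℂ) where
  carrier := {T | ∀ K : Set (E m), IsCompact K → K ⊆ Ω → ∀ h > 0, ∃ c > 0,
    ∀ (f : gevreyTest τ Ω) (M : ℝ), tsupport (f : E m → ℂ) ⊆ K → 0 ≤ M →
      (∀ α x, ‖mderiv α (f : E m → ℂ) x‖ ≤ M * h ^ len α * mfact α ^ τ) → ‖T f‖ ≤ c * M}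
  zero_mem' := fun _ _ _ _ _ => ⟨1, one_pos, fun f M _ hM _ => by simpa using hM⟩
  add_mem' := by
    intro S T hS hT K hK hKΩ h hh
    obtain ⟨c, hc, h1⟩ := hS K hK hKΩ h hh
    obtain ⟨d, hd, h2⟩ := hT K hK hKΩ h hh
    refine ⟨c + d, by positivity, fun f M hs hM hf => ?_⟩
    rw [add_mul]
    exact (norm_add_le _ _).trans (add_le_add (h1 f M hs hM hf) (h2 f M hs hM hf))
  smul_mem' := by
    intro a T hT K hK hKΩ h hh
    obtain ⟨c, hc, h1⟩ := hT K hK hKΩ h hh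
    refine ⟨(1 + ‖a‖) * c, by positivity, fun f M hs hM hf => ?_⟩
    rw [LinearMap.smul_apply, norm_smul, mul_assoc]
    exact mul_le_mul (by linarith) (h1 f M hs hM hf) (norm_nonneg _) (by positivity)

/-- The canonical map `E'_τ(Ω) → D'_τ(Ω)`: restriction of a linear form to `D^τ(Ω)`. -/
def compactToUltradist (τ : ℝ) {m : ℕ} (Ω : TopologicalSpace.Opens (E m)) :
    compactUltradist τ Ω →ₗ[ℂ] ultradist τ Ω where
  toFun T := ⟨T.1.comp (Submodule.inclusion (gevreyTest_le τ Ω)), by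
    obtain ⟨L, _, _, hT⟩ := T.2
    intro K _ _ h hh
    obtain ⟨c, hc, h1⟩ := hT h hh
    exact ⟨c, hc, fun f M _ hM hf => h1 _ M hM fun α x _ => hf α x⟩⟩
  map_add' _ _ := rfl
  map_smul' _ _ := rfl

theorem integrable_mul_test {σ τ : ℝ} {m : ℕ} {Ω : TopologicalSpace.Opens (E m)}
    {f ψ : E m → ℂ} (hf : f ∈ gevrey σ Ω) (hψ : ψ ∈ gevreyTest τ Ω) :
    Integrable fun x => f x * ψ x := by
  have hc : Continuous fun x => f x * ψ x := by
    rw [continuous_iff_continuousAt]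
    intro x
    by_cases hx : x ∈ tsupport ψ
    · have hxΩ := Ω.isOpen.mem_nhds (hψ.2.2 hx)
      exact (hf.1.continuousOn.continuousAt hxΩ).mul (hψ.1.1.continuousOn.continuousAt hxΩ)
    · have h0 : (fun x => f x * ψ x) =ᶠ[nhds x] fun _ => 0 := by
        filter_upwards [notMem_tsupport_iff_eventuallyEq.mp hx] with y hy
        simp [hy]
      exact continuousAt_const.congr h0.symm
  exact hc.integrable_of_hasCompactSupport (hψ.2.1.mul_left (f := f))

/-- The canonical map `E^σ(Ω) → D'_τ(Ω)` which sends `f` to `ψ ↦ ∫_Ω f ψ`. -/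
def gevreyToUltradist (σ τ : ℝ) {m : ℕ} (Ω : TopologicalSpace.Opens (E m)) :
    gevrey σ Ω →ₗ[ℂ] ultradist τ Ω where
  toFun f := ⟨{
      toFun := fun ψ => ∫ x in (Ω : Set (E m)), (f : E m → ℂ) x * (ψ : E m → ℂ) x
      map_add' := fun ψ χ => by
        rw [← integral_add (integrable_mul_test f.2 ψ.2).integrableOn
          (integrable_mul_test f.2 χ.2).integrableOn]
        simp [mul_add]
      map_smul' := fun a ψ => by
        simp only [Submodule.coe_smul, Pi.smul_apply, smul_eq_mul, RingHom.id_apply]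
        rw [← integral_const_mul]
        congr 1; funext x; ring }, by
    intro K hK hKΩ h hh
    obtain ⟨C, hC⟩ := hK.exists_bound_of_continuousOn (f.2.1.continuousOn.mono hKΩ)
    refine ⟨(|C| + 1) * (volume.real K + 1), by positivity, fun ψ M hs hM hψ => ?_⟩
    have h0 : ∀ x, ‖(ψ : E m → ℂ) x‖ ≤ M := fun x => by
      have := hψ 0 x
      have e : word (0 : Fin m → ℕ) = [] := by simp [word]
      simpa [mderiv, e, wordDeriv, len, mfact] using this
    have hz : ∀ x, x ∉ K → (f : E m → ℂ) x * (ψ : E m → ℂ) x = 0 := fun x hx => by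
      rw [image_eq_zero_of_notMem_tsupport (fun h => hx (hs h)), mul_zero]
    have e1 : ∫ x in (Ω : Set (E m)), (f : E m → ℂ) x * (ψ : E m → ℂ) x =
        ∫ x in K, (f : E m → ℂ) x * (ψ : E m → ℂ) x := by
      rw [setIntegral_eq_integral_of_forall_compl_eq_zero hz,
        setIntegral_eq_integral_of_forall_compl_eq_zero fun x hx => hz x fun h => hx (hKΩ h)]
    change ‖∫ x in (Ω : Set (E m)), (f : E m → ℂ) x * (ψ : E m → ℂ) x‖ ≤ _
    rw [e1]
    refine (norm_setIntegral_le_of_norm_le_const (C := (|C| + 1) * M) hK.measure_lt_top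
      fun x hx => ?_).trans ?_
    · rw [norm_mul]
      exact mul_le_mul ((hC x hx).trans (by linarith [le_abs_self C])) (h0 x) (norm_nonneg _)
        (by positivity)
    · have : 0 ≤ (|C| + 1) * M := by positivity
      nlinarith⟩
  map_add' f g := by
    apply Subtype.ext
    apply LinearMap.ext
    intro ψ
    change ∫ x in (Ω : Set (E m)), ((f : E m → ℂ) x + (g : E m → ℂ) x) * (ψ : E m → ℂ) x =
      (∫ x in (Ω : Set (E m)), (f : E m → ℂ) x * (ψ : E m → ℂ) x) +
        ∫ x in (Ω : Set (E m)), (g : E m → ℂ) x * (ψ : E m → ℂ) x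
    rw [← integral_add (integrable_mul_test f.2 ψ.2).integrableOn
          (integrable_mul_test g.2 ψ.2).integrableOn]
    simp [add_mul]
  map_smul' a f := by
    apply Subtype.ext
    apply LinearMap.ext
    intro ψ
    change ∫ x in (Ω : Set (E m)), (a * (f : E m → ℂ) x) * (ψ : E m → ℂ) x =
      a * ∫ x in (Ω : Set (E m)), (f : E m → ℂ) x * (ψ : E m → ℂ) x
    rw [← integral_const_mul]
    simp [mul_assoc]

/-! ### The algebra of generalized Gevrey ultradistributions -/

/-- Nets of complex functions indexed by `ε ∈ ]0, 1]`. -/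
abbrev Net (m : ℕ) : Type := Ioc (0 : ℝ) 1 → E m → ℂ

/-- `F` is, on every compact subset of `Ω` and for small `ε`, bounded by `c exp (k ε^{-1/(2σ-1)})`
for some `k > 0`. -/
def ModerateBound (σ : ℝ) {m : ℕ} (Ω : TopologicalSpace.Opens (E m)) (F : Net m) : Prop :=
  ∀ K : Set (E m), IsCompact K → K ⊆ Ω → ∃ k > 0, ∃ c > 0, ∃ ε₀ : Ioc (0 : ℝ) 1, ∀ ε ≤ ε₀,
    ∀ x ∈ K, ‖F ε x‖ ≤ c * Real.exp (k * (ε : ℝ) ^ (-(1 / (2 * σ - 1))))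

/-- `F` is, on every compact subset of `Ω` and for small `ε`, bounded by `c exp (-k ε^{-1/(2σ-1)})`
for every `k > 0`. -/
def NullBound (σ : ℝ) {m : ℕ} (Ω : TopologicalSpace.Opens (E m)) (F : Net m) : Prop :=
  ∀ K : Set (E m), IsCompact K → K ⊆ Ω → ∀ k > 0, ∃ c > 0, ∃ ε₀ : Ioc (0 : ℝ) 1, ∀ ε ≤ ε₀,
    ∀ x ∈ K, ‖F ε x‖ ≤ c * Real.exp (-k * (ε : ℝ) ^ (-(1 / (2 * σ - 1))))

/-- Membership in the space of moderate elements. -/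
def IsModerate (σ : ℝ) {m : ℕ} (Ω : TopologicalSpace.Opens (E m)) (f : Net m) : Prop :=
  (∀ ε, ContDiffOn ℝ ∞ (f ε) Ω) ∧ ∀ α, ModerateBound σ Ω fun ε => mderiv α (f ε)

/-- Membership in the space `N^σ(Ω)` of null elements. -/
def IsNull (σ : ℝ) {m : ℕ} (Ω : TopologicalSpace.Opens (E m)) (f : Net m) : Prop :=
  (∀ ε, ContDiffOn ℝ ∞ (f ε) Ω) ∧ ∀ α, NullBound σ Ω fun ε => mderiv α (f ε)

section helpers

variable {σ : ℝ} {m : ℕ} {Ω : TopologicalSpace.Opens (E m)}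

theorem ModerateBound.congr {F G : Net m} (hF : ModerateBound σ Ω F)
    (h : ∀ ε, EqOn (G ε) (F ε) Ω) : ModerateBound σ Ω G := by
  intro K hK hKΩ
  obtain ⟨k, hk, c, hc, ε₀, H⟩ := hF K hK hKΩ
  exact ⟨k, hk, c, hc, ε₀, fun ε hε x hx => by rw [h ε (hKΩ hx)]; exact H ε hε x hx⟩

theorem NullBound.congr {F G : Net m} (hF : NullBound σ Ω F)
    (h : ∀ ε, EqOn (G ε) (F ε) Ω) : NullBound σ Ω G := by
  intro K hK hKΩ k hk
  obtain ⟨c, hc, ε₀, H⟩ := hF K hK hKΩ k hk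
  exact ⟨c, hc, ε₀, fun ε hε x hx => by rw [h ε (hKΩ hx)]; exact H ε hε x hx⟩

theorem ModerateBound.add {F G : Net m} (hF : ModerateBound σ Ω F) (hG : ModerateBound σ Ω G) :
    ModerateBound σ Ω (F + G) := by
  intro K hK hKΩ
  obtain ⟨k, hk, c, hc, ε₁, H1⟩ := hF K hK hKΩ
  obtain ⟨l, hl, d, hd, ε₂, H2⟩ := hG K hK hKΩ
  refine ⟨k + l, by positivity, c + d, by positivity, min ε₁ ε₂, fun ε hε x hx => ?_⟩
  have hε0 : 0 ≤ (ε : ℝ) ^ (-(1 / (2 * σ - 1))) := Real.rpow_nonneg ε.2.1.le _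
  have h1 := H1 ε (hε.trans (min_le_left _ _)) x hx
  have h2 := H2 ε (hε.trans (min_le_right _ _)) x hx
  refine (norm_add_le _ _).trans ((add_le_add h1 h2).trans ?_)
  rw [add_mul]
  refine add_le_add (mul_le_mul_of_nonneg_left (Real.exp_le_exp.mpr ?_) hc.le)
    (mul_le_mul_of_nonneg_left (Real.exp_le_exp.mpr ?_) hd.le) <;> nlinarith

theorem NullBound.add {F G : Net m} (hF : NullBound σ Ω F) (hG : NullBound σ Ω G) :
    NullBound σ Ω (F + G) := by
  intro K hK hKΩ k hk
  obtain ⟨c, hc, ε₁, H1⟩ := hF K hK hKΩ k hk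
  obtain ⟨d, hd, ε₂, H2⟩ := hG K hK hKΩ k hk
  refine ⟨c + d, by positivity, min ε₁ ε₂, fun ε hε x hx => ?_⟩
  rw [add_mul]
  exact (norm_add_le _ _).trans (add_le_add (H1 ε (hε.trans (min_le_left _ _)) x hx)
    (H2 ε (hε.trans (min_le_right _ _)) x hx))

theorem ModerateBound.mul {F G : Net m} (hF : ModerateBound σ Ω F) (hG : ModerateBound σ Ω G) :
    ModerateBound σ Ω (F * G) := by
  intro K hK hKΩ
  obtain ⟨k, hk, c, hc, ε₁, H1⟩ := hF K hK hKΩ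
  obtain ⟨l, hl, d, hd, ε₂, H2⟩ := hG K hK hKΩ
  refine ⟨k + l, by positivity, c * d, by positivity, min ε₁ ε₂, fun ε hε x hx => ?_⟩
  have h1 := H1 ε (hε.trans (min_le_left _ _)) x hx
  have h2 := H2 ε (hε.trans (min_le_right _ _)) x hx
  rw [add_mul, Real.exp_add, mul_mul_mul_comm]
  exact (norm_mul_le _ _).trans (mul_le_mul h1 h2 (norm_nonneg _) (by positivity))

theorem ModerateBound.mul_null {F G : Net m} (hF : ModerateBound σ Ω F) (hG : NullBound σ Ω G) :
    NullBound σ Ω (F * G) := by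
  intro K hK hKΩ k hk
  obtain ⟨l, hl, c, hc, ε₁, H1⟩ := hF K hK hKΩ
  obtain ⟨d, hd, ε₂, H2⟩ := hG K hK hKΩ (l + k) (by positivity)
  refine ⟨c * d, by positivity, min ε₁ ε₂, fun ε hε x hx => ?_⟩
  have h1 := H1 ε (hε.trans (min_le_left _ _)) x hx
  have h2 := H2 ε (hε.trans (min_le_right _ _)) x hx
  rw [show -k * (ε : ℝ) ^ (-(1 / (2 * σ - 1))) = l * (ε : ℝ) ^ (-(1 / (2 * σ - 1))) +
    -(l + k) * (ε : ℝ) ^ (-(1 / (2 * σ - 1))) by ring, Real.exp_add, mul_mul_mul_comm]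
  exact (norm_mul_le _ _).trans (mul_le_mul h1 h2 (norm_nonneg _) (by positivity))

theorem IsModerate.word {f : Net m} (hf : IsModerate σ Ω f) (w : List (Fin m)) :
    ModerateBound σ Ω fun ε => wordDeriv w (f ε) :=
  (hf.2 _).congr fun ε => forall_wordDeriv (hf.1 ε) w

theorem IsNull.word {f : Net m} (hf : IsNull σ Ω f) (w : List (Fin m)) :
    NullBound σ Ω fun ε => wordDeriv w (f ε) :=
  (hf.2 _).congr fun ε => forall_wordDeriv (hf.1 ε) w

theorem IsModerate.pderiv {f : Net m} (hf : IsModerate σ Ω f) (i : Fin m) :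
    IsModerate σ Ω fun ε => pderiv i (f ε) :=
  ⟨fun ε => contDiffOn_pderiv i (hf.1 ε), fun α => hf.word (i :: Gevrey.word α)⟩

theorem IsNull.pderiv {f : Net m} (hf : IsNull σ Ω f) (i : Fin m) :
    IsNull σ Ω fun ε => pderiv i (f ε) :=
  ⟨fun ε => contDiffOn_pderiv i (hf.1 ε), fun α => hf.word (i :: Gevrey.word α)⟩

theorem wordDeriv_mul_cons (i : Fin m) (w : List (Fin m)) {f g : E m → ℂ}
    (hf : ContDiffOn ℝ ∞ f Ω) (hg : ContDiffOn ℝ ∞ g Ω) :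
    EqOn (wordDeriv (i :: w) (f * g))
      (wordDeriv w (f * pderiv i g) + wordDeriv w (pderiv i f * g)) Ω :=
  (wordDeriv_congr w (pderiv_mul i hf hg)).trans
    (wordDeriv_add w (hf.mul (contDiffOn_pderiv i hg)) ((contDiffOn_pderiv i hf).mul hg))

theorem IsModerate.mul_word (w : List (Fin m)) {f g : Net m} (hf : IsModerate σ Ω f)
    (hg : IsModerate σ Ω g) : ModerateBound σ Ω fun ε => wordDeriv w (f ε * g ε) := by
  induction w generalizing f g with
  | nil => exact (hf.word []).mul (hg.word [])
  | cons i w ih =>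
    exact ((ih hf (hg.pderiv i)).add (ih (hf.pderiv i) hg)).congr
      fun ε => wordDeriv_mul_cons i w (hf.1 ε) (hg.1 ε)

theorem IsModerate.mul_null_word (w : List (Fin m)) {f g : Net m} (hf : IsModerate σ Ω f)
    (hg : IsNull σ Ω g) : NullBound σ Ω fun ε => wordDeriv w (f ε * g ε) := by
  induction w generalizing f g with
  | nil => exact (hf.word []).mul_null (hg.word [])
  | cons i w ih =>
    exact ((ih hf (hg.pderiv i)).add (ih (hf.pderiv i) hg)).congr
      fun ε => wordDeriv_mul_cons i w (hf.1 ε) (hg.1 ε)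

theorem IsModerate.of_const {f : E m → ℂ} (hf : ContDiffOn ℝ ∞ f Ω) :
    IsModerate σ Ω fun _ => f := by
  refine ⟨fun _ => hf, fun α K hK hKΩ => ?_⟩
  obtain ⟨C, hC⟩ := hK.exists_bound_of_continuousOn
    ((contDiffOn_wordDeriv (Gevrey.word α) hf).continuousOn.mono hKΩ)
  refine ⟨1, one_pos, |C| + 1, by positivity, ⟨1, by simp⟩, fun ε _ x hx => ?_⟩
  have h1 : ‖mderiv α f x‖ ≤ |C| + 1 := (hC x hx).trans (by linarith [le_abs_self C])
  have hε0 : 0 ≤ (ε : ℝ) ^ (-(1 / (2 * σ - 1))) := Real.rpow_nonneg ε.2.1.le _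
  refine h1.trans (le_mul_of_one_le_right (by positivity) (Real.one_le_exp (by linarith)))

end helpers

/-- The algebra of moderate elements. -/
def moderate (σ : ℝ) {m : ℕ} (Ω : TopologicalSpace.Opens (E m)) : Subalgebra ℂ (Net m) where
  carrier := {f | IsModerate σ Ω f}
  mul_mem' hf hg := ⟨fun ε => (hf.1 ε).mul (hg.1 ε), fun α => hf.mul_word (word α) hg⟩
  add_mem' hf hg := ⟨fun ε => (hf.1 ε).add (hg.1 ε), fun α =>
    ((hf.2 α).add (hg.2 α)).congr fun ε => wordDeriv_add (word α) (hf.1 ε) (hg.1 ε)⟩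
  algebraMap_mem' a := IsModerate.of_const (f := fun _ => a) contDiffOn_const

/-- The ideal `N^σ(Ω)` of null elements in the algebra of moderate elements. -/
def nullIdeal (σ : ℝ) {m : ℕ} (Ω : TopologicalSpace.Opens (E m)) : Ideal (moderate σ Ω) where
  carrier := {f | IsNull σ Ω (f : Net m)}
  zero_mem' := by
    have h : IsModerate σ Ω (0 : Net m) := (moderate σ Ω).zero_mem
    have h0 : ∀ w : List (Fin m), wordDeriv w (0 : E m → ℂ) = 0 := by
      intro w
      induction w with
      | nil => rfl
      | cons i w ih =>
        rw [wordDeriv_cons, show Gevrey.pderiv i (0 : E m → ℂ) = 0 from pderiv_const i 0, ih]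
    refine ⟨h.1, fun α K _ _ k _ => ⟨1, one_pos, ⟨1, by simp⟩, fun ε _ x _ => ?_⟩⟩
    change ‖wordDeriv (word α) (0 : E m → ℂ) x‖ ≤ _
    rw [h0]
    simp [Real.exp_nonneg]
  add_mem' hf hg := ⟨fun ε => (hf.1 ε).add (hg.1 ε), fun α =>
    ((hf.2 α).add (hg.2 α)).congr fun ε => wordDeriv_add (word α) (hf.1 ε) (hg.1 ε)⟩
  smul_mem' c _ hf := ⟨fun ε => (c.2.1 ε).mul (hf.1 ε), fun α =>
    IsModerate.mul_null_word (word α) c.2 hf⟩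

/-- The algebra `G^σ(Ω)` of generalized Gevrey ultradistributions of order `σ`. -/
abbrev GenGevrey (σ : ℝ) {m : ℕ} (Ω : TopologicalSpace.Opens (E m)) : Type :=
  moderate σ Ω ⧸ nullIdeal σ Ω

/-- `u = cl (f_ε)_ε` in `G^σ(Ω)`; in particular the net `f` is moderate. -/
def IsClass {σ : ℝ} {m : ℕ} {Ω : TopologicalSpace.Opens (E m)} (f : Net m)
    (u : GenGevrey σ Ω) : Prop :=
  ∃ h : f ∈ moderate σ Ω, u = Ideal.Quotient.mk (nullIdeal σ Ω) ⟨f, h⟩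

/-- `u = cl (f_ε)_ε` in `G^σ(Ω)` for a net whose members are smooth functions near any given
compact subset of `Ω` as soon as `ε` is small enough: near every compact subset of `Ω`, the net
differs from a representative of `u` by a null net. -/
def IsLocalClass {σ : ℝ} {m : ℕ} {Ω : TopologicalSpace.Opens (E m)} (f : Net m)
    (u : GenGevrey σ Ω) : Prop :=
  (∀ K : Set (E m), IsCompact K → K ⊆ Ω → ∃ ε₀ : Ioc (0 : ℝ) 1, ∀ ε ≤ ε₀, ∀ x ∈ K,
      ContDiffAt ℝ ∞ (f ε) x) ∧
    ∃ g : moderate σ Ω, u = Ideal.Quotient.mk (nullIdeal σ Ω) g ∧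
      ∀ α, NullBound σ Ω fun ε => mderiv α (f ε - (g : Net m) ε)

/-- The canonical map `I : E^σ(Ω) → G^σ(Ω)`, `f ↦ cl (f)_ε`. -/
def gevreyToGen (σ : ℝ) {m : ℕ} (Ω : TopologicalSpace.Opens (E m)) :
    gevrey σ Ω →ₗ[ℂ] GenGevrey σ Ω where
  toFun f := Ideal.Quotient.mk (nullIdeal σ Ω)
    ⟨fun _ => (f : E m → ℂ), IsModerate.of_const f.2.1⟩
  map_add' _ _ := rfl
  map_smul' _ _ := rfl

/-! ### Mollifiers and convolutions -/

/-- The norm `‖φ‖_{b,σ}`, the supremum over `α, β` of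
`∫ |x|^|β| |∂^α φ(x)| dx / (b^|α+β| α!^σ β!^σ)`. -/
def gsNorm (b σ : ℝ) {m : ℕ} (φ : E m → ℂ) : ℝ≥0∞ :=
  ⨆ (α : Fin m → ℕ) (β : Fin m → ℕ), ∫⁻ x, ENNReal.ofReal
    (‖x‖ ^ len β / (b ^ len (α + β) * mfact α ^ σ * mfact β ^ σ) * ‖mderiv α φ x‖)

/-- `φ` belongs to `S^(σ)(ℝ^m)`, has integral `1`, and all its other moments vanish. -/
structure IsMollifier (σ : ℝ) {m : ℕ} (φ : E m → ℂ) : Prop where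
  contDiff : ContDiff ℝ ∞ φ
  gsNorm_lt_top : ∀ b > 0, gsNorm b σ φ < ⊤
  integral_eq_one : ∫ x, φ x = 1
  moment_eq_zero : ∀ α : Fin m → ℕ, α ≠ 0 → ∫ x, (mpow x α : ℂ) * φ x = 0

/-- The net of mollifiers `φ_ε = ε^{-m} φ(·/ε)`. -/
def mollNet {m : ℕ} (φ : E m → ℂ) : Net m :=
  fun ε x => (((ε : ℝ) ^ m)⁻¹ : ℝ) * φ ((ε : ℝ)⁻¹ • x)

/-- `χ ∈ D^σ(B(0,2))`, `0 ≤ χ ≤ 1` and `χ = 1` on `B(0,1)`. -/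
structure IsCutoff (σ : ℝ) {m : ℕ} (χ : E m → ℝ) : Prop where
  mem : (fun x => (χ x : ℂ)) ∈ gevreyTest σ (⟨Metric.ball 0 2, Metric.isOpen_ball⟩ :
    TopologicalSpace.Opens (E m))
  nonneg : ∀ x, 0 ≤ χ x
  le_one : ∀ x, χ x ≤ 1
  eq_one : ∀ x ∈ Metric.ball (0 : E m) 1, χ x = 1

/-- The modified net of mollifiers `ρ_ε(x) = ε^{-m} φ(x/ε) χ(x |ln ε|)`. -/
def modMollNet {m : ℕ} (φ : E m → ℂ) (χ : E m → ℝ) : Net m :=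
  fun ε x => mollNet φ ε x * (χ (|Real.log ε| • x) : ℂ)

/-- The net of convolutions `f ∗ g_ε`, `(f ∗ g_ε)(x) = ∫ f(y) g_ε(x - y) dy`. -/
def convNet {m : ℕ} (f : E m → ℂ) (g : Net m) : Net m :=
  fun ε => convolution f (g ε) (ContinuousLinearMap.mul ℝ ℂ) volume

open Classical in
/-- The net `(T ∗ g_ε)(x) = ⟨T, g_ε(x - ·)⟩` for `T ∈ E'_τ(Ω)`; it makes sense where
`g_ε(x - ·) ∈ E^τ(Ω)`. -/
def compactConvNet {τ : ℝ} {m : ℕ} {Ω : TopologicalSpace.Opens (E m)}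
    (T : compactUltradist τ Ω) (g : Net m) : Net m :=
  fun ε x => if h : (fun y => g ε (x - y)) ∈ gevrey τ Ω then T.1 ⟨_, h⟩ else 0

open Classical in
/-- The net `(T ∗ g_ε)(x) = ⟨T, g_ε(x - ·)⟩` for `T ∈ D'_τ(Ω)`; it makes sense where
`g_ε(x - ·) ∈ D^τ(Ω)`. -/
def ultradistConvNet {τ : ℝ} {m : ℕ} {Ω : TopologicalSpace.Opens (E m)}
    (T : ultradist τ Ω) (g : Net m) : Net m :=
  fun ε x => if h : (fun y => g ε (x - y)) ∈ gevreyTest τ Ω then T.1 ⟨_, h⟩ else 0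

end Gevrey

end

/-!
Derivatives are indexed by words `w` of coordinate directions, with the estimates
`|∂^w f| ≤ A h^|w| |w|!^σ` (`GevreyAt`); these are equivalent to the estimates with multi-indices.
Put `s = 2σ - 1`.

*Regularization of functions.* Since `φ` has integral `1` and its other moments vanish,
`f ∗ φ_ε - f` is the average of the Taylor remainder of `f` of any order `N`. That remainder
contributes `(h ε)^N N!^σ / N!`, and the moments `∫ |x|^N |φ|` are `O(b^N N!^σ)` for every `b > 0`.
Hence `|f ∗ φ_ε - f| ≤ C (b ε)^N N!^s` for all `N` and `b`, which amounts to a bound by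
`exp(-k ε^{-1/s})` for all `k` (`le_exp_neg_of_forall_le_pow_mul_factorial`,
`IsMollifier.exists_norm_integral_sub_le`). Derivatives of the convolution fall on `f`, and the
derivatives of `f` are Gevrey functions again.

*Moderateness.* A derivative of length `n` of `φ_ε` or `ρ_ε` costs a factor `ε^{-n} n!^σ`. As
`(a / ε)^n ≤ n!^s exp(k ε^{-1/s})`, these nets satisfy Gevrey estimates of order `s + σ = 3σ - 1`
with a constant independent of `ε` and a moderate factor (`GevreyAt.absorb`); this is where the
order `3σ - 1` comes from. The difference `φ_ε - ρ_ε` lives where `|x| ≥ 1 / |ln ε|`, and there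
`φ(x / ε)` is smaller than any `exp(-k (ε |ln ε|)^{-1/σ})`. This beats all `exp(-k ε^{-1/s})`
because `1/σ > 1/s` (`IsMollifier.exists_gevreyAt_sub`). The pointwise decay of `φ` follows from
the integral bounds by a local Sobolev inequality.

*Ultradistributions.* The Gevrey norm of step `h` of a function is the supremum norm of its jet,
the bounded family of all `∂^w f(y) / (h^|w| |w|!^τ)`. By the Hahn–Banach theorem an
ultradistribution acts as a continuous linear form `Λ` on the Banach space of bounded families
(`exists_jet_functional`). Since `x ↦ jet (g(x - ·))` is smooth with values in that space, `T ∗ g`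
is smooth, its derivatives fall on `g` and are bounded by `‖Λ‖` times the Gevrey norms of the
derivatives of `g`. So `T ∗ φ_ε` and `T ∗ ρ_ε` are moderate with a null difference. For `T` in
`D'_τ(Ω)` the net `T ∗ ρ_ε` is defined only away from the boundary of `Ω`, and it is multiplied by
functions of `x` that cut off a neighbourhood of the complement whose size shrinks with `ε`.

*The diagram.* `J ∘ ι = I` is a local assertion, and locally a Gevrey function coincides with a
test function, so that the estimate for `f ∗ φ_ε - f` applies; the truncated `ρ_ε` is close to
`φ_ε` in `L¹`. If `J T = 0`, then `∫ (T ∗ ρ_ε) ψ` tends to `0`; on the other hand it is the value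
of `Λ` at `∫ ψ(x) jet (ρ_ε(x - ·)) dx`, which by integration by parts tends to the jet of `ψ`.
Hence `T ψ = 0` (`IsMollifier.eq_zero_of_isLocalClass_zero`). Injectivity of `I` holds since a
constant below all `c exp(-k ε^{-1/s})` is zero, and `ι` is injective because `I = J ∘ ι` is.
-/

namespace Gevrey

/-! ### Derivatives along words of coordinate directions -/

section words

variable {m : ℕ}

theorem contDiff_pderiv (i : Fin m) {f : E m → ℂ} (hf : ContDiff ℝ ∞ f) :
    ContDiff ℝ ∞ (pderiv i f) :=
  contDiffOn_univ.mp (contDiffOn_pderiv (Ω := ⊤) i hf.contDiffOn)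

theorem contDiff_wordDeriv (w : List (Fin m)) {f : E m → ℂ} (hf : ContDiff ℝ ∞ f) :
    ContDiff ℝ ∞ (wordDeriv w f) :=
  contDiffOn_univ.mp (contDiffOn_wordDeriv (Ω := ⊤) w hf.contDiffOn)

theorem wordDeriv_smul' (w : List (Fin m)) (a : ℂ) {f : E m → ℂ} (hf : ContDiff ℝ ∞ f) :
    wordDeriv w (a • f) = a • wordDeriv w f :=
  funext fun _ => wordDeriv_smul (Ω := ⊤) w a hf.contDiffOn trivial

theorem wordDeriv_add' (w : List (Fin m)) {f g : E m → ℂ} (hf : ContDiff ℝ ∞ f)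
    (hg : ContDiff ℝ ∞ g) : wordDeriv w (f + g) = wordDeriv w f + wordDeriv w g :=
  funext fun _ => wordDeriv_add (Ω := ⊤) w hf.contDiffOn hg.contDiffOn trivial

theorem wordDeriv_sub {Ω : TopologicalSpace.Opens (E m)} (w : List (Fin m)) {f g : E m → ℂ}
    (hf : ContDiffOn ℝ ∞ f Ω) (hg : ContDiffOn ℝ ∞ g Ω) :
    EqOn (wordDeriv w (f - g)) (wordDeriv w f - wordDeriv w g) Ω := by
  intro x hx
  have e : f - g = f + (-1 : ℂ) • g := by ext y; simp [sub_eq_add_neg]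
  have hg' : ContDiffOn ℝ ∞ ((-1 : ℂ) • g) Ω := contDiffOn_const.smul hg
  rw [e, wordDeriv_add w hf hg' hx, Pi.add_apply, wordDeriv_smul w _ hg hx]
  simp [sub_eq_add_neg]

theorem wordDeriv_perm' {w v : List (Fin m)} (h : w.Perm v) {f : E m → ℂ}
    (hf : ContDiff ℝ ∞ f) : wordDeriv w f = wordDeriv v f :=
  funext fun _ => wordDeriv_perm (Ω := ⊤) h hf.contDiffOn trivial

theorem wordDeriv_pderiv (w : List (Fin m)) (i : Fin m) {f : E m → ℂ} (hf : ContDiff ℝ ∞ f) :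
    wordDeriv w (pderiv i f) = pderiv i (wordDeriv w f) := by
  have h : (i :: w).Perm (w ++ [i]) := (List.perm_append_singleton i w).symm
  have := wordDeriv_perm' h hf
  rwa [wordDeriv_cons, wordDeriv_append] at this

theorem wordDeriv_eventuallyEq (w : List (Fin m)) {f g : E m → ℂ} {x : E m}
    (h : f =ᶠ[nhds x] g) : wordDeriv w f =ᶠ[nhds x] wordDeriv w g := by
  obtain ⟨U, hU, hUo, hx⟩ := eventually_nhds_iff.mp h
  exact (wordDeriv_congr (Ω := ⟨U, hUo⟩) w hU).eventuallyEq_of_mem (hUo.mem_nhds hx)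

theorem wordDeriv_zero (w : List (Fin m)) : wordDeriv w (0 : E m → ℂ) = 0 := by
  induction w with
  | nil => rfl
  | cons i w ih =>
    rw [wordDeriv_cons, show pderiv i (0 : E m → ℂ) = 0 from pderiv_const i 0, ih]

theorem wordDeriv_eq_zero_of_eventuallyEq (w : List (Fin m)) {f : E m → ℂ} {x : E m}
    (h : f =ᶠ[nhds x] 0) : wordDeriv w f x = 0 := by
  rw [(wordDeriv_eventuallyEq w h).eq_of_nhds, wordDeriv_zero]; rfl

theorem tsupport_wordDeriv_subset (w : List (Fin m)) (f : E m → ℂ) :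
    tsupport (wordDeriv w f) ⊆ tsupport f := by
  refine closure_minimal (fun x hx => ?_) (isClosed_tsupport f)
  by_contra h
  exact hx (wordDeriv_eq_zero_of_eventuallyEq w (notMem_tsupport_iff_eventuallyEq.mp h))

/-- Derivatives of a function precomposed with the affine map `y ↦ a + c y`; this covers
translations, dilations and reflections. -/
theorem wordDeriv_comp_affine (w : List (Fin m)) {g : E m → ℂ} (hg : ContDiff ℝ ∞ g) (a : E m)
    (c : ℝ) : wordDeriv w (fun y => g (a + c • y)) =
      fun y => (c : ℂ) ^ w.length * wordDeriv w g (a + c • y) := by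
  induction w generalizing g with
  | nil => ext y; simp [wordDeriv]
  | cons i w ih =>
    have h : pderiv i (fun y => g (a + c • y)) =
        (c : ℂ) • fun y => pderiv i g (a + c • y) := by
      ext x
      have h1 : HasFDerivAt (fun y : E m => a + c • y) (c • ContinuousLinearMap.id ℝ (E m)) x :=
        ((hasFDerivAt_id x).const_smul c).const_add a
      have h2 := ((hg.differentiable (by simp)) (a + c • x)).hasFDerivAt.comp x h1
      have h3 : fderiv ℝ (fun y => g (a + c • y)) x = _ := h2.fderiv
      simp only [pderiv, h3]
      simp
    have h' : ContDiff ℝ ∞ fun y => pderiv i g (a + c • y) :=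
      (contDiff_pderiv i hg).comp (contDiff_const.add (contDiff_id.const_smul c))
    rw [wordDeriv_cons, h, wordDeriv_smul' w _ h', ih (contDiff_pderiv i hg)]
    ext y
    simp [wordDeriv_cons, pow_succ]
    ring

/-- The Leibniz rule, in the form of a bound which depends only on the lengths of words. -/
theorem norm_wordDeriv_mul_le {Ω : TopologicalSpace.Opens (E m)} (w : List (Fin m))
    {f g : E m → ℂ} (hf : ContDiffOn ℝ ∞ f Ω) (hg : ContDiffOn ℝ ∞ g Ω) {x : E m} (hx : x ∈ Ω)
    {A B : ℕ → ℝ} (hA : ∀ v, ‖wordDeriv v f x‖ ≤ A v.length)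
    (hB : ∀ v, ‖wordDeriv v g x‖ ≤ B v.length) :
    ‖wordDeriv w (f * g) x‖ ≤ ∑ p ∈ Finset.HasAntidiagonal.antidiagonal w.length,
      (w.length.choose p.1 : ℝ) * (A p.1 * B p.2) := by
  induction w generalizing f g A B with
  | nil =>
    have hA0 := hA []
    have hB0 := hB []
    simp only [wordDeriv, List.foldl_nil, List.length_nil] at hA0 hB0 ⊢
    simpa using mul_le_mul hA0 hB0 (norm_nonneg _) ((norm_nonneg _).trans hA0)
  | cons i w ih =>
    rw [wordDeriv_mul_cons i w hf hg hx, List.length_cons,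
      Finset.sum_antidiagonal_choose_succ_mul fun j k => A j * B k]
    refine (norm_add_le _ _).trans (add_le_add ?_ ?_)
    · exact ih hf (contDiffOn_pderiv i hg) hA (B := fun n => B (n + 1)) fun v => hB (i :: v)
    · refine (ih (contDiffOn_pderiv i hf) hg (A := fun n => A (n + 1))
        (fun v => hA (i :: v)) hB).trans_eq ?_
      refine Finset.sum_congr rfl fun p hp => ?_
      rw [Nat.choose_symm_of_eq_add (Finset.HasAntidiagonal.mem_antidiagonal.mp hp).symm]

end words

/-! ### Factorials of words and multi-indices -/

section factorials

variable {m : ℕ}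

theorem factorial_rpow_pos (n : ℕ) (σ : ℝ) : 0 < (n.factorial : ℝ) ^ σ :=
  Real.rpow_pos_of_pos (by positivity) σ

theorem factorial_rpow_mul_le (j k : ℕ) {σ : ℝ} (hσ : 0 ≤ σ) :
    (j.factorial : ℝ) ^ σ * (k.factorial : ℝ) ^ σ ≤ ((j + k).factorial : ℝ) ^ σ := by
  rw [← Real.mul_rpow (by positivity) (by positivity)]
  refine Real.rpow_le_rpow (by positivity) ?_ hσ
  exact_mod_cast Nat.le_of_dvd (Nat.factorial_pos _)
    (Nat.factorial_mul_factorial_dvd_factorial_add j k)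

theorem factorial_add_le (j k : ℕ) :
    (j + k).factorial ≤ 2 ^ (j + k) * (j.factorial * k.factorial) := by
  rw [← Nat.add_choose_mul_factorial_mul_factorial, mul_assoc]
  exact Nat.mul_le_mul_right _ (Nat.choose_le_two_pow _ _)

theorem factorial_add_rpow_le (j k : ℕ) {σ : ℝ} (hσ : 0 ≤ σ) :
    ((j + k).factorial : ℝ) ^ σ ≤
      ((2 : ℝ) ^ σ) ^ (j + k) * ((j.factorial : ℝ) ^ σ * (k.factorial : ℝ) ^ σ) := by
  rw [← Real.mul_rpow (by positivity) (by positivity), ← Real.rpow_natCast, ← Real.rpow_mul (by simp),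
    mul_comm σ, Real.rpow_mul (by simp), Real.rpow_natCast,
    ← Real.mul_rpow (by positivity) (by positivity)]
  refine Real.rpow_le_rpow (by positivity) ?_ hσ
  exact_mod_cast factorial_add_le j k

theorem mfact_le_factorial_len (α : Fin m → ℕ) : mfact α ≤ ((len α).factorial : ℝ) := by
  unfold mfact len
  exact_mod_cast Nat.le_of_dvd (Nat.factorial_pos _)
    (Nat.prod_factorial_dvd_factorial_sum Finset.univ α)

theorem mfact_pos (α : Fin m → ℕ) : 0 < mfact α :=
  Finset.prod_pos fun _ _ => by positivity

theorem factorial_sum_le (s : Finset (Fin m)) (α : Fin m → ℕ) :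
    (∑ i ∈ s, α i).factorial ≤ (2 ^ s.card) ^ (∑ i ∈ s, α i) * ∏ i ∈ s, (α i).factorial := by
  induction s using Finset.induction_on with
  | empty => simp
  | insert a s ha ih =>
    rw [Finset.sum_insert ha, Finset.prod_insert ha, Finset.card_insert_of_notMem ha]
    refine (factorial_add_le _ _).trans ?_
    have h1 : (2 ^ s.card) ^ (∑ i ∈ s, α i) ≤ (2 ^ s.card) ^ (α a + ∑ i ∈ s, α i) :=
      Nat.pow_le_pow_right (by positivity) (by omega)
    calc 2 ^ (α a + ∑ i ∈ s, α i) * ((α a).factorial * (∑ i ∈ s, α i).factorial)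
        ≤ 2 ^ (α a + ∑ i ∈ s, α i) * ((α a).factorial *
          ((2 ^ s.card) ^ (α a + ∑ i ∈ s, α i) * ∏ i ∈ s, (α i).factorial)) := by
          gcongr
          exact ih.trans (Nat.mul_le_mul_right _ h1)
      _ = _ := by rw [pow_succ, mul_pow]; ring

theorem factorial_len_rpow_le (α : Fin m → ℕ) {σ : ℝ} (hσ : 0 ≤ σ) :
    ((len α).factorial : ℝ) ^ σ ≤ (((2 : ℝ) ^ m) ^ σ) ^ len α * mfact α ^ σ := by
  rw [← Real.rpow_natCast (((2 : ℝ) ^ m) ^ σ), ← Real.rpow_mul (by positivity), mul_comm σ,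
    Real.rpow_mul (by positivity), Real.rpow_natCast,
    ← Real.mul_rpow (by positivity) (mfact_pos α).le]
  refine Real.rpow_le_rpow (by positivity) ?_ hσ
  have := factorial_sum_le Finset.univ α
  rw [Finset.card_univ, Fintype.card_fin] at this
  unfold mfact len
  exact_mod_cast this

theorem length_word (α : Fin m → ℕ) : (word α).length = len α := by
  simp [word, len, List.length_flatMap, ← List.ofFn_eq_map, List.sum_ofFn]

theorem len_count (w : List (Fin m)) : len (fun i => w.count i) = w.length := by
  rw [← length_word]; exact (perm_word w).length_eq.symm

end factorials

/-! ### Gevrey estimates at a point -/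

/-- The estimates `|∂^w f(x)| ≤ A h^|w| |w|!^σ` for all words `w` of coordinate directions. Up to
a change of `h` they are the Gevrey estimates with multi-indices, because
`α! ≤ |α|! ≤ (2^m)^|α| α!`. -/
def GevreyAt {m : ℕ} (σ A h : ℝ) (f : E m → ℂ) (x : E m) : Prop :=
  ∀ w : List (Fin m), ‖wordDeriv w f x‖ ≤ A * h ^ w.length * (w.length.factorial : ℝ) ^ σ

section gevreyAt

variable {m : ℕ} {σ A B h a b : ℝ} {f g : E m → ℂ} {x : E m}

theorem GevreyAt.nonneg (hf : GevreyAt σ A h f x) : 0 ≤ A := by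
  simpa [wordDeriv] using (norm_nonneg _).trans (hf [])

theorem gevreyAt_of_mderiv {Ω : TopologicalSpace.Opens (E m)} (hσ : 0 ≤ σ) (hA : 0 ≤ A)
    (hh : 0 ≤ h) (hf : ContDiffOn ℝ ∞ f Ω) (hx : x ∈ Ω)
    (H : ∀ α, ‖mderiv α f x‖ ≤ A * h ^ len α * mfact α ^ σ) : GevreyAt σ A h f x := by
  intro w
  rw [forall_wordDeriv hf w hx]
  refine (H _).trans ?_
  rw [len_count]
  refine mul_le_mul_of_nonneg_left ?_ (by positivity)
  refine Real.rpow_le_rpow (mfact_pos _).le ?_ hσ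
  exact (mfact_le_factorial_len _).trans_eq (by rw [len_count])

theorem GevreyAt.mderiv_le (hσ : 0 ≤ σ) (hh : 0 ≤ h) (hf : GevreyAt σ A h f x) (α : Fin m → ℕ) :
    ‖mderiv α f x‖ ≤ A * (h * ((2 : ℝ) ^ m) ^ σ) ^ len α * mfact α ^ σ := by
  refine (hf (word α)).trans ?_
  have hA := hf.nonneg
  rw [length_word, mul_pow, ← mul_assoc, mul_assoc (A * h ^ len α)]
  exact mul_le_mul_of_nonneg_left (factorial_len_rpow_le α hσ) (by positivity)

theorem GevreyAt.mono (hf : GevreyAt σ A a f x) (ha : 0 ≤ a) (hAB : A ≤ B) (hab : a ≤ b) :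
    GevreyAt σ B b f x := fun w => by
  have hA := hf.nonneg
  have hB := hA.trans hAB
  have := factorial_rpow_pos w.length σ
  refine (hf w).trans ?_
  gcongr

theorem gevreyAt_zero (hA : 0 ≤ A) (hh : 0 ≤ h) (hf : f =ᶠ[nhds x] 0) : GevreyAt σ A h f x := by
  intro w
  rw [wordDeriv_eq_zero_of_eventuallyEq w hf, norm_zero]
  have := factorial_rpow_pos w.length σ
  positivity

/-- A product of Gevrey functions is Gevrey of the same order: the constants `h` add up. -/
theorem GevreyAt.mul {Ω : TopologicalSpace.Opens (E m)} (hσ : 0 ≤ σ) (ha : 0 ≤ a) (hb : 0 ≤ b)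
    (hf : ContDiffOn ℝ ∞ f Ω) (hg : ContDiffOn ℝ ∞ g Ω) (hx : x ∈ Ω) (hfx : GevreyAt σ A a f x)
    (hgx : GevreyAt σ B b g x) : GevreyAt σ (A * B) (a + b) (f * g) x := by
  intro w
  refine (norm_wordDeriv_mul_le w hf hg hx (A := fun n => A * a ^ n * (n.factorial : ℝ) ^ σ)
    (B := fun n => B * b ^ n * (n.factorial : ℝ) ^ σ) hfx hgx).trans ?_
  rw [(Commute.all a b).add_pow', Finset.mul_sum, Finset.sum_mul]
  refine Finset.sum_le_sum fun p hp => ?_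
  have hA := hfx.nonneg
  have hB := hgx.nonneg
  have hp' : p.1 + p.2 = w.length := Finset.HasAntidiagonal.mem_antidiagonal.mp hp
  rw [← hp', nsmul_eq_mul]
  calc _ = A * B * ((((p.1 + p.2).choose p.1 : ℕ) : ℝ) * (a ^ p.1 * b ^ p.2)) *
        ((p.1.factorial : ℝ) ^ σ * (p.2.factorial : ℝ) ^ σ) := by ring
    _ ≤ _ := mul_le_mul_of_nonneg_left (factorial_rpow_mul_le _ _ hσ) (by positivity)

theorem GevreyAt.comp_affine (hg : ContDiff ℝ ∞ g) (y : E m) (c : ℝ)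
    (h' : GevreyAt σ A h g (y + c • x)) :
    GevreyAt σ A (|c| * h) (fun z => g (y + c • z)) x := by
  intro w
  rw [wordDeriv_comp_affine w hg, norm_mul, norm_pow, Complex.norm_real, Real.norm_eq_abs, mul_pow]
  refine (mul_le_mul_of_nonneg_left (h' w) (by positivity)).trans_eq (by ring)

/-- Taking derivatives preserves Gevrey estimates: `(j + k)! ≤ 2^{j+k} j! k!`. -/
theorem GevreyAt.wordDeriv (hσ : 0 ≤ σ) (hh : 0 ≤ h) (hf : GevreyAt σ A h f x)
    (v : List (Fin m)) :
    GevreyAt σ (A * ((2 : ℝ) ^ σ * h) ^ v.length * (v.length.factorial : ℝ) ^ σ) ((2 : ℝ) ^ σ * h)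
      (Gevrey.wordDeriv v f) x := by
  intro w
  have hA := hf.nonneg
  rw [← wordDeriv_append]
  refine (hf (v ++ w)).trans ?_
  rw [List.length_append]
  refine (mul_le_mul_of_nonneg_left (factorial_add_rpow_le v.length w.length hσ)
    (by positivity)).trans_eq ?_
  rw [mul_pow, mul_pow, pow_add, pow_add]
  ring

end gevreyAt

/-! ### Optimization of factorial bounds -/

section optimization

/-- The choice of the order `N` in the bounds `X ≤ C (b t)^N N!^s`: if `b` is small enough, they
imply exponential decay in `t^{-1/s}`. Instead of picking the optimal `N`, the `1/s`-th powers of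
the bounds are summed up to an exponential series. -/
theorem le_exp_neg_of_forall_le_pow_mul_factorial {s k X C t : ℝ} (hs : 0 < s) (hk : 0 < k)
    (ht : 0 < t) (hX : 0 ≤ X)
    (H : ∀ N : ℕ, X ≤ C * (((2 * k)⁻¹) ^ s * t) ^ N * (N.factorial : ℝ) ^ s) :
    X ≤ 2 ^ s * C * Real.exp (-(s * k) * t ^ (-(1 / s))) := by
  have hC : 0 ≤ C := hX.trans (by simpa using H 0)
  set y := t ^ (-(1 / s)) with hy
  have hy0 : 0 < y := Real.rpow_pos_of_pos ht _
  have hyt : t = (y⁻¹) ^ s := by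
    rw [hy, ← Real.rpow_neg ht.le, neg_neg, ← Real.rpow_mul ht.le, one_div_mul_cancel hs.ne',
      Real.rpow_one]
  have h1 : ∀ N : ℕ, X ^ (1 / s) * ((k * y) ^ N / N.factorial) ≤ C ^ (1 / s) * (1 / 2) ^ N := by
    intro N
    have h2 := Real.rpow_le_rpow hX (H N) (one_div_pos.mpr hs).le
    have e : C * (((2 * k)⁻¹) ^ s * t) ^ N * (N.factorial : ℝ) ^ s =
        C * (((2 * k)⁻¹ * y⁻¹) ^ N * N.factorial) ^ s := by
      rw [hyt, ← Real.mul_rpow (by positivity) (by positivity),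
        Real.mul_rpow (x := ((2 * k)⁻¹ * y⁻¹) ^ N) (by positivity) (by positivity),
        ← Real.rpow_natCast, ← Real.rpow_natCast, ← Real.rpow_mul (by positivity),
        ← Real.rpow_mul (by positivity), mul_comm s]
      ring
    rw [e, Real.mul_rpow hC (by positivity), ← Real.rpow_mul (by positivity),
      mul_one_div_cancel hs.ne', Real.rpow_one] at h2
    refine (mul_le_mul_of_nonneg_right h2 (by positivity)).trans_eq ?_
    rw [mul_assoc]
    congr 1
    have hN : (N.factorial : ℝ) ≠ 0 := by positivity
    field_simp
    rw [← mul_pow]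
    field_simp
  have h2 : X ^ (1 / s) * Real.exp (k * y) ≤ C ^ (1 / s) * 2 := by
    have e1 : HasSum (fun N : ℕ => (k * y) ^ N / N.factorial) (Real.exp (k * y)) := by
      rw [Real.exp_eq_exp_ℝ]
      exact NormedSpace.expSeries_div_hasSum_exp (k * y)
    exact hasSum_le h1 (e1.mul_left _) (hasSum_geometric_two.mul_left _)
  have h3 := Real.rpow_le_rpow (by positivity) h2 hs.le
  rw [Real.mul_rpow (by positivity) (by positivity), Real.mul_rpow (by positivity) (by positivity),
    ← Real.rpow_mul hX, ← Real.rpow_mul hC, one_div_mul_cancel hs.ne', Real.rpow_one,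
    Real.rpow_one, ← Real.exp_mul] at h3
  rw [neg_mul, Real.exp_neg, ← div_eq_mul_inv, le_div_iff₀ (Real.exp_pos _)]
  calc X * Real.exp (s * k * y) = X * Real.exp (k * y * s) := by ring_nf
    _ ≤ _ := h3
    _ = _ := mul_comm _ _

/-- Powers of `1/ε` are absorbed by a factorial to the power `s` and an exponential in
`ε^{-1/s}`. -/
theorem div_pow_le_factorial_mul_exp {s c ε : ℝ} (hs : 0 < s) (hc : 0 ≤ c) (hε : 0 < ε) (n : ℕ) :
    (c / ε) ^ n ≤ (n.factorial : ℝ) ^ s * Real.exp (s * c ^ (1 / s) * ε ^ (-(1 / s))) := by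
  have h0 : 0 ≤ c / ε := by positivity
  have h := Real.pow_div_factorial_le_exp ((c / ε) ^ (1 / s)) (by positivity) n
  rw [div_le_iff₀ (by positivity)] at h
  have h' := Real.rpow_le_rpow (by positivity) h hs.le
  rw [← Real.rpow_natCast, ← Real.rpow_mul h0, ← Real.rpow_mul h0,
    show 1 / s * n * s = n by field_simp, Real.rpow_natCast,
    Real.mul_rpow (by positivity) (by positivity), ← Real.exp_mul, Real.div_rpow hc hε.le] at h'
  refine h'.trans_eq ?_
  rw [mul_comm, Real.rpow_neg hε.le]
  congr 2
  rw [div_eq_mul_inv]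
  ring

end optimization

/-! ### Taylor expansion -/

section taylor

variable {m : ℕ}

/-- The `n`-th derivative of `t ↦ f (x + t v)` at `t = 0`, as a polynomial in `v`. -/
noncomputable def taylorTerm : ℕ → (E m → ℂ) → E m → E m → ℂ
  | 0, f, x, _ => f x
  | n + 1, f, x, v => ∑ i, (v i : ℂ) * taylorTerm n (pderiv i f) x v

theorem fderiv_apply_eq_sum (f : E m → ℂ) (x v : E m) :
    fderiv ℝ f x v = ∑ i, (v i : ℂ) * pderiv i f x := by
  conv_lhs => rw [← (EuclideanSpace.basisFun (Fin m) ℝ).sum_repr v]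
  simp [pderiv]

theorem hasDerivAt_taylorTerm (n : ℕ) {f : E m → ℂ} (hf : ContDiff ℝ ∞ f) (x v : E m) (t : ℝ) :
    HasDerivAt (fun t : ℝ => taylorTerm n f (x + t • v) v)
      (taylorTerm (n + 1) f (x + t • v) v) t := by
  induction n generalizing f with
  | zero =>
    simp only [taylorTerm]
    rw [← fderiv_apply_eq_sum]
    have h1 : HasDerivAt (fun t : ℝ => x + t • v) v t := by
      simpa using ((hasDerivAt_id t).smul_const v).const_add x
    exact ((hf.differentiable (by simp)) (x + t • v)).hasFDerivAt.comp_hasDerivAt t h1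
  | succ n ih =>
    rw [taylorTerm]
    exact HasDerivAt.fun_sum fun i _ => (ih (contDiff_pderiv i hf)).const_mul _

theorem norm_taylorTerm_le (n : ℕ) {f : E m → ℂ} {x v : E m} {B : ℝ}
    (hB : ∀ w : List (Fin m), w.length = n → ‖wordDeriv w f x‖ ≤ B) :
    ‖taylorTerm n f x v‖ ≤ (∑ i, |v i|) ^ n * B := by
  induction n generalizing f with
  | zero => simpa [taylorTerm, wordDeriv] using hB [] rfl
  | succ n ih =>
    rw [taylorTerm, pow_succ', Finset.sum_mul, Finset.sum_mul]
    refine (norm_sum_le _ _).trans (Finset.sum_le_sum fun i _ => ?_)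
    rw [norm_mul, Complex.norm_real, Real.norm_eq_abs, mul_assoc]
    exact mul_le_mul_of_nonneg_left (ih fun w hw => hB (i :: w) (by simp [hw])) (abs_nonneg _)

/-- Taylor's formula for a sequence of successive derivatives `u n`. -/
theorem norm_sub_sum_taylor_le (N : ℕ) {u : ℕ → ℝ → ℂ} {C : ℝ}
    (hu : ∀ n t, HasDerivAt (u n) (u (n + 1) t) t) (hC : ∀ t ∈ Icc (0 : ℝ) 1, ‖u N t‖ ≤ C) :
    ∀ t ∈ Icc (0 : ℝ) 1, ‖u 0 t - ∑ n ∈ Finset.range N, ((t ^ n / n.factorial : ℝ) : ℂ) * u n 0‖ ≤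
      C * (t ^ N / N.factorial) := by
  induction N generalizing u with
  | zero => simpa using hC
  | succ N ih =>
    have ih' := ih (u := fun n => u (n + 1)) (fun n => hu (n + 1)) hC
    have hd : ∀ t : ℝ, HasDerivAt
        (fun t : ℝ => u 0 t - ∑ n ∈ Finset.range (N + 1), ((t ^ n / n.factorial : ℝ) : ℂ) * u n 0)
        (u 1 t - ∑ n ∈ Finset.range N, ((t ^ n / n.factorial : ℝ) : ℂ) * u (n + 1) 0) t := by
      intro t
      simp only [Finset.sum_range_succ']
      refine (hu 0 t).sub ?_
      simp only [pow_zero]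
      refine HasDerivAt.add_const _ (HasDerivAt.fun_sum fun n _ => ?_)
      refine HasDerivAt.mul_const ?_ _
      have h1 : HasDerivAt (fun t : ℝ => t ^ (n + 1) / ((n + 1).factorial : ℝ))
          (t ^ n / n.factorial) t := by
        have := (hasDerivAt_pow (n + 1) t).div_const ((n + 1).factorial : ℝ)
        refine this.congr_deriv ?_
        rw [Nat.factorial_succ]
        push_cast
        have : (n.factorial : ℝ) ≠ 0 := by positivity
        have : (n : ℝ) + 1 ≠ 0 := by positivity
        field_simp
      exact h1.ofReal_comp
    refine image_norm_le_of_norm_deriv_right_le_deriv_boundary (B := fun t : ℝ =>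
        C * (t ^ (N + 1) / (N + 1).factorial)) (B' := fun t : ℝ => C * (t ^ N / N.factorial))
      (fun t _ => (hd t).continuousAt.continuousWithinAt)
      (fun t _ => (hd t).hasDerivWithinAt) ?_ ?_ ?_
    · simp [Finset.sum_range_succ']
    · intro t
      have := ((hasDerivAt_pow (N + 1) t).div_const ((N + 1).factorial : ℝ)).const_mul C
      refine this.congr_deriv ?_
      rw [Nat.factorial_succ]
      push_cast
      have : (N.factorial : ℝ) ≠ 0 := by positivity
      have : (N : ℝ) + 1 ≠ 0 := by positivity
      field_simp
    · exact fun t ht => ih' t ⟨ht.1, ht.2.le⟩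

/-- Taylor's formula with a remainder that only involves derivatives of order `N`. -/
theorem norm_sub_taylorTerm_le (N : ℕ) {f : E m → ℂ} (hf : ContDiff ℝ ∞ f) (x v : E m) {B : ℝ}
    (hB : ∀ w : List (Fin m), w.length = N → ∀ y, ‖wordDeriv w f y‖ ≤ B) :
    ‖f (x + v) - ∑ n ∈ Finset.range N, ((n.factorial : ℂ))⁻¹ * taylorTerm n f x v‖ ≤
      (∑ i, |v i|) ^ N * B / N.factorial := by
  have := norm_sub_sum_taylor_le N (u := fun n t => taylorTerm n f (x + t • v) v)
    (hasDerivAt_taylorTerm · hf x v)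
    (fun t _ => norm_taylorTerm_le N (v := v) fun w hw => hB w hw (x + t • v)) 1 (by simp)
  simpa [taylorTerm, div_eq_mul_inv] using this

theorem sum_abs_le (v : E m) : ∑ i, |v i| ≤ m * ‖v‖ := by
  refine (Finset.sum_le_card_nsmul _ _ ‖v‖ fun i _ => PiLp.norm_apply_le v i).trans_eq ?_
  simp

theorem norm_le_sum_abs (v : E m) : ‖v‖ ≤ ∑ i, |v i| := by
  conv_lhs => rw [← (EuclideanSpace.basisFun (Fin m) ℝ).sum_repr v]
  refine (norm_sum_le _ _).trans_eq ?_
  simp [norm_smul]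

end taylor

/-! ### A local Sobolev inequality -/

section sobolev

variable {m : ℕ}

/-- The fundamental theorem of calculus for `t ↦ (t - a - 1) u(t)`, which vanishes at `a + 1`. -/
theorem enorm_le_lintegral_Icc {u u' : ℝ → ℂ} (hu : ∀ t, HasDerivAt u (u' t) t)
    (hu' : Continuous u') (a : ℝ) :
    ‖u a‖ₑ ≤ ∫⁻ t in Icc a (a + 1), (‖u t‖ₑ + ‖u' t‖ₑ) := by
  have hc : Continuous u := continuous_iff_continuousAt.mpr fun t => (hu t).continuousAt
  have hd : ∀ t, HasDerivAt (fun t : ℝ => ((t - a - 1 : ℝ) : ℂ) * u t)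
      (u t + ((t - a - 1 : ℝ) : ℂ) * u' t) t := by
    intro t
    have h1 : HasDerivAt (fun t : ℝ => ((t - a - 1 : ℝ) : ℂ)) ((1 : ℝ) : ℂ) t :=
      (((hasDerivAt_id t).sub_const a).sub_const 1).ofReal_comp
    simpa using h1.fun_mul (hu t)
  have h1 : ∫ t in a..(a + 1), (u t + ((t - a - 1 : ℝ) : ℂ) * u' t) = u a := by
    rw [intervalIntegral.integral_eq_sub_of_hasDerivAt (fun t _ => hd t)]
    · simp
    · exact Continuous.intervalIntegrable (by fun_prop) _ _
  rw [← h1, intervalIntegral.integral_of_le (by linarith), integral_Icc_eq_integral_Ioc.symm]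
  refine (enorm_integral_le_lintegral_enorm _).trans ?_
  refine setLIntegral_mono' measurableSet_Icc fun t ht => ?_
  refine (enorm_add_le _ _).trans (add_le_add le_rfl ?_)
  rw [enorm_mul]
  refine mul_le_of_le_one_left (by simp) ?_
  rw [← ofReal_norm, Complex.norm_real, Real.norm_eq_abs]
  simpa using abs_le.mpr ⟨by linarith [ht.1], by linarith [ht.2]⟩

theorem toLp_update (y : Fin m → ℝ) (i : Fin m) (ξ : ℝ) :
    WithLp.toLp 2 (Function.update y i ξ) =
      (WithLp.toLp 2 (Function.update y i 0) + ξ • EuclideanSpace.single i 1 : E m) := by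
  ext j
  by_cases h : j = i
  · subst h; simp
  · simp [h]

/-- The Sobolev inequality in the variables of `s` on the cube with corner `x`; the induction
integrates over one more coordinate. -/
theorem enorm_le_lmarginal (x : Fin m → ℝ) {F : (Fin m → ℝ) → ℝ≥0∞} (hF : Measurable F)
    (s : Finset (Fin m)) {g : E m → ℂ} (hg : ContDiff ℝ ∞ g)
    (H : ∀ w : List (Fin m), w.length ≤ s.card → ∀ z, (∀ i, z i ∈ Icc (x i) (x i + 1)) →
      ‖wordDeriv w g (WithLp.toLp 2 z)‖ₑ ≤ F z)
    (y : Fin m → ℝ) (hy : ∀ i, y i ∈ Icc (x i) (x i + 1)) (hys : ∀ i ∈ s, y i = x i) :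
    ‖g (WithLp.toLp 2 y)‖ₑ ≤ 2 ^ s.card * (∫⋯∫⁻_s, F ∂(fun _ => volume)) y := by
  induction s using Finset.induction_on generalizing g y with
  | empty => simpa [wordDeriv] using H [] (by simp) y hy
  | insert i s hi ih =>
    rw [lmarginal_insert _ hF hi, Finset.card_insert_of_notMem hi]
    rw [Finset.card_insert_of_notMem hi] at H
    have hline : (fun ξ : ℝ => (WithLp.toLp 2 (Function.update y i ξ) : E m)) = fun ξ : ℝ =>
        (WithLp.toLp 2 (Function.update y i 0) + ξ • EuclideanSpace.single i 1 : E m) :=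
      funext fun ξ => toLp_update y i ξ
    have hd : ∀ t, HasDerivAt (fun ξ : ℝ => g (WithLp.toLp 2 (Function.update y i ξ)))
        (pderiv i g (WithLp.toLp 2 (Function.update y i t))) t := by
      intro t
      have h1 : HasDerivAt (fun ξ : ℝ => (WithLp.toLp 2 (Function.update y i ξ) : E m))
          (EuclideanSpace.single i 1) t := by
        rw [hline]
        simpa using ((hasDerivAt_id t).smul_const
          (EuclideanSpace.single i (1 : ℝ) : E m)).const_add (WithLp.toLp 2 (Function.update y i 0))
      exact ((hg.differentiable (by simp)) _).hasFDerivAt.comp_hasDerivAt t h1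
    have hc : Continuous fun ξ : ℝ => pderiv i g (WithLp.toLp 2 (Function.update y i ξ)) := by
      refine (contDiff_pderiv i hg).continuous.comp (?_ :
        Continuous fun ξ : ℝ => (WithLp.toLp 2 (Function.update y i ξ) : E m))
      rw [hline]
      fun_prop
    have h1 := enorm_le_lintegral_Icc hd hc (x i)
    rw [show Function.update y i (x i) = y by
      rw [← hys i (Finset.mem_insert_self i s), Function.update_eq_self]] at h1
    refine h1.trans ?_
    rw [← lintegral_const_mul' _ _ (by simp)]
    refine (setLIntegral_mono' measurableSet_Icc fun t ht => ?_).trans (setLIntegral_le_lintegral _ _)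
    have hu : ∀ j, Function.update y i t j ∈ Icc (x j) (x j + 1) := by
      intro j
      by_cases h : j = i
      · subst h; simpa using ht
      · simpa [h] using hy j
    have hus : ∀ j ∈ s, Function.update y i t j = x j := by
      intro j hj
      have h : j ≠ i := fun h => hi (h ▸ hj)
      simpa [h] using hys j (Finset.mem_insert_of_mem hj)
    have a1 := ih hg (fun w hw => H w (by omega)) _ hu hus
    have a2 := ih (contDiff_pderiv i hg) (fun w hw => H (i :: w) (by simpa using hw)) _ hu hus
    refine (add_le_add a1 a2).trans_eq ?_
    rw [pow_succ]
    ring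

/-- Pointwise values are bounded by local `L¹` norms of finitely many derivatives. -/
theorem exists_enorm_le_sum_lintegral (m : ℕ) : ∃ S : Finset (List (Fin m)),
    ∀ g : E m → ℂ, ContDiff ℝ ∞ g → ∀ x,
      ‖g x‖ₑ ≤ 2 ^ m * ∑ w ∈ S, ∫⁻ y in Metric.closedBall x m, ‖wordDeriv w g y‖ₑ := by
  refine ⟨(List.finite_length_le (Fin m) m).toFinset, fun g hg x => ?_⟩
  set S := (List.finite_length_le (Fin m) m).toFinset
  set Q : Set (Fin m → ℝ) := {z | ∀ i, z i ∈ Icc (x i) (x i + 1)} with hQ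
  have hQm : MeasurableSet Q := by
    have : Q = Set.pi univ fun i => Icc (x i) (x i + 1) := by
      ext z
      simp only [hQ, mem_pi, mem_ofPred_eq, mem_univ, true_imp_iff]
    rw [this]
    exact MeasurableSet.univ_pi fun i => measurableSet_Icc
  have hGm : ∀ w, Measurable fun z : E m => ‖wordDeriv w g z‖ₑ := fun w =>
    (contDiff_wordDeriv w hg).continuous.enorm.measurable
  have hGm' : ∀ w, Measurable fun z : Fin m → ℝ => ‖wordDeriv w g (WithLp.toLp 2 z)‖ₑ := fun w =>
    (hGm w).comp (MeasurableEquiv.toLp 2 (Fin m → ℝ)).measurable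
  have hF : Measurable (Q.indicator fun z => ∑ w ∈ S, ‖wordDeriv w g (WithLp.toLp 2 z)‖ₑ) :=
    (Finset.measurable_fun_sum S fun w _ => hGm' w).indicator hQm
  have h1 := enorm_le_lmarginal x.ofLp hF Finset.univ hg (fun w hw z hz => ?_) x.ofLp
    (fun i => by simp) fun i _ => rfl
  · refine h1.trans ?_
    rw [Finset.card_univ, Fintype.card_fin, lmarginal_univ]
    refine mul_le_mul_right (?_ : ∫⁻ z, _ ∂(volume : Measure (Fin m → ℝ)) ≤ _) _
    rw [lintegral_indicator hQm, lintegral_finsetSum _ fun w _ => hGm' w]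
    refine Finset.sum_le_sum fun w _ => ?_
    rw [← lintegral_indicator Metric.isClosed_closedBall.measurableSet,
      ← (EuclideanSpace.volume_preserving_symm_measurableEquiv_toLp (Fin m)).symm.lintegral_comp
        ((hGm w).indicator Metric.isClosed_closedBall.measurableSet), ← lintegral_indicator hQm]
    refine lintegral_mono fun z => ?_
    by_cases hz : z ∈ Q
    · have : (WithLp.toLp 2 z : E m) ∈ Metric.closedBall x m := by
        rw [Metric.mem_closedBall, dist_eq_norm]
        refine (norm_le_sum_abs _).trans ?_
        refine (Finset.sum_le_card_nsmul _ _ 1 fun i _ => ?_).trans_eq (by simp)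
        have := hz i
        simpa using abs_le.mpr ⟨by linarith [this.1], by linarith [this.2]⟩
      simp [hz, this]
    · simp [hz]
  · rw [indicator_of_mem (show z ∈ Q from hz)]
    refine Finset.single_le_sum (f := fun w => ‖wordDeriv w g (WithLp.toLp 2 z)‖ₑ)
      (fun _ _ => by simp) ?_
    simpa [S] using hw

end sobolev

/-! ### Decay and moments of the mollifier -/

section mollifier

variable {m : ℕ} {σ : ℝ} {φ : E m → ℂ}

theorem lintegral_pow_mul_mderiv_le {b : ℝ} (hb : 0 < b) (α β : Fin m → ℕ) :
    ∫⁻ x, ‖x‖ₑ ^ len β * ‖mderiv α φ x‖ₑ ≤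
      ENNReal.ofReal (b ^ len (α + β) * mfact α ^ σ * mfact β ^ σ) * gsNorm b σ φ := by
  set D := b ^ len (α + β) * mfact α ^ σ * mfact β ^ σ with hD
  have hα := Real.rpow_pos_of_pos (mfact_pos α) σ
  have hβ := Real.rpow_pos_of_pos (mfact_pos β) σ
  have hD0 : 0 < D := by positivity
  have h1 : ∫⁻ x, ENNReal.ofReal (‖x‖ ^ len β / D * ‖mderiv α φ x‖) ≤ gsNorm b σ φ :=
    le_iSup₂ (f := fun α β : Fin m → ℕ => ∫⁻ x, ENNReal.ofReal
      (‖x‖ ^ len β / (b ^ len (α + β) * mfact α ^ σ * mfact β ^ σ) * ‖mderiv α φ x‖)) α β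
  refine le_trans (le_of_eq ?_) (mul_le_mul_right h1 _)
  rw [← lintegral_const_mul' _ _ (by simp)]
  congr 1
  funext x
  rw [← ENNReal.ofReal_mul hD0.le, ← ofReal_norm, ← ofReal_norm, ← ENNReal.ofReal_pow (norm_nonneg _),
    ← ENNReal.ofReal_mul (by positivity)]
  congr 1
  field_simp

/-- The bounds on the norms `‖φ‖_{b,σ}` in terms of words and of powers of `|x|`. -/
theorem IsMollifier.exists_lintegral_le (hφ : IsMollifier σ φ) (hσ : 0 ≤ σ) {b : ℝ} (hb : 0 < b) :
    ∃ C, 0 ≤ C ∧ ∀ (w : List (Fin m)) (N : ℕ), ∫⁻ x, ‖x‖ₑ ^ N * ‖wordDeriv w φ x‖ₑ ≤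
      ENNReal.ofReal (C * b ^ (w.length + N) * (w.length.factorial : ℝ) ^ σ *
        (N.factorial : ℝ) ^ σ) := by
  refine ⟨(gsNorm b σ φ).toReal, ENNReal.toReal_nonneg, fun w N => ?_⟩
  -- A multi-index `β` with `|β| = N` and `β! = N!` is concentrated in a single coordinate; in
  -- dimension `0` there is none for `N ≠ 0`, but then `‖x‖ = 0`.
  by_cases h : N ≠ 0 ∧ IsEmpty (Fin m)
  · have h0 : ∀ x : E m, ‖x‖ₑ = 0 := fun x => by
      have := h.2
      rw [Subsingleton.elim x 0, enorm_zero]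
    simp [h0, h.1]
  · obtain ⟨β, hβ1, hβ2⟩ : ∃ β : Fin m → ℕ, len β = N ∧ mfact β = N.factorial := by
      by_cases hN : N = 0
      · exact ⟨0, by simp [len, hN], by simp [mfact, hN]⟩
      · have : Nonempty (Fin m) := not_isEmpty_iff.mp fun h' => h ⟨hN, h'⟩
        obtain ⟨i⟩ := this
        refine ⟨Pi.single i N, by simp [len], ?_⟩
        unfold mfact
        rw [Finset.prod_eq_single i (fun j _ hj => by simp [hj]) (by simp)]
        simp
    have e : wordDeriv w φ = mderiv (fun i => w.count i) φ :=
      funext fun x => forall_wordDeriv (Ω := ⊤) hφ.contDiff.contDiffOn w trivial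
    have h1 := lintegral_pow_mul_mderiv_le (σ := σ) (φ := φ) hb (fun i => w.count i) β
    rw [e, ← hβ1]
    refine h1.trans ?_
    have hl : len ((fun i => w.count i) + β) = w.length + N := by
      rw [← len_count w, ← hβ1]
      simp [len, Finset.sum_add_distrib]
    rw [hl, hβ1, hβ2]
    conv_lhs => rw [← ENNReal.ofReal_toReal (hφ.gsNorm_lt_top b hb).ne,
      ← ENNReal.ofReal_mul (by have := mfact_rpow_nonneg (fun i => w.count i) σ; positivity)]
    refine ENNReal.ofReal_le_ofReal ?_
    have h2 : mfact (fun i => w.count i) ^ σ ≤ (w.length.factorial : ℝ) ^ σ :=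
      Real.rpow_le_rpow (mfact_pos _).le
        ((mfact_le_factorial_len _).trans_eq (by rw [len_count])) hσ
    calc _ = (gsNorm b σ φ).toReal * b ^ (w.length + N) * (N.factorial : ℝ) ^ σ *
          mfact (fun i => w.count i) ^ σ := by ring
      _ ≤ (gsNorm b σ φ).toReal * b ^ (w.length + N) * (N.factorial : ℝ) ^ σ *
          (w.length.factorial : ℝ) ^ σ := by gcongr
      _ = _ := by ring

theorem IsMollifier.integrable_pow_mul (hφ : IsMollifier σ φ) (hσ : 0 ≤ σ) (N : ℕ) :
    Integrable fun x => ‖x‖ ^ N * ‖φ x‖ := by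
  obtain ⟨C, _, H⟩ := hφ.exists_lintegral_le hσ one_pos
  have hc := hφ.contDiff.continuous
  refine ⟨Continuous.aestronglyMeasurable (by fun_prop), ?_⟩
  refine lt_of_le_of_lt (le_of_eq ?_) ((H [] N).trans_lt ENNReal.ofReal_lt_top)
  refine lintegral_congr fun x => ?_
  simp [wordDeriv, enorm_mul, enorm_pow]

theorem IsMollifier.integrable (hφ : IsMollifier σ φ) (hσ : 0 ≤ σ) : Integrable φ := by
  have := hφ.integrable_pow_mul hσ 0
  simp only [pow_zero, one_mul] at this
  exact (integrable_norm_iff hφ.contDiff.continuous.aestronglyMeasurable).mp this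

theorem IsMollifier.exists_integral_pow_mul_le (hφ : IsMollifier σ φ) (hσ : 0 ≤ σ) {b : ℝ}
    (hb : 0 < b) : ∃ C, 0 ≤ C ∧ ∀ N : ℕ, ∫ x, ‖x‖ ^ N * ‖φ x‖ ≤
      C * b ^ N * (N.factorial : ℝ) ^ σ := by
  obtain ⟨C, hC, H⟩ := hφ.exists_lintegral_le hσ hb
  refine ⟨C, hC, fun N => ?_⟩
  have hc := hφ.contDiff.continuous
  rw [integral_eq_lintegral_of_nonneg_ae (Filter.Eventually.of_forall fun x => by positivity)
    (Continuous.aestronglyMeasurable (by fun_prop))]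
  have := factorial_rpow_pos N σ
  refine ENNReal.toReal_le_of_le_ofReal (by positivity) ?_
  refine le_trans (le_of_eq (lintegral_congr fun x => ?_)) ((H [] N).trans_eq ?_)
  · rw [ENNReal.ofReal_mul (by positivity), ENNReal.ofReal_pow (norm_nonneg _), ofReal_norm,
      ofReal_norm]
    rfl
  · simp

/-- Pointwise bounds for the mollifier, from the integral ones by the local Sobolev inequality. The
weight `‖x‖^N` can be moved into the integrals away from the origin. -/
theorem IsMollifier.exists_pow_mul_norm_le (hφ : IsMollifier σ φ) (hσ : 0 ≤ σ) {b : ℝ}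
    (hb : 0 < b) : ∃ C, 0 ≤ C ∧ ∀ (w : List (Fin m)) (N : ℕ) (x : E m), N = 0 ∨ 2 * (m : ℝ) ≤ ‖x‖ →
      ‖x‖ ^ N * ‖wordDeriv w φ x‖ ≤
        C * b ^ N * (N.factorial : ℝ) ^ σ * (w.length.factorial : ℝ) ^ σ := by
  obtain ⟨S, hS⟩ := exists_enorm_le_sum_lintegral m
  -- The factor `1/2` accounts for `‖y‖ ≥ ‖x‖/2` on the ball, the other bound for the constant in
  -- `(j + k)!^σ ≤ (2^σ)^(j+k) j!^σ k!^σ`.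
  set b' := min (b / 2) (((2 : ℝ) ^ σ)⁻¹) with hb'
  have hb'0 : 0 < b' := lt_min (by positivity) (by positivity)
  obtain ⟨C, hC, H⟩ := hφ.exists_lintegral_le hσ hb'0
  refine ⟨2 ^ m * (C * ∑ t ∈ S, (t.length.factorial : ℝ) ^ σ),
    mul_nonneg (by positivity) (mul_nonneg hC (Finset.sum_nonneg fun t _ =>
      (factorial_rpow_pos _ σ).le)), fun w N x hx => ?_⟩
  have hN := factorial_rpow_pos N σ
  have hw := factorial_rpow_pos w.length σ
  have h1 := hS _ (contDiff_wordDeriv w hφ.contDiff) x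
  have h2 : ∀ t ∈ S, (‖x‖ₑ / 2) ^ N *
      ∫⁻ y in Metric.closedBall x m, ‖wordDeriv t (wordDeriv w φ) y‖ₑ ≤
        ENNReal.ofReal (C * (b / 2) ^ N * (N.factorial : ℝ) ^ σ * (w.length.factorial : ℝ) ^ σ *
          (t.length.factorial : ℝ) ^ σ) := by
    intro t _
    have h3 := H (w ++ t) N
    rw [← lintegral_const_mul' _ _ (by finiteness)]
    have h4 : ∫⁻ y in Metric.closedBall x m, (‖x‖ₑ / 2) ^ N *
        ‖wordDeriv t (wordDeriv w φ) y‖ₑ ≤ ∫⁻ y, ‖y‖ₑ ^ N * ‖wordDeriv (w ++ t) φ y‖ₑ := by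
      refine (setLIntegral_mono' Metric.isClosed_closedBall.measurableSet fun y hy => ?_).trans
        (setLIntegral_le_lintegral _ _)
      rw [wordDeriv_append]
      refine mul_le_mul_left ?_ _
      rcases hx with rfl | hx
      · simp
      · refine pow_le_pow_left' ?_ N
        have : ‖x‖ / 2 ≤ ‖y‖ := by
          have h5 : ‖x‖ ≤ ‖y‖ + ‖x - y‖ := by
            simpa using norm_add_le y (x - y)
          rw [Metric.mem_closedBall, dist_comm, dist_eq_norm] at hy
          linarith
        have e : ‖x‖ₑ / 2 = ENNReal.ofReal (‖x‖ / 2) := by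
          rw [ENNReal.ofReal_div_of_pos (by norm_num), ofReal_norm, ENNReal.ofReal_ofNat]
        rw [e, ← ofReal_norm]
        exact ENNReal.ofReal_le_ofReal this
    refine h4.trans (h3.trans (ENNReal.ofReal_le_ofReal ?_))
    rw [List.length_append]
    have ht := factorial_rpow_pos t.length σ
    have h5 : b' ^ (w.length + t.length) * (((2 : ℝ) ^ σ) ^ (w.length + t.length)) ≤ 1 := by
      rw [← mul_pow]
      refine pow_le_one₀ (by positivity) ?_
      calc b' * (2 : ℝ) ^ σ ≤ ((2 : ℝ) ^ σ)⁻¹ * (2 : ℝ) ^ σ := by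
            gcongr; exact min_le_right _ _
        _ = 1 := inv_mul_cancel₀ (by positivity)
    have h6 : b' ^ N ≤ (b / 2) ^ N := by gcongr; exact min_le_left _ _
    calc C * b' ^ (w.length + t.length + N) * ((w.length + t.length).factorial : ℝ) ^ σ *
          (N.factorial : ℝ) ^ σ
        ≤ C * b' ^ (w.length + t.length + N) * (((2 : ℝ) ^ σ) ^ (w.length + t.length) *
          ((w.length.factorial : ℝ) ^ σ * (t.length.factorial : ℝ) ^ σ)) *
          (N.factorial : ℝ) ^ σ := by
          gcongr
          exact factorial_add_rpow_le _ _ hσ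
      _ = (b' ^ (w.length + t.length) * (((2 : ℝ) ^ σ) ^ (w.length + t.length))) *
          (C * b' ^ N * (N.factorial : ℝ) ^ σ * (w.length.factorial : ℝ) ^ σ *
          (t.length.factorial : ℝ) ^ σ) := by rw [pow_add b' (_ + _) N]; ring
      _ ≤ 1 * (C * (b / 2) ^ N * (N.factorial : ℝ) ^ σ * (w.length.factorial : ℝ) ^ σ *
          (t.length.factorial : ℝ) ^ σ) := by gcongr
      _ = _ := one_mul _
  have h3 : ENNReal.ofReal ((‖x‖ / 2) ^ N * ‖wordDeriv w φ x‖) ≤ ENNReal.ofReal (2 ^ m * ∑ t ∈ S,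
      C * (b / 2) ^ N * (N.factorial : ℝ) ^ σ * (w.length.factorial : ℝ) ^ σ *
          (t.length.factorial : ℝ) ^ σ) := by
    rw [ENNReal.ofReal_mul (by positivity), ENNReal.ofReal_pow (by positivity), ofReal_norm,
      ENNReal.ofReal_div_of_pos (by norm_num), ofReal_norm, ENNReal.ofReal_ofNat,
      ENNReal.ofReal_mul (by positivity), ENNReal.ofReal_pow (by norm_num), ENNReal.ofReal_ofNat,
      ENNReal.ofReal_sum_of_nonneg fun t _ => by
        have ht := factorial_rpow_pos t.length σ
        positivity]
    refine (mul_le_mul_right h1 _).trans ?_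
    rw [mul_left_comm, Finset.mul_sum]
    exact mul_le_mul_right (Finset.sum_le_sum h2) _
  rw [ENNReal.ofReal_le_ofReal_iff (mul_nonneg (by positivity) (Finset.sum_nonneg fun t _ => by
        have ht := factorial_rpow_pos t.length σ
        positivity)), ← Finset.mul_sum, div_pow, div_pow, div_mul_eq_mul_div,
    div_le_iff₀ (by positivity)] at h3
  refine h3.trans_eq ?_
  field_simp

theorem IsMollifier.exists_gevreyAt (hφ : IsMollifier σ φ) (hσ : 0 ≤ σ) :
    ∃ C, ∀ x, GevreyAt σ C 1 φ x := by
  obtain ⟨C, _, H⟩ := hφ.exists_pow_mul_norm_le hσ one_pos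
  exact ⟨C, fun x w => by simpa using H w 0 x (Or.inl rfl)⟩

/-- The derivatives of the mollifier decay faster than `exp(-k |x|^{1/σ})` for every `k`. The bound
is stated with a parameter `t ≥ 1 / |x|`. -/
theorem IsMollifier.exists_norm_le_exp (hφ : IsMollifier σ φ) (hσ : 0 < σ) {k : ℝ} (hk : 0 < k) :
    ∃ C, 0 ≤ C ∧ ∀ (w : List (Fin m)) (x : E m) (t : ℝ), 0 < t → 2 * (m : ℝ) ≤ ‖x‖ → t⁻¹ ≤ ‖x‖ →
      ‖wordDeriv w φ x‖ ≤ C * Real.exp (-k * t ^ (-(1 / σ))) * (w.length.factorial : ℝ) ^ σ := by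
  have hb : 0 < ((2 * (k / σ))⁻¹) ^ σ := by positivity
  obtain ⟨C, hC, H⟩ := hφ.exists_pow_mul_norm_le hσ.le hb
  refine ⟨2 ^ σ * C, by positivity, fun w x t ht hx1 hx2 => ?_⟩
  have hw := factorial_rpow_pos w.length σ
  rw [← div_le_iff₀ hw]
  have := le_exp_neg_of_forall_le_pow_mul_factorial (X := ‖wordDeriv w φ x‖ /
    (w.length.factorial : ℝ) ^ σ) (C := C) (t := t) (k := k / σ) hσ (by positivity) ht (by positivity)
    fun N => by
      have hN := factorial_rpow_pos N σ
      have h1 := H w N x (Or.inr hx1)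
      have h2 : (t⁻¹) ^ N ≤ ‖x‖ ^ N := by gcongr
      rw [div_le_iff₀ hw, mul_pow]
      calc ‖wordDeriv w φ x‖ = t ^ N * ((t⁻¹) ^ N * ‖wordDeriv w φ x‖) := by
            rw [← mul_assoc, ← mul_pow, mul_inv_cancel₀ ht.ne', one_pow, one_mul]
        _ ≤ t ^ N * (‖x‖ ^ N * ‖wordDeriv w φ x‖) := by gcongr
        _ ≤ _ := mul_le_mul_of_nonneg_left h1 (by positivity)
        _ = _ := by ring
  rwa [mul_div_cancel₀ _ hσ.ne'] at this

/-- Decay of the tails of the mollifier in `L¹`. -/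
theorem IsMollifier.exists_setIntegral_le_exp (hφ : IsMollifier σ φ) (hσ : 0 < σ) {k : ℝ}
    (hk : 0 < k) : ∃ C, 0 ≤ C ∧ ∀ t : ℝ, 0 < t →
      ∫ x in {x | t⁻¹ ≤ ‖x‖}, ‖φ x‖ ≤ C * Real.exp (-k * t ^ (-(1 / σ))) := by
  have hb : 0 < ((2 * (k / σ))⁻¹) ^ σ := by positivity
  obtain ⟨C, hC, H⟩ := hφ.exists_integral_pow_mul_le hσ.le hb
  refine ⟨2 ^ σ * C, by positivity, fun t ht => ?_⟩
  have := le_exp_neg_of_forall_le_pow_mul_factorial (X := ∫ x in {x | t⁻¹ ≤ ‖x‖}, ‖φ x‖) (C := C)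
    (t := t) (k := k / σ) hσ (by positivity) ht (integral_nonneg fun x => norm_nonneg _)
    fun N => by
      rw [mul_pow]
      have hi := hφ.integrable_pow_mul hσ.le N
      calc ∫ x in {x | t⁻¹ ≤ ‖x‖}, ‖φ x‖ ≤ ∫ x in {x | t⁻¹ ≤ ‖x‖}, t ^ N * (‖x‖ ^ N * ‖φ x‖) := by
            refine setIntegral_mono_on (hφ.integrable hσ.le).norm.integrableOn
              (hi.const_mul _).integrableOn (measurableSet_le measurable_const measurable_norm)
              fun x hx => ?_
            rw [← mul_assoc, ← mul_pow]
            refine le_mul_of_one_le_left (norm_nonneg _) (one_le_pow₀ ?_)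
            have hx' : t⁻¹ ≤ ‖x‖ := hx
            rwa [inv_le_iff_one_le_mul₀' ht] at hx'
        _ ≤ ∫ x, t ^ N * (‖x‖ ^ N * ‖φ x‖) :=
            setIntegral_le_integral (hi.const_mul _) (Filter.Eventually.of_forall fun x => by
              dsimp only [Pi.zero_apply]; positivity)
        _ = t ^ N * ∫ x, ‖x‖ ^ N * ‖φ x‖ := integral_const_mul _ _
        _ ≤ t ^ N * (C * (((2 * (k / σ))⁻¹) ^ σ) ^ N * (N.factorial : ℝ) ^ σ) := by
            gcongr
            exact H N
        _ = _ := by ring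
  rwa [mul_div_cancel₀ _ hσ.ne'] at this

theorem norm_mpow_le (x : E m) (α : Fin m → ℕ) : ‖(mpow x α : ℂ)‖ ≤ ‖x‖ ^ len α := by
  rw [Complex.norm_real, Real.norm_eq_abs, mpow, Finset.abs_prod, len, ← Finset.prod_pow_eq_pow_sum]
  refine Finset.prod_le_prod (fun _ _ => abs_nonneg _) fun i _ => ?_
  rw [abs_pow]
  exact pow_le_pow_left₀ (abs_nonneg _) (PiLp.norm_apply_le x i) _

theorem continuous_mpow (α : Fin m → ℕ) : Continuous fun x : E m => (mpow x α : ℂ) := by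
  unfold mpow
  fun_prop

theorem mpow_mul_coord (x : E m) (α : Fin m → ℕ) (i : Fin m) :
    mpow x α * x i = mpow x (α + Pi.single i 1) := by
  have h : mpow x (Pi.single i 1) = x i := by
    unfold mpow
    rw [Finset.prod_eq_single i (fun j _ hj => by simp [hj]) (by simp)]
    simp
  rw [← h]
  simp [mpow, pow_add, Finset.prod_mul_distrib]

theorem IsMollifier.integrable_mpow_mul (hφ : IsMollifier σ φ) (hσ : 0 ≤ σ) (α : Fin m → ℕ) :
    Integrable fun x => (mpow x α : ℂ) * φ x := by
  refine (hφ.integrable_pow_mul hσ (len α)).mono'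
    ((continuous_mpow α).mul hφ.contDiff.continuous).aestronglyMeasurable
    (Filter.Eventually.of_forall fun x => ?_)
  rw [norm_mul]
  exact mul_le_mul_of_nonneg_right (norm_mpow_le x α) (norm_nonneg _)

/-- The moment conditions annihilate all nonconstant terms of a Taylor expansion. The monomial
`mpow z α` is there for the induction. -/
theorem IsMollifier.integral_taylorTerm (hφ : IsMollifier σ φ) (hσ : 0 ≤ σ) (n : ℕ) (f : E m → ℂ)
    (x : E m) (c : ℝ) (α : Fin m → ℕ) :
    Integrable (fun z => (mpow z α : ℂ) * taylorTerm n f x (c • z) * φ z) ∧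
      (α ≠ 0 ∨ n ≠ 0 → ∫ z, (mpow z α : ℂ) * taylorTerm n f x (c • z) * φ z = 0) := by
  induction n generalizing f α with
  | zero =>
    have e : (fun z => (mpow z α : ℂ) * taylorTerm 0 f x (c • z) * φ z) =
        fun z => f x * ((mpow z α : ℂ) * φ z) := by ext z; simp only [taylorTerm]; ring
    rw [e]
    refine ⟨(hφ.integrable_mpow_mul hσ α).const_mul _, fun h => ?_⟩
    rw [integral_const_mul, hφ.moment_eq_zero α (by simpa using h), mul_zero]
  | succ n ih =>
    have e : (fun z => (mpow z α : ℂ) * taylorTerm (n + 1) f x (c • z) * φ z) = fun z => ∑ i,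
        (c : ℂ) * ((mpow z (α + Pi.single i 1) : ℂ) * taylorTerm n (pderiv i f) x (c • z) * φ z) := by
      ext z
      rw [taylorTerm, Finset.mul_sum, Finset.sum_mul]
      refine Finset.sum_congr rfl fun i _ => ?_
      rw [← mpow_mul_coord]
      simp only [PiLp.smul_apply, smul_eq_mul]
      push_cast
      ring
    rw [e]
    refine ⟨integrable_finsetSum _ fun i _ => (ih (pderiv i f) _).1.const_mul _, fun _ => ?_⟩
    rw [integral_finsetSum _ fun i _ => (ih (pderiv i f) _).1.const_mul _]
    refine Finset.sum_eq_zero fun i _ => ?_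
    rw [integral_const_mul, (ih (pderiv i f) _).2 (Or.inl ?_), mul_zero]
    intro h
    simpa using congrFun h i

/-- Averages of a Gevrey function against the dilated mollifier converge exponentially fast: all
terms of the Taylor expansion but the first have vanishing integral, the remainder of order `N` is
`O((b ε)^N N!^{2σ-1})` for every `b`, and `N` is arbitrary. -/
theorem IsMollifier.exists_norm_integral_sub_le (hφ : IsMollifier σ φ) (hσ : 1 < σ) {h k : ℝ}
    (hh : 0 ≤ h) (hk : 0 < k) : ∃ C, 0 ≤ C ∧ ∀ (A : ℝ) (F : E m → ℂ), ContDiff ℝ ∞ F →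
      (∀ x, GevreyAt σ A h F x) → ∀ (x : E m) (ε : ℝ), 0 < ε →
        ‖(∫ z, F (x + (-ε) • z) * φ z) - F x‖ ≤
          A * C * Real.exp (-k * ε ^ (-(1 / (2 * σ - 1)))) := by
  have hs : 0 < 2 * σ - 1 := by linarith
  have hσ0 : 0 ≤ σ := by linarith
  set k' := k / (2 * σ - 1) with hk'
  have hk'0 : 0 < k' := by positivity
  -- The factor `m h` comes from the remainder of order `N`, which is bounded by `(m h ε |z|)^N`.
  set b := ((2 * k')⁻¹) ^ (2 * σ - 1) / (m * h + 1) with hb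
  have hb0 : 0 < b := by positivity
  obtain ⟨C, hC, H⟩ := hφ.exists_integral_pow_mul_le hσ0 hb0
  refine ⟨2 ^ (2 * σ - 1) * (C + 1), by positivity, fun A F hF hFA x ε hε => ?_⟩
  have hA : 0 ≤ A := (hFA x).nonneg
  have hT : ∀ n, Integrable fun z => taylorTerm n F x ((-ε) • z) * φ z := fun n => by
    simpa [mpow] using (hφ.integral_taylorTerm hσ0 n F x (-ε) 0).1
  have hFi : Integrable fun z => F (x + (-ε) • z) * φ z := by
    refine (hφ.integrable hσ0).bdd_mul (c := A) ?_ (Filter.Eventually.of_forall fun z => ?_)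
    · exact (hF.continuous.comp (by fun_prop)).aestronglyMeasurable
    · simpa [wordDeriv] using hFA (x + (-ε) • z) []
  have hrem : ∀ N : ℕ, ‖(∫ z, F (x + (-ε) • z) * φ z) -
      ∑ n ∈ Finset.range N, ((n.factorial : ℂ))⁻¹ * ∫ z, taylorTerm n F x ((-ε) • z) * φ z‖ ≤
      A * C * (((2 * k')⁻¹) ^ (2 * σ - 1) * ε) ^ N * (N.factorial : ℝ) ^ (2 * σ - 1) := by
    intro N
    have hN := factorial_rpow_pos N σ
    have e : (∫ z, F (x + (-ε) • z) * φ z) -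
        ∑ n ∈ Finset.range N, ((n.factorial : ℂ))⁻¹ * ∫ z, taylorTerm n F x ((-ε) • z) * φ z =
        ∫ z, (F (x + (-ε) • z) -
          ∑ n ∈ Finset.range N, ((n.factorial : ℂ))⁻¹ * taylorTerm n F x ((-ε) • z)) * φ z := by
      simp_rw [← integral_const_mul]
      rw [← integral_finsetSum _ fun n _ => (hT n).const_mul _,
        ← integral_sub hFi (integrable_finsetSum _ fun n _ => (hT n).const_mul _)]
      congr 1
      ext z
      rw [sub_mul, Finset.sum_mul]
      simp only [mul_assoc]
    rw [e]
    have hN' : (N.factorial : ℝ) ^ (2 * σ - 1) =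
        (N.factorial : ℝ) ^ σ * (N.factorial : ℝ) ^ σ / N.factorial := by
      rw [Real.rpow_sub (by positivity), two_mul, Real.rpow_add (by positivity), Real.rpow_one]
    calc _ ≤ ∫ z, A * (m * ε * h) ^ N * (N.factorial : ℝ) ^ σ / N.factorial *
          (‖z‖ ^ N * ‖φ z‖) := by
          refine norm_integral_le_of_norm_le ((hφ.integrable_pow_mul hσ0 N).const_mul _)
            (Filter.Eventually.of_forall fun z => ?_)
          rw [norm_mul]
          refine (mul_le_mul_of_nonneg_right (norm_sub_taylorTerm_le N hF x ((-ε) • z)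
            (B := A * h ^ N * (N.factorial : ℝ) ^ σ) ?_) (norm_nonneg _)).trans ?_
          · rintro w rfl y
            exact hFA y w
          · have h1 : ∑ i, |((-ε) • z) i| ≤ m * (ε * ‖z‖) := by
              refine (sum_abs_le _).trans_eq ?_
              rw [norm_smul, norm_neg, Real.norm_eq_abs, abs_of_pos hε]
            have h2 : (∑ i, |((-ε) • z) i|) ^ N ≤ (m * (ε * ‖z‖)) ^ N :=
              pow_le_pow_left₀ (Finset.sum_nonneg fun _ _ => abs_nonneg _) h1 N
            calc _ ≤ (m * (ε * ‖z‖)) ^ N * (A * h ^ N * (N.factorial : ℝ) ^ σ) / N.factorial *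
                  ‖φ z‖ := by gcongr
              _ = _ := by simp only [mul_pow]; ring
      _ = A * (m * ε * h) ^ N * (N.factorial : ℝ) ^ σ / N.factorial * ∫ z, ‖z‖ ^ N * ‖φ z‖ :=
          integral_const_mul _ _
      _ ≤ A * (m * ε * h) ^ N * (N.factorial : ℝ) ^ σ / N.factorial *
          (C * b ^ N * (N.factorial : ℝ) ^ σ) := by
          gcongr
          exact H N
      _ = A * C * (m * h * b * ε) ^ N * (N.factorial : ℝ) ^ (2 * σ - 1) := by
          rw [hN']
          simp only [mul_pow]
          ring
      _ ≤ _ := by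
          have : m * h * b ≤ ((2 * k')⁻¹) ^ (2 * σ - 1) := by
            rw [hb, ← mul_div_assoc, div_le_iff₀ (by positivity), mul_comm]
            gcongr
            linarith
          gcongr
  have := le_exp_neg_of_forall_le_pow_mul_factorial (X := ‖(∫ z, F (x + (-ε) • z) * φ z) - F x‖)
    (C := A * (C + 1)) (t := ε) (k := k') hs hk'0 hε (norm_nonneg _) fun N => by
      rcases Nat.eq_zero_or_pos N with rfl | hN
      · have h1 := hrem 0
        have h2 : ‖F x‖ ≤ A := by simpa [wordDeriv] using hFA x []
        simp only [Finset.range_zero, Finset.sum_empty, sub_zero, pow_zero, Nat.factorial_zero,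
          Nat.cast_one, Real.one_rpow, mul_one] at h1 ⊢
        refine (norm_sub_le _ _).trans ((add_le_add h1 h2).trans_eq (by ring))
      · have h1 := hrem N
        rw [← Nat.succ_pred_eq_of_pos hN, Finset.sum_range_succ', Finset.sum_eq_zero] at h1
        · rw [Nat.succ_pred_eq_of_pos hN] at h1
          simp only [taylorTerm, Nat.factorial_zero, Nat.cast_one, inv_one, one_mul, zero_add,
            integral_const_mul, hφ.integral_eq_one, mul_one] at h1
          refine h1.trans ?_
          have := factorial_rpow_pos N (2 * σ - 1)
          gcongr
          linarith
        · intro n _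
          have := (hφ.integral_taylorTerm hσ0 (n + 1) F x (-ε) 0).2 (Or.inr (by simp))
          simp only [mpow, Pi.zero_apply, pow_zero, Finset.prod_const_one, Complex.ofReal_one,
            one_mul] at this
          rw [this, mul_zero]
  rw [hk', mul_div_cancel₀ _ hs.ne'] at this
  exact this.trans_eq (by ring)

end mollifier

/-! ### Global bounds for Gevrey functions with compact support -/

section testFunctions

variable {m : ℕ} {σ : ℝ} {Ω : TopologicalSpace.Opens (E m)}

theorem contDiff_of_mem_gevreyTest {f : E m → ℂ} (hf : f ∈ gevreyTest σ Ω) : ContDiff ℝ ∞ f := by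
  rw [contDiff_iff_contDiffAt]
  intro x
  by_cases hx : x ∈ tsupport f
  · exact hf.1.1.contDiffAt (Ω.isOpen.mem_nhds (hf.2.2 hx))
  · exact contDiffAt_const.congr_of_eventuallyEq (notMem_tsupport_iff_eventuallyEq.mp hx)

/-- Off the support all derivatives vanish, so the estimates on the support hold everywhere. -/
theorem exists_gevreyAt_of_mem_gevreyTest (hσ : 0 ≤ σ) {f : E m → ℂ} (hf : f ∈ gevreyTest σ Ω) :
    ∃ A > 0, ∀ x, GevreyAt σ A A f x := by
  obtain ⟨c, hc, H⟩ := hf.1.2 (tsupport f) hf.2.1 hf.2.2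
  refine ⟨c, hc, fun x => ?_⟩
  by_cases hx : x ∈ tsupport f
  · refine gevreyAt_of_mderiv hσ hc.le hc.le hf.1.1 (hf.2.2 hx) fun α => ?_
    exact (H α x hx).trans_eq (by rw [pow_succ'])
  · exact gevreyAt_zero hc.le hc.le (notMem_tsupport_iff_eventuallyEq.mp hx)

/-- Uniform Gevrey bounds on compact sets give membership in `E^σ(Ω)`. -/
theorem mem_gevrey_of_gevreyAt (hσ : 0 ≤ σ) {f : E m → ℂ} (hf : ContDiffOn ℝ ∞ f Ω)
    (H : ∀ K : Set (E m), IsCompact K → K ⊆ Ω → ∃ A h : ℝ, 0 ≤ h ∧ ∀ x ∈ K, GevreyAt σ A h f x) :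
    f ∈ gevrey σ Ω := by
  refine ⟨hf, fun K hK hKΩ => ?_⟩
  obtain ⟨A, h, hh, H'⟩ := H K hK hKΩ
  set h' := h * ((2 : ℝ) ^ m) ^ σ with hh'
  have h0 : 0 ≤ h' := by positivity
  refine ⟨|A| + h' + 1, by positivity, fun α x hx => ?_⟩
  refine ((H' x hx).mderiv_le hσ hh α).trans ?_
  have := mfact_rpow_nonneg α σ
  rw [pow_succ']
  have h1 : A ≤ |A| + h' + 1 := by linarith [le_abs_self A]
  have h2 : h' ≤ |A| + h' + 1 := by linarith [abs_nonneg A]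
  gcongr

theorem exists_gevreyAt_of_mem_gevrey (hσ : 0 ≤ σ) {f : E m → ℂ} (hf : f ∈ gevrey σ Ω)
    {K : Set (E m)} (hK : IsCompact K) (hKΩ : K ⊆ Ω) : ∃ A > 0, ∀ x ∈ K, GevreyAt σ A A f x := by
  obtain ⟨c, hc, H⟩ := hf.2 K hK hKΩ
  refine ⟨c, hc, fun x hx => gevreyAt_of_mderiv hσ hc.le hc.le hf.1 (hKΩ hx) fun α => ?_⟩
  exact (H α x hx).trans_eq (by rw [pow_succ'])

end testFunctions

/-! ### Estimates for the nets of mollifiers -/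

section nets

theorem exists_forall_le_of_eventually {P : ℝ → Prop}
    (h : ∀ᶠ ε in nhdsWithin (0 : ℝ) (Ioi 0), P ε) : ∃ ε₀ : Ioc (0 : ℝ) 1, ∀ ε ≤ ε₀, P (ε : ℝ) := by
  obtain ⟨u, hu, H⟩ := mem_nhdsGT_iff_exists_Ioo_subset.mp h
  have hu' : (0 : ℝ) < u := hu
  refine ⟨⟨min (u / 2) 1, by positivity, min_le_right _ _⟩, fun ε hε => H ⟨ε.2.1, ?_⟩⟩
  have : (ε : ℝ) ≤ min (u / 2) 1 := hε
  linarith [this.trans (min_le_left _ _)]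

theorem exists_lt_one : ∃ ε₀ : Ioc (0 : ℝ) 1, ∀ ε ≤ ε₀, (ε : ℝ) < 1 :=
  ⟨⟨1 / 2, by norm_num, by norm_num⟩, fun ε hε => lt_of_le_of_lt (show (ε : ℝ) ≤ 1 / 2 from hε)
    (by norm_num)⟩

/-- As `1/σ > 1/(2σ-1)`, the logarithm in `ε |ln ε|` does no harm: `|ln ε| = O(ε^{-η})` for
`η = (σ-1)/(2σ-1)`, and `1 - η = σ/(2σ-1)`. -/
theorem exists_mul_rpow_le_rpow_mul_log {σ : ℝ} (hσ : 1 < σ) : ∃ c > 0, ∀ ε : ℝ, 0 < ε → ε < 1 →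
    c * ε ^ (-(1 / (2 * σ - 1))) ≤ (ε * |Real.log ε|) ^ (-(1 / σ)) := by
  have hs : 0 < 2 * σ - 1 := by linarith
  have hσ0 : 0 < σ := by linarith
  set η := (σ - 1) / (2 * σ - 1) with hη
  have hη0 : 0 < η := div_pos (by linarith) hs
  refine ⟨(1 / η) ^ (-(1 / σ)), by positivity, fun ε h0 h1 => ?_⟩
  have hl : 0 < |Real.log ε| := abs_pos.mpr (Real.log_neg h0 h1).ne
  have h2 : |Real.log ε| * ε ^ η ≤ 1 / η := by
    have := (Real.abs_log_mul_self_rpow_lt ε η h0 h1.le hη0).le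
    rwa [abs_mul, abs_of_pos (Real.rpow_pos_of_pos h0 η)] at this
  have h3 : ε * |Real.log ε| ≤ 1 / η * ε ^ (σ / (2 * σ - 1)) := by
    calc ε * |Real.log ε| = (|Real.log ε| * ε ^ η) * ε ^ (σ / (2 * σ - 1)) := by
          rw [mul_assoc, ← Real.rpow_add h0, show η + σ / (2 * σ - 1) = 1 by
            rw [hη, ← add_div, div_eq_one_iff_eq hs.ne']; ring, Real.rpow_one, mul_comm]
      _ ≤ _ := by gcongr
  calc _ = (1 / η * ε ^ (σ / (2 * σ - 1))) ^ (-(1 / σ)) := by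
        rw [Real.mul_rpow (by positivity) (by positivity), ← Real.rpow_mul h0.le]
        congr 2
        field_simp
    _ ≤ _ := Real.rpow_le_rpow_of_nonpos (by positivity) h3 (by simp [hσ0.le])

variable {m : ℕ} {σ : ℝ} {φ : E m → ℂ} {χ : E m → ℝ}

theorem mollNet_eq (φ : E m → ℂ) (ε : Ioc (0 : ℝ) 1) :
    mollNet φ ε = (((((ε : ℝ) ^ m)⁻¹ : ℝ) : ℂ)) • fun x => φ (0 + (ε : ℝ)⁻¹ • x) := by
  ext x; simp [mollNet]

theorem contDiff_mollNet (hφ : ContDiff ℝ ∞ φ) (ε : Ioc (0 : ℝ) 1) :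
    ContDiff ℝ ∞ (mollNet φ ε) := by
  have : ContDiff ℝ ∞ fun x => φ (0 + (ε : ℝ)⁻¹ • x) :=
    hφ.comp (contDiff_const.add (contDiff_id.const_smul _))
  rw [mollNet_eq]
  exact contDiff_const.smul this

theorem norm_wordDeriv_mollNet (hφ : ContDiff ℝ ∞ φ) (ε : Ioc (0 : ℝ) 1) (w : List (Fin m))
    (x : E m) :
    ‖wordDeriv w (mollNet φ ε) x‖ =
      ((ε : ℝ) ^ m)⁻¹ * ((ε : ℝ)⁻¹ ^ w.length * ‖wordDeriv w φ ((ε : ℝ)⁻¹ • x)‖) := by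
  have h0 := ε.2.1
  have h : ContDiff ℝ ∞ fun x => φ (0 + (ε : ℝ)⁻¹ • x) :=
    hφ.comp (contDiff_const.add (contDiff_id.const_smul _))
  rw [mollNet_eq, wordDeriv_smul' _ _ h, wordDeriv_comp_affine w hφ]
  simp [abs_of_pos h0]

theorem gevreyAt_mollNet (hφ : ContDiff ℝ ∞ φ) (ε : Ioc (0 : ℝ) 1) {C : ℝ} {x : E m}
    (h : GevreyAt σ C 1 φ ((ε : ℝ)⁻¹ • x)) :
    GevreyAt σ (C / (ε : ℝ) ^ m) (1 / ε) (mollNet φ ε) x := fun w => by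
  have h0 := ε.2.1
  rw [norm_wordDeriv_mollNet hφ]
  have := h w
  rw [one_pow, mul_one] at this
  calc _ ≤ ((ε : ℝ) ^ m)⁻¹ * ((ε : ℝ)⁻¹ ^ w.length * (C * (w.length.factorial : ℝ) ^ σ)) := by
        gcongr
    _ = _ := by rw [one_div]; ring

/-- Bounds with a factor `1/ε` for each derivative are of order `3σ-1 = (2σ-1) + σ`, uniformly up
to a moderate factor. -/
theorem GevreyAt.absorb (hσ : 1 < σ) {g : E m → ℂ} {x : E m} {D a ε : ℝ} (ha : 0 ≤ a) (hε : 0 < ε)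
    (h : GevreyAt σ (D / ε ^ m) (a / ε) g x) :
    GevreyAt (3 * σ - 1) (D * ((m.factorial : ℝ) ^ (2 * σ - 1) * Real.exp
      (((2 * σ - 1) * 1 ^ (1 / (2 * σ - 1)) + (2 * σ - 1) * a ^ (1 / (2 * σ - 1))) *
        ε ^ (-(1 / (2 * σ - 1)))))) 1 g x := by
  intro w
  have hs : 0 < 2 * σ - 1 := by linarith
  have hD : 0 ≤ D := by
    have := mul_nonneg h.nonneg (pow_pos hε m).le
    rwa [div_mul_cancel₀ _ (pow_pos hε m).ne'] at this
  have h1 := div_pow_le_factorial_mul_exp hs zero_le_one hε m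
  have h2 := div_pow_le_factorial_mul_exp hs ha hε w.length
  have hw := factorial_rpow_pos w.length σ
  have hm := factorial_rpow_pos m (2 * σ - 1)
  refine (h w).trans ?_
  rw [div_eq_mul_inv, ← one_div, ← one_div_pow, add_mul, Real.exp_add,
    show 3 * σ - 1 = (2 * σ - 1) + σ by ring, Real.rpow_add (by positivity), one_pow, mul_one]
  calc _ ≤ D * ((m.factorial : ℝ) ^ (2 * σ - 1) * Real.exp
          ((2 * σ - 1) * 1 ^ (1 / (2 * σ - 1)) * ε ^ (-(1 / (2 * σ - 1))))) *
        ((w.length.factorial : ℝ) ^ (2 * σ - 1) * Real.exp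
          ((2 * σ - 1) * a ^ (1 / (2 * σ - 1)) * ε ^ (-(1 / (2 * σ - 1))))) *
        (w.length.factorial : ℝ) ^ σ := by gcongr
    _ = _ := by ring

theorem IsCutoff.contDiff (hχ : IsCutoff σ χ) : ContDiff ℝ ∞ fun x => (χ x : ℂ) :=
  contDiff_of_mem_gevreyTest hχ.mem

theorem IsCutoff.eq_zero (hχ : IsCutoff σ χ) {x : E m} (hx : 2 ≤ ‖x‖) : χ x = 0 := by
  have h : x ∉ tsupport fun x => (χ x : ℂ) := fun h => by
    have h1 : x ∈ Metric.ball (0 : E m) 2 := hχ.mem.2.2 h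
    rw [mem_ball_zero_iff] at h1
    linarith
  have := image_eq_zero_of_notMem_tsupport h
  exact_mod_cast this

/-- The dilated cutoff function `x ↦ χ(x |ln ε|)`. -/
noncomputable def logCutoff {m : ℕ} (χ : E m → ℝ) (ε : Ioc (0 : ℝ) 1) : E m → ℂ :=
  fun x => (χ (0 + |Real.log ε| • x) : ℂ)

/-- The complementary function `x ↦ 1 - χ(x |ln ε|)`, which vanishes for `|x| < 1 / |ln ε|`. -/
noncomputable def logTail {m : ℕ} (χ : E m → ℝ) (ε : Ioc (0 : ℝ) 1) : E m → ℂ :=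
  fun x => 1 - logCutoff χ ε x

theorem modMollNet_eq (φ : E m → ℂ) (χ : E m → ℝ) (ε : Ioc (0 : ℝ) 1) :
    modMollNet φ χ ε = mollNet φ ε * logCutoff χ ε := by
  ext x; simp [modMollNet, logCutoff]

theorem mollNet_sub_modMollNet_eq (φ : E m → ℂ) (χ : E m → ℝ) (ε : Ioc (0 : ℝ) 1) :
    mollNet φ ε - modMollNet φ χ ε = mollNet φ ε * logTail χ ε := by
  rw [modMollNet_eq]; ext x; simp [logTail]; ring

theorem IsCutoff.contDiff_logCutoff (hχ : IsCutoff σ χ) (ε : Ioc (0 : ℝ) 1) :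
    ContDiff ℝ ∞ (logCutoff χ ε) :=
  hχ.contDiff.comp (contDiff_const.add (contDiff_id.const_smul _))

theorem abs_log_le_one_div (ε : Ioc (0 : ℝ) 1) : |Real.log ε| ≤ 1 / ε := by
  have h0 := ε.2.1
  have := (Real.abs_log_mul_self_lt ε h0 ε.2.2).le
  rw [abs_mul, abs_of_pos h0] at this
  rwa [le_div_iff₀ h0]

theorem IsCutoff.exists_gevreyAt_logCutoff (hχ : IsCutoff σ χ) (hσ : 0 ≤ σ) :
    ∃ A ≥ 1, ∀ (ε : Ioc (0 : ℝ) 1) (x : E m), GevreyAt σ A (A / ε) (logCutoff χ ε) x := by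
  obtain ⟨A, hA, H⟩ := exists_gevreyAt_of_mem_gevreyTest hσ hχ.mem
  refine ⟨A + 1, by linarith, fun ε x => ?_⟩
  have h0 := ε.2.1
  refine (GevreyAt.comp_affine hχ.contDiff 0 |Real.log ε| (H _)).mono (by positivity)
    (by linarith) ?_
  rw [abs_abs]
  calc |Real.log ε| * A ≤ 1 / ε * (A + 1) := by
        gcongr
        · exact abs_log_le_one_div ε
        · linarith
    _ = _ := by ring

theorem gevreyAt_const_one {h : ℝ} (hh : 0 ≤ h) (x : E m) :
    GevreyAt σ 1 h (fun _ => 1) x := by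
  intro w
  have := factorial_rpow_pos w.length σ
  cases w with
  | nil => simp [wordDeriv]
  | cons i w =>
    rw [wordDeriv_cons, pderiv_const, show (fun _ : E m => (0 : ℂ)) = 0 from rfl, wordDeriv_zero]
    simp only [Pi.zero_apply, norm_zero]
    positivity

theorem logTail_eq (χ : E m → ℝ) (ε : Ioc (0 : ℝ) 1) :
    logTail χ ε = (fun _ => 1) + (-1 : ℂ) • logCutoff χ ε := by
  ext x; simp [logTail, sub_eq_add_neg]

theorem IsCutoff.contDiff_logTail (hχ : IsCutoff σ χ) (ε : Ioc (0 : ℝ) 1) :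
    ContDiff ℝ ∞ (logTail χ ε) :=
  contDiff_const.sub (hχ.contDiff_logCutoff ε)

theorem IsCutoff.exists_gevreyAt_logTail (hχ : IsCutoff σ χ) (hσ : 0 ≤ σ) :
    ∃ A ≥ 1, ∀ (ε : Ioc (0 : ℝ) 1) (x : E m), GevreyAt σ A (A / ε) (logTail χ ε) x := by
  obtain ⟨A, hA, H⟩ := hχ.exists_gevreyAt_logCutoff hσ
  refine ⟨1 + A, by linarith, fun ε x w => ?_⟩
  have h0 := ε.2.1
  have h1 := gevreyAt_const_one (σ := σ) (h := (1 + A) / ε) (by positivity) x w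
  have h2 := ((H ε x).mono (b := (1 + A) / ε) (by positivity) le_rfl
    (by gcongr; linarith)) w
  have h3 : ContDiff ℝ ∞ ((-1 : ℂ) • logCutoff χ ε) :=
    contDiff_const.smul (hχ.contDiff_logCutoff ε)
  rw [logTail_eq, wordDeriv_add' w contDiff_const h3,
    wordDeriv_smul' w _ (hχ.contDiff_logCutoff ε)]
  refine (norm_add_le _ _).trans ?_
  rw [Pi.smul_apply, norm_smul, norm_neg, norm_one, one_mul, add_mul, add_mul]
  exact add_le_add h1 h2

theorem contDiff_modMollNet (hφ : ContDiff ℝ ∞ φ) (hχ : IsCutoff σ χ) (ε : Ioc (0 : ℝ) 1) :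
    ContDiff ℝ ∞ (modMollNet φ χ ε) := by
  rw [modMollNet_eq]
  exact (contDiff_mollNet hφ ε).mul (hχ.contDiff_logCutoff ε)

/-- A net of smooth functions with moderate bounds of order `τ`, uniform on the whole space. -/
structure IsModerateKernel (σ τ : ℝ) {m : ℕ} (g : Net m) : Prop where
  contDiff : ∀ ε, ContDiff ℝ ∞ (g ε)
  bound : ∃ C ≥ 0, ∃ k > 0, ∀ (ε : Ioc (0 : ℝ) 1) (x : E m),
    GevreyAt τ (C * Real.exp (k * (ε : ℝ) ^ (-(1 / (2 * σ - 1))))) 1 (g ε) x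

theorem IsMollifier.isModerateKernel (hφ : IsMollifier σ φ) (hσ : 1 < σ) :
    IsModerateKernel σ (3 * σ - 1) (mollNet φ) := by
  refine ⟨contDiff_mollNet hφ.contDiff, ?_⟩
  obtain ⟨C, hC⟩ := hφ.exists_gevreyAt (by linarith)
  have hC0 := (hC 0).nonneg
  have hs : 0 < 2 * σ - 1 := by linarith
  refine ⟨C * (m.factorial : ℝ) ^ (2 * σ - 1), by positivity, (2 * σ - 1) * 1 ^ (1 / (2 * σ - 1)) +
    (2 * σ - 1) * 1 ^ (1 / (2 * σ - 1)), by positivity, fun ε x => ?_⟩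
  have := (gevreyAt_mollNet hφ.contDiff ε (hC ((ε : ℝ)⁻¹ • x))).absorb hσ zero_le_one ε.2.1
  rwa [← mul_assoc] at this

theorem IsMollifier.isModerateKernel_mod (hφ : IsMollifier σ φ) (hχ : IsCutoff σ χ) (hσ : 1 < σ) :
    IsModerateKernel σ (3 * σ - 1) (modMollNet φ χ) := by
  refine ⟨contDiff_modMollNet hφ.contDiff hχ, ?_⟩
  have hσ0 : 0 ≤ σ := by linarith
  obtain ⟨C, hC⟩ := hφ.exists_gevreyAt hσ0
  obtain ⟨A, hA, HA⟩ := hχ.exists_gevreyAt_logCutoff hσ0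
  have hC0 := (hC 0).nonneg
  have hs : 0 < 2 * σ - 1 := by linarith
  have hA0 : 0 < A := by linarith
  refine ⟨C * A * (m.factorial : ℝ) ^ (2 * σ - 1), by positivity, (2 * σ - 1) *
    1 ^ (1 / (2 * σ - 1)) + (2 * σ - 1) * (1 + A) ^ (1 / (2 * σ - 1)), by positivity,
    fun ε x => ?_⟩
  have h0 := ε.2.1
  have h1 := (gevreyAt_mollNet hφ.contDiff ε (hC ((ε : ℝ)⁻¹ • x))).mul (Ω := ⊤) hσ0 (by positivity)
    (by positivity) (contDiff_mollNet hφ.contDiff ε).contDiffOn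
    (hχ.contDiff_logCutoff ε).contDiffOn trivial (HA ε x)
  rw [div_mul_eq_mul_div, ← add_div] at h1
  have h2 := h1.absorb hσ (by positivity) h0
  rwa [← mul_assoc, ← modMollNet_eq] at h2

theorem inv_le_norm_inv_smul {ε : Ioc (0 : ℝ) 1} {x : E m}
    (h : ¬ |Real.log ε| * ‖x‖ < 1) : (ε * |Real.log ε|)⁻¹ ≤ ‖(ε : ℝ)⁻¹ • x‖ := by
  have h0 := ε.2.1
  have hl : 0 < |Real.log ε| := by
    refine (abs_nonneg _).lt_of_ne fun h' => h ?_
    rw [← h', zero_mul]; exact one_pos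
  rw [norm_smul, norm_inv, Real.norm_eq_abs, abs_of_pos h0, mul_inv]
  gcongr
  rw [inv_le_iff_one_le_mul₀' hl]
  exact not_lt.mp h

theorem IsCutoff.logTail_eventuallyEq_zero (hχ : IsCutoff σ χ) {ε : Ioc (0 : ℝ) 1} {x : E m}
    (h : |Real.log ε| * ‖x‖ < 1) :
    logTail χ ε =ᶠ[nhds x] 0 := by
  have h1 : ∀ᶠ y in nhds x, |Real.log ε| * ‖y‖ < 1 :=
    (continuous_const.mul continuous_norm).continuousAt.eventually_lt continuousAt_const h
  filter_upwards [h1] with y hy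
  have : χ (0 + |Real.log ε| • y) = 1 := hχ.eq_one _ (by
    rw [mem_ball_zero_iff, zero_add, norm_smul, Real.norm_eq_abs, abs_abs]; exact hy)
  simp only [logTail, logCutoff, this]
  simp

/-- Truncating the mollifiers changes them by a null net: the derivatives of `φ` decay like
`exp(-K |x|^{1/σ})`, and `|x| ≥ 1 / (ε |ln ε|)` where the cutoff matters. -/
theorem IsMollifier.exists_gevreyAt_sub (hφ : IsMollifier σ φ) (hχ : IsCutoff σ χ) (hσ : 1 < σ)
    {k : ℝ} (hk : 0 < k) : ∃ C ≥ 0, ∃ ε₀ : Ioc (0 : ℝ) 1, ∀ ε ≤ ε₀, ∀ x, GevreyAt (3 * σ - 1)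
      (C * Real.exp (-k * (ε : ℝ) ^ (-(1 / (2 * σ - 1))))) 1
      (mollNet φ ε - modMollNet φ χ ε) x := by
  have hσ0 : 0 < σ := by linarith
  have hs : 0 < 2 * σ - 1 := by linarith
  obtain ⟨A, hA, HA⟩ := hχ.exists_gevreyAt_logTail hσ0.le
  have hA0 : 0 < A := by linarith
  obtain ⟨c, hc, Hc⟩ := exists_mul_rpow_le_rpow_mul_log hσ
  set K' := (2 * σ - 1) * 1 ^ (1 / (2 * σ - 1)) + (2 * σ - 1) * (1 + A) ^ (1 / (2 * σ - 1)) with hK'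
  have hK'0 : 0 < K' := by positivity
  obtain ⟨C, hC, HC⟩ := hφ.exists_norm_le_exp hσ0 (k := (k + K') / c) (by positivity)
  obtain ⟨ε₁, h₁⟩ := exists_lt_one
  obtain ⟨ε₂, h₂⟩ : ∃ ε₀ : Ioc (0 : ℝ) 1, ∀ ε ≤ ε₀, 2 * (m : ℝ) * ((ε : ℝ) * |Real.log ε|) ≤ 1 := by
    refine exists_forall_le_of_eventually (P := fun ε => 2 * (m : ℝ) * (ε * |Real.log ε|) ≤ 1) ?_
    have h1 : Filter.Tendsto (fun ε : ℝ => 2 * (m : ℝ) * |Real.log ε * ε|)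
        (nhdsWithin 0 (Ioi 0)) (nhds (2 * (m : ℝ) * |0|)) := by
      have := tendsto_log_mul_rpow_nhdsGT_zero one_pos
      simp only [Real.rpow_one] at this
      exact this.abs.const_mul _
    rw [abs_zero, mul_zero] at h1
    filter_upwards [h1.eventually (gt_mem_nhds one_pos), self_mem_nhdsWithin] with ε h2 h3
    rw [abs_mul, abs_of_pos (show (0 : ℝ) < ε from h3), mul_comm |Real.log ε|] at h2
    exact h2.le
  refine ⟨C * A * (m.factorial : ℝ) ^ (2 * σ - 1), by positivity, min ε₁ ε₂, fun ε hε x => ?_⟩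
  have h0 := ε.2.1
  have hε1 := h₁ ε (hε.trans (min_le_left _ _))
  have hε2 := h₂ ε (hε.trans (min_le_right _ _))
  have hl : 0 < |Real.log ε| := abs_pos.mpr (Real.log_neg h0 hε1).ne
  rw [mollNet_sub_modMollNet_eq]
  by_cases hx : |Real.log ε| * ‖x‖ < 1
  · refine gevreyAt_zero (by positivity) zero_le_one ?_
    filter_upwards [hχ.logTail_eventuallyEq_zero hx] with y hy
    rw [Pi.mul_apply, hy, Pi.zero_apply, mul_zero]
  · have hx1 := inv_le_norm_inv_smul hx
    have hx2 : 2 * (m : ℝ) ≤ ‖(ε : ℝ)⁻¹ • x‖ := by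
      refine le_trans ?_ hx1
      rw [← one_div, le_div_iff₀ (by positivity)]
      exact hε2
    have h1 : GevreyAt σ (C * Real.exp (-((k + K') / c) *
        ((ε : ℝ) * |Real.log ε|) ^ (-(1 / σ)))) 1 φ ((ε : ℝ)⁻¹ • x) := fun w => by
      simpa using HC w _ _ (by positivity) hx2 hx1
    have h2 := (gevreyAt_mollNet hφ.contDiff ε h1).mul (Ω := ⊤) hσ0.le (by positivity)
      (by positivity) (contDiff_mollNet hφ.contDiff ε).contDiffOn
      (hχ.contDiff_logTail ε).contDiffOn trivial (HA ε x)
    rw [div_mul_eq_mul_div, ← add_div] at h2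
    refine (h2.absorb hσ (by positivity) h0).mono zero_le_one ?_ le_rfl
    rw [← hK']
    have h3 : Real.exp (-((k + K') / c) * ((ε : ℝ) * |Real.log ε|) ^ (-(1 / σ))) ≤
        Real.exp (-(k + K') * (ε : ℝ) ^ (-(1 / (2 * σ - 1)))) := by
      rw [Real.exp_le_exp, neg_mul, neg_mul, neg_le_neg_iff]
      calc _ = (k + K') / c * (c * (ε : ℝ) ^ (-(1 / (2 * σ - 1)))) := by field_simp
        _ ≤ _ := by
          have := Hc ε h0 hε1
          gcongr
    have hm := factorial_rpow_pos m (2 * σ - 1)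
    calc _ ≤ C * Real.exp (-(k + K') * (ε : ℝ) ^ (-(1 / (2 * σ - 1)))) * A *
          ((m.factorial : ℝ) ^ (2 * σ - 1) * Real.exp (K' * (ε : ℝ) ^ (-(1 / (2 * σ - 1))))) := by
          gcongr
      _ = C * A * (m.factorial : ℝ) ^ (2 * σ - 1) *
          (Real.exp (-(k + K') * (ε : ℝ) ^ (-(1 / (2 * σ - 1)))) *
            Real.exp (K' * (ε : ℝ) ^ (-(1 / (2 * σ - 1))))) := by ring
      _ = _ := by rw [← Real.exp_add]; ring_nf

theorem integral_mollify {F : Type*} [NormedAddCommGroup F] [NormedSpace ℝ F] (G : E m → F)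
    (ε : Ioc (0 : ℝ) 1) :
    ∫ z, ((ε : ℝ) ^ m)⁻¹ • G ((ε : ℝ)⁻¹ • z) = ∫ z, G z := by
  have h0 := ε.2.1
  rw [integral_smul, Measure.integral_comp_smul, smul_smul, finrank_euclideanSpace,
    Fintype.card_fin, inv_pow, inv_inv, abs_of_pos (by positivity), inv_mul_cancel₀ (by positivity),
    one_smul]

theorem integral_mul_mollNet (G : E m → ℂ) (ε : Ioc (0 : ℝ) 1) :
    ∫ z, G z * mollNet φ ε z = ∫ z, G ((ε : ℝ) • z) * φ z := by
  have h0 := ε.2.1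
  rw [← integral_mollify (fun z => G ((ε : ℝ) • z) * φ z) ε]
  congr 1
  ext z
  rw [smul_inv_smul₀ h0.ne', mollNet, Complex.real_smul]
  ring

theorem norm_mollNet (φ : E m → ℂ) (ε : Ioc (0 : ℝ) 1) (z : E m) :
    ‖mollNet φ ε z‖ = ((ε : ℝ) ^ m)⁻¹ * ‖φ ((ε : ℝ)⁻¹ • z)‖ := by
  have h0 := ε.2.1
  simp [mollNet, abs_of_pos h0]

theorem IsMollifier.integrable_mollNet (hφ : IsMollifier σ φ) (hσ : 0 ≤ σ) (ε : Ioc (0 : ℝ) 1) :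
    Integrable (mollNet φ ε) := by
  have h0 := ε.2.1
  exact ((integrable_comp_smul_iff volume φ (inv_ne_zero h0.ne')).mpr
    (hφ.integrable hσ)).const_mul _

theorem IsCutoff.norm_logCutoff_le (hχ : IsCutoff σ χ) (ε : Ioc (0 : ℝ) 1) (x : E m) :
    ‖logCutoff χ ε x‖ ≤ 1 := by
  rw [logCutoff, Complex.norm_real, Real.norm_eq_abs, abs_of_nonneg (hχ.nonneg _)]
  exact hχ.le_one _

theorem norm_modMollNet_le (hχ : IsCutoff σ χ) (ε : Ioc (0 : ℝ) 1) (x : E m) :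
    ‖modMollNet φ χ ε x‖ ≤ ‖mollNet φ ε x‖ := by
  rw [modMollNet_eq, Pi.mul_apply, norm_mul]
  exact mul_le_of_le_one_right (norm_nonneg _) (hχ.norm_logCutoff_le ε x)

theorem IsMollifier.integrable_modMollNet (hφ : IsMollifier σ φ) (hχ : IsCutoff σ χ) (hσ : 0 ≤ σ)
    (ε : Ioc (0 : ℝ) 1) : Integrable (modMollNet φ χ ε) :=
  (hφ.integrable_mollNet hσ ε).mono
    (contDiff_modMollNet hφ.contDiff hχ ε).continuous.aestronglyMeasurable
    (Filter.Eventually.of_forall (norm_modMollNet_le hχ ε))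

/-- Truncating the mollifiers changes them by a null net in `L¹`. -/
theorem IsMollifier.exists_integral_sub_le (hφ : IsMollifier σ φ) (hχ : IsCutoff σ χ) (hσ : 1 < σ)
    {k : ℝ} (hk : 0 < k) : ∃ C ≥ 0, ∃ ε₀ : Ioc (0 : ℝ) 1, ∀ ε ≤ ε₀,
      ∫ z, ‖mollNet φ ε z - modMollNet φ χ ε z‖ ≤
        C * Real.exp (-k * (ε : ℝ) ^ (-(1 / (2 * σ - 1)))) := by
  have hσ0 : 0 < σ := by linarith
  obtain ⟨c, hc, Hc⟩ := exists_mul_rpow_le_rpow_mul_log hσ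
  obtain ⟨C, hC, HC⟩ := hφ.exists_setIntegral_le_exp hσ0 (k := k / c) (by positivity)
  obtain ⟨ε₁, h₁⟩ := exists_lt_one
  refine ⟨C, hC, ε₁, fun ε hε => ?_⟩
  have h0 := ε.2.1
  have hε1 := h₁ ε hε
  have hl : 0 < |Real.log ε| := abs_pos.mpr (Real.log_neg h0 hε1).ne
  set S : Set (E m) := {x | ((ε : ℝ) * |Real.log ε|)⁻¹ ≤ ‖x‖} with hS
  have hSm : MeasurableSet S := measurableSet_le measurable_const measurable_norm
  have hφi := (hφ.integrable hσ0.le).norm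
  have hint : Integrable (S.indicator fun x => ‖φ x‖) := hφi.indicator hSm
  calc ∫ z, ‖mollNet φ ε z - modMollNet φ χ ε z‖
      ≤ ∫ z, ((ε : ℝ) ^ m)⁻¹ • S.indicator (fun x => ‖φ x‖) ((ε : ℝ)⁻¹ • z) := by
        refine integral_mono_of_nonneg (Filter.Eventually.of_forall fun z => norm_nonneg _)
          (((integrable_comp_smul_iff volume _ (inv_ne_zero h0.ne')).mpr hint).smul
            (((ε : ℝ) ^ m)⁻¹)) (Filter.Eventually.of_forall fun z => ?_)
        change ‖(mollNet φ ε - modMollNet φ χ ε) z‖ ≤ _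
        rw [mollNet_sub_modMollNet_eq]
        by_cases hz : |Real.log ε| * ‖z‖ < 1
        · rw [Pi.mul_apply, (hχ.logTail_eventuallyEq_zero hz).eq_of_nhds]
          simp only [Pi.zero_apply, mul_zero, norm_zero, smul_eq_mul]
          exact mul_nonneg (by positivity) (indicator_nonneg (fun _ _ => norm_nonneg _) _)
        · have hz' : (ε : ℝ)⁻¹ • z ∈ S := inv_le_norm_inv_smul hz
          simp only [smul_eq_mul]
          rw [indicator_of_mem hz', ← norm_mollNet, Pi.mul_apply, norm_mul]
          refine mul_le_of_le_one_right (norm_nonneg _) ?_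
          have : logTail χ ε z =
              ((1 - χ (0 + |Real.log ε| • z) : ℝ) : ℂ) := by
            simp [logTail, logCutoff]
          rw [this, Complex.norm_real, Real.norm_eq_abs, abs_le]
          constructor <;> linarith [hχ.nonneg (0 + |Real.log ε| • z),
            hχ.le_one (0 + |Real.log ε| • z)]
    _ = ∫ x in S, ‖φ x‖ := by rw [integral_mollify, integral_indicator hSm]
    _ ≤ C * Real.exp (-(k / c) * ((ε : ℝ) * |Real.log ε|) ^ (-(1 / σ))) := HC _ (by positivity)
    _ ≤ _ := by
        refine mul_le_mul_of_nonneg_left (Real.exp_le_exp.mpr ?_) hC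
        rw [neg_mul, neg_mul, neg_le_neg_iff]
        calc _ = k / c * (c * (ε : ℝ) ^ (-(1 / (2 * σ - 1)))) := by field_simp
          _ ≤ _ := by
            have := Hc ε h0 hε1
            gcongr

end nets

/-! ### Convolution of test functions with mollifiers -/

section convolution

variable {m : ℕ} {σ : ℝ} {φ : E m → ℂ} {χ : E m → ℝ}

theorem convNet_apply (f : E m → ℂ) (g : Net m) (ε : Ioc (0 : ℝ) 1) (x : E m) :
    convNet f g ε x = ∫ z, f (x - z) * g ε z := by
  rw [convNet, convolution_eq_swap]
  rfl

theorem contDiff_convNet {f : E m → ℂ} (hf : ContDiff ℝ ∞ f) (hfc : HasCompactSupport f)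
    {g : Net m} {ε : Ioc (0 : ℝ) 1} (hg : LocallyIntegrable (g ε)) : ContDiff ℝ ∞ (convNet f g ε) :=
  HasCompactSupport.contDiff_convolution_left (n := ⊤) (ContinuousLinearMap.mul ℝ ℂ) hfc hf hg

theorem pderiv_convNet (i : Fin m) {f : E m → ℂ} (hf : ContDiff ℝ ∞ f) (hfc : HasCompactSupport f)
    {g : Net m} {ε : Ioc (0 : ℝ) 1} (hg : LocallyIntegrable (g ε)) :
    pderiv i (convNet f g ε) = convNet (pderiv i f) g ε := by
  ext x
  have h := HasCompactSupport.hasFDerivAt_convolution_left (ContinuousLinearMap.mul ℝ ℂ) hfc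
    (hf.of_le (by simp)) hg x
  have h' : fderiv ℝ (convNet f g ε) x = _ := h.fderiv
  rw [pderiv, h', convNet, convolution, convolution, ContinuousLinearMap.integral_apply]
  · rfl
  · exact (hfc.fderiv (𝕜 := ℝ)).convolutionExists_left
      (ContinuousLinearMap.precompL (E m) (ContinuousLinearMap.mul ℝ ℂ))
      (hf.continuous_fderiv (by simp)) hg x

theorem wordDeriv_convNet (w : List (Fin m)) {f : E m → ℂ} (hf : ContDiff ℝ ∞ f)
    (hfc : HasCompactSupport f) {g : Net m} {ε : Ioc (0 : ℝ) 1} (hg : LocallyIntegrable (g ε)) :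
    wordDeriv w (convNet f g ε) = convNet (wordDeriv w f) g ε := by
  induction w generalizing f with
  | nil => rfl
  | cons i w ih =>
    rw [wordDeriv_cons, pderiv_convNet i hf hfc hg, ih (contDiff_pderiv i hf)]
    · rfl
    · exact hfc.mono' ((subset_tsupport _).trans (tsupport_wordDeriv_subset [i] f))

theorem convNet_mollNet_apply (f : E m → ℂ) (ε : Ioc (0 : ℝ) 1) (x : E m) :
    convNet f (mollNet φ) ε x = ∫ z, f (x + (-(ε : ℝ)) • z) * φ z := by
  rw [convNet_apply, integral_mul_mollNet fun z => f (x - z)]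
  simp [sub_eq_add_neg]

/-- Derivatives fall on the test function, whose derivatives are Gevrey functions again. -/
theorem IsMollifier.exists_wordDeriv_convNet_sub_le (hφ : IsMollifier σ φ) (hσ : 1 < σ) {h k : ℝ}
    (hh : 0 ≤ h) (hk : 0 < k) : ∃ C, 0 ≤ C ∧ ∀ (A : ℝ) (F : E m → ℂ), ContDiff ℝ ∞ F →
      HasCompactSupport F → (∀ x, GevreyAt σ A h F x) → ∀ (w : List (Fin m)) ε x,
        ‖wordDeriv w (convNet F (mollNet φ) ε - F) x‖ ≤
          A * ((2 : ℝ) ^ σ * h) ^ w.length * (w.length.factorial : ℝ) ^ σ * C *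
            Real.exp (-k * (ε : ℝ) ^ (-(1 / (2 * σ - 1)))) := by
  have hσ0 : 0 ≤ σ := by linarith
  obtain ⟨C, hC, H⟩ := hφ.exists_norm_integral_sub_le hσ (h := (2 : ℝ) ^ σ * h) (by positivity) hk
  refine ⟨C, hC, fun A F hF hFc hFA w ε x => ?_⟩
  have hg := (hφ.integrable_mollNet hσ0 ε).locallyIntegrable
  rw [wordDeriv_sub (Ω := ⊤) w (contDiff_convNet hF hFc hg).contDiffOn hF.contDiffOn trivial,
    wordDeriv_convNet w hF hFc hg, Pi.sub_apply, convNet_mollNet_apply]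
  exact H _ _ (contDiff_wordDeriv w hF) (fun y => (hFA y).wordDeriv hσ0 hh w) x ε ε.2.1

/-- The truncated mollifiers have no vanishing moments, but they are close in `L¹` to the original
ones. -/
theorem IsMollifier.exists_wordDeriv_convNet_mod_sub_le (hφ : IsMollifier σ φ)
    (hχ : IsCutoff σ χ) (hσ : 1 < σ) {h k : ℝ}
    (hh : 0 ≤ h) (hk : 0 < k) : ∃ C, 0 ≤ C ∧ ∃ ε₀ : Ioc (0 : ℝ) 1, ∀ (A : ℝ) (F : E m → ℂ),
      ContDiff ℝ ∞ F → HasCompactSupport F → (∀ x, GevreyAt σ A h F x) →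
        ∀ (w : List (Fin m)), ∀ ε ≤ ε₀, ∀ x,
        ‖wordDeriv w (convNet F (modMollNet φ χ) ε - F) x‖ ≤
          A * ((2 : ℝ) ^ σ * h) ^ w.length * (w.length.factorial : ℝ) ^ σ * C *
            Real.exp (-k * (ε : ℝ) ^ (-(1 / (2 * σ - 1)))) := by
  have hσ0 : 0 ≤ σ := by linarith
  obtain ⟨C, hC, H⟩ := hφ.exists_norm_integral_sub_le hσ (h := (2 : ℝ) ^ σ * h) (by positivity) hk
  obtain ⟨D, hD, ε₀, HD⟩ := hφ.exists_integral_sub_le hχ hσ hk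
  refine ⟨D + C, by positivity, ε₀, fun A F hF hFc hFA w ε hε x => ?_⟩
  have hi := hφ.integrable_mollNet hσ0 ε
  have hi' := hφ.integrable_modMollNet hχ hσ0 ε
  have hg := hi'.locallyIntegrable
  set G := wordDeriv w F with hG
  have hGc : Continuous G := (contDiff_wordDeriv w hF).continuous
  set B := A * ((2 : ℝ) ^ σ * h) ^ w.length * (w.length.factorial : ℝ) ^ σ with hB
  have hFA' : ∀ y, GevreyAt σ B ((2 : ℝ) ^ σ * h) G y := fun y => (hFA y).wordDeriv hσ0 hh w
  have hB0 : 0 ≤ B := (hFA' 0).nonneg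
  have hGB : ∀ y, ‖G y‖ ≤ B := fun y => by simpa [wordDeriv] using hFA' y []
  have hGi : ∀ {g : E m → ℂ}, Integrable g → Integrable fun z => G (x - z) * g z := fun hg =>
    hg.bdd_mul (c := B) (hGc.comp (by fun_prop)).aestronglyMeasurable
      (Filter.Eventually.of_forall fun z => hGB _)
  rw [wordDeriv_sub (Ω := ⊤) w (contDiff_convNet hF hFc hg).contDiffOn hF.contDiffOn trivial,
    wordDeriv_convNet w hF hFc hg, Pi.sub_apply, ← hG]
  have h1 := H _ _ (contDiff_wordDeriv w hF) hFA' x ε ε.2.1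
  rw [← hG, ← convNet_mollNet_apply] at h1
  have h2 : ‖convNet G (modMollNet φ χ) ε x - convNet G (mollNet φ) ε x‖ ≤
      B * (D * Real.exp (-k * (ε : ℝ) ^ (-(1 / (2 * σ - 1))))) := by
    rw [norm_sub_rev, convNet_apply, convNet_apply, ← integral_sub (hGi hi) (hGi hi')]
    refine (norm_integral_le_of_norm_le ((hi.sub hi').norm.const_mul B)
      (Filter.Eventually.of_forall fun z => ?_)).trans ?_
    · rw [← mul_sub, norm_mul]
      exact mul_le_mul_of_nonneg_right (hGB _) (norm_nonneg _)
    · rw [integral_const_mul]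
      exact mul_le_mul_of_nonneg_left (HD ε hε) hB0
  calc _ = ‖(convNet G (modMollNet φ χ) ε x - convNet G (mollNet φ) ε x) +
        (convNet G (mollNet φ) ε x - G x)‖ := by rw [sub_add_sub_cancel]
    _ ≤ _ := (norm_add_le _ _).trans ((add_le_add h2 h1).trans_eq (by ring))

end convolution

/-! ### The Banach space of jets -/

section jets

/-- The index set of jets: a point together with a word of coordinate directions. It is a type of
its own in order to carry the discrete topology. -/
structure JetIndex (m : ℕ) : Type where
  /-- The word of coordinate directions. -/
  dirs : List (Fin m)
  /-- The point. -/
  pt : E m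

instance (m : ℕ) : TopologicalSpace (JetIndex m) := ⊥

instance (m : ℕ) : DiscreteTopology (JetIndex m) := ⟨rfl⟩

/-- The Banach space of all bounded families indexed by words and points. -/
abbrev Jet (m : ℕ) : Type := BoundedContinuousFunction (JetIndex m) ℂ

variable {m : ℕ} {τ h A : ℝ} {f g : E m → ℂ}

open Classical in
/-- The family `∂^w f(y) / (h^|w| |w|!^τ)`, whose supremum is the Gevrey norm of step `h`; it
is `0` if the family is unbounded. -/
noncomputable def jet (τ h : ℝ) {m : ℕ} (f : E m → ℂ) : Jet m :=
  if H : ∃ C, ∀ p : JetIndex m,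
      ‖wordDeriv p.dirs f p.pt *
        (((h ^ p.dirs.length * (p.dirs.length.factorial : ℝ) ^ τ)⁻¹ : ℝ) : ℂ)‖ ≤ C
  then BoundedContinuousFunction.ofNormedAddCommGroupDiscrete _ H.choose H.choose_spec
  else 0

theorem GevreyAt.norm_mul_inv_le (hh : 0 < h) {y : E m} (hf : GevreyAt τ A h f y)
    (w : List (Fin m)) :
    ‖Gevrey.wordDeriv w f y * (((h ^ w.length * (w.length.factorial : ℝ) ^ τ)⁻¹ : ℝ) : ℂ)‖ ≤ A := by
  have hw := factorial_rpow_pos w.length τ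
  have h0 : 0 < h ^ w.length * (w.length.factorial : ℝ) ^ τ := by positivity
  rw [norm_mul, Complex.norm_real, Real.norm_eq_abs, abs_inv, abs_of_pos h0, ← div_eq_mul_inv,
    div_le_iff₀ h0, ← mul_assoc]
  exact hf w

theorem jet_apply (hh : 0 < h) (hf : ∀ y, GevreyAt τ A h f y) (w : List (Fin m)) (y : E m) :
    jet τ h f ⟨w, y⟩ =
      wordDeriv w f y * (((h ^ w.length * (w.length.factorial : ℝ) ^ τ)⁻¹ : ℝ) : ℂ) := by
  rw [jet, dif_pos ⟨A, fun p => (hf p.pt).norm_mul_inv_le hh p.dirs⟩]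
  rfl

theorem norm_jet_le (hh : 0 < h) (hf : ∀ y, GevreyAt τ A h f y) : ‖jet τ h f‖ ≤ A := by
  rw [BoundedContinuousFunction.norm_le (hf 0).nonneg]
  rintro ⟨w, y⟩
  rw [jet_apply hh hf]
  exact (hf y).norm_mul_inv_le hh w

theorem gevreyAt_norm_jet (hh : 0 < h) (hf : ∀ y, GevreyAt τ A h f y) (y : E m) :
    GevreyAt τ ‖jet τ h f‖ h f y := by
  intro w
  have hw := factorial_rpow_pos w.length τ
  have h0 : 0 < h ^ w.length * (w.length.factorial : ℝ) ^ τ := by positivity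
  have h1 := (jet τ h f).norm_coe_le_norm ⟨w, y⟩
  rw [jet_apply hh hf, norm_mul, Complex.norm_real, Real.norm_eq_abs, abs_inv, abs_of_pos h0,
    ← div_eq_mul_inv, div_le_iff₀ h0, ← mul_assoc] at h1
  exact h1

/-- The space of smooth functions whose jet of step `h` is bounded. -/
def boundedJets (τ h : ℝ) (hh : 0 ≤ h) (m : ℕ) : Submodule ℂ (E m → ℂ) where
  carrier := {f | ContDiff ℝ ∞ f ∧ ∃ A, ∀ x, GevreyAt τ A h f x}
  zero_mem' := ⟨contDiff_const, 0, fun x => gevreyAt_zero le_rfl hh Filter.EventuallyEq.rfl⟩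
  add_mem' := by
    rintro f g ⟨hf, A, hA⟩ ⟨hg, B, hB⟩
    refine ⟨hf.add hg, A + B, fun x w => ?_⟩
    rw [wordDeriv_add' w hf hg, add_mul, add_mul]
    exact (norm_add_le _ _).trans (add_le_add (hA x w) (hB x w))
  smul_mem' := by
    rintro a f ⟨hf, A, hA⟩
    refine ⟨contDiff_const.smul hf, ‖a‖ * A, fun x w => ?_⟩
    rw [wordDeriv_smul' w a hf, Pi.smul_apply, norm_smul, mul_assoc, mul_assoc, ← mul_assoc A]
    exact mul_le_mul_of_nonneg_left (hA x w) (norm_nonneg a)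

theorem jet_add (hh : 0 < h) (hf : f ∈ boundedJets τ h hh.le m) (hg : g ∈ boundedJets τ h hh.le m) :
    jet τ h (f + g) = jet τ h f + jet τ h g := by
  obtain ⟨C, hC⟩ := (add_mem hf hg).2
  obtain ⟨A, hA⟩ := hf.2
  obtain ⟨B, hB⟩ := hg.2
  ext ⟨w, y⟩
  rw [BoundedContinuousFunction.add_apply, jet_apply hh hC, jet_apply hh hA, jet_apply hh hB,
    wordDeriv_add' w hf.1 hg.1, Pi.add_apply, add_mul]

theorem jet_smul (hh : 0 < h) (a : ℂ) (hf : f ∈ boundedJets τ h hh.le m) :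
    jet τ h (a • f) = a • jet τ h f := by
  obtain ⟨C, hC⟩ := (Submodule.smul_mem _ a hf).2
  obtain ⟨A, hA⟩ := hf.2
  ext ⟨w, y⟩
  rw [BoundedContinuousFunction.smul_apply, jet_apply hh hC, jet_apply hh hA,
    wordDeriv_smul' w a hf.1, Pi.smul_apply, smul_eq_mul, smul_eq_mul, mul_assoc]

/-- A linear form which is continuous for the Gevrey norm of step `h` is given by a continuous
linear form on jets, by the Hahn–Banach theorem. -/
theorem exists_jet_functional {V : Type*} [AddCommGroup V] [Module ℂ V] (hh : 0 < h)
    (i : V →ₗ[ℂ] (E m → ℂ)) (hi : ∀ v, i v ∈ boundedJets τ h hh.le m) (T : V →ₗ[ℂ] ℂ) (c : ℝ)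
    (hT : ∀ (v : V) (M : ℝ), 0 ≤ M → (∀ x, GevreyAt τ M h (i v) x) → ‖T v‖ ≤ c * M) :
    ∃ Λ : Jet m →L[ℂ] ℂ, ∀ v, T v = Λ (jet τ h (i v)) := by
  let j : V →ₗ[ℂ] Jet m :=
    { toFun := fun v => jet τ h (i v)
      map_add' := fun u v => by rw [map_add, jet_add hh (hi u) (hi v)]
      map_smul' := fun a v => by rw [map_smul, jet_smul hh a (hi v)]; rfl }
  have hj : ∀ v, ‖T v‖ ≤ c * ‖j v‖ := fun v => by
    obtain ⟨A, hA⟩ := (hi v).2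
    exact hT v _ (norm_nonneg _) (gevreyAt_norm_jet hh hA)
  obtain ⟨s, hs⟩ := j.rangeRestrict.exists_rightInverse_of_surjective j.range_rangeRestrict
  have hs' : ∀ u : LinearMap.range j, j (s u) = u := fun u =>
    congrArg Subtype.val (LinearMap.congr_fun hs u)
  let T' : LinearMap.range j →L[ℂ] ℂ := (T ∘ₗ s).mkContinuous c fun u => by
    have := hj (s u)
    rwa [hs'] at this
  obtain ⟨Λ, hΛ, _⟩ := exists_extension_norm_eq _ T'
  refine ⟨Λ, fun v => ?_⟩
  have h1 : Λ (jet τ h (i v)) = T (s ⟨j v, v, rfl⟩) := hΛ ⟨j v, v, rfl⟩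
  have h2 := hj (v - s ⟨j v, v, rfl⟩)
  rw [map_sub, map_sub, hs', sub_self, norm_zero, mul_zero, norm_le_zero_iff, sub_eq_zero] at h2
  rw [h1, h2]

/-- The reflected translate `y ↦ g (x - y)`. -/
def reflTranslate {m : ℕ} (g : E m → ℂ) (x : E m) : E m → ℂ := fun y => g (x - y)

theorem reflTranslate_eq (g : E m → ℂ) (x : E m) :
    reflTranslate g x = fun y => g (x + (-1 : ℝ) • y) := by
  ext y; simp [reflTranslate, sub_eq_add_neg]

theorem wordDeriv_reflTranslate (hg : ContDiff ℝ ∞ g) (x : E m) (w : List (Fin m)) (y : E m) :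
    wordDeriv w (reflTranslate g x) y = (-1) ^ w.length * wordDeriv w g (x - y) := by
  rw [reflTranslate_eq, wordDeriv_comp_affine w hg]
  simp [sub_eq_add_neg]

theorem contDiff_reflTranslate (hg : ContDiff ℝ ∞ g) (x : E m) :
    ContDiff ℝ ∞ (reflTranslate g x) :=
  hg.comp (contDiff_const.sub contDiff_id)

theorem gevreyAt_reflTranslate (hg : ContDiff ℝ ∞ g) (hgA : ∀ z, GevreyAt τ A h g z) (x y : E m) :
    GevreyAt τ A h (reflTranslate g x) y := by
  intro w
  rw [wordDeriv_reflTranslate hg, norm_mul, norm_pow, norm_neg, norm_one, one_pow, one_mul]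
  exact hgA _ w

/-- Smooth functions all of whose derivatives have bounded jets of step `h`. -/
structure IsKernel (τ h : ℝ) {m : ℕ} (g : E m → ℂ) : Prop where
  contDiff : ContDiff ℝ ∞ g
  bound : ∀ v : List (Fin m), ∃ A, ∀ x, GevreyAt τ A h (wordDeriv v g) x

/-- The derivatives satisfy Gevrey estimates with a larger `h`, the same for all of them. -/
theorem isKernel_of_gevreyAt {h₀ : ℝ} (hτ : 0 ≤ τ) (h0 : 0 ≤ h₀) (hh : (2 : ℝ) ^ τ * h₀ ≤ h)
    (hg : ContDiff ℝ ∞ g) (hgA : ∀ z, GevreyAt τ A h₀ g z) : IsKernel τ h g :=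
  ⟨hg, fun v => ⟨_, fun x => ((hgA x).wordDeriv hτ h0 v).mono (by positivity) le_rfl hh⟩⟩

theorem IsKernel.pderiv (hg : IsKernel τ h g) (i : Fin m) : IsKernel τ h (pderiv i g) :=
  ⟨contDiff_pderiv i hg.contDiff, fun v => hg.bound (i :: v)⟩

theorem IsKernel.mem_boundedJets (hg : IsKernel τ h g) (hh : 0 ≤ h) (x : E m) :
    reflTranslate g x ∈ boundedJets τ h hh m := by
  obtain ⟨A, hA⟩ := hg.bound []
  exact ⟨contDiff_reflTranslate hg.contDiff x, A, gevreyAt_reflTranslate hg.contDiff hA x⟩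

theorem IsKernel.jet_apply (hg : IsKernel τ h g) (hh : 0 < h) (x : E m) (w : List (Fin m))
    (y : E m) : jet τ h (reflTranslate g x) ⟨w, y⟩ = (-1) ^ w.length * Gevrey.wordDeriv w g (x - y) *
      (((h ^ w.length * (w.length.factorial : ℝ) ^ τ)⁻¹ : ℝ) : ℂ) := by
  obtain ⟨A, hA⟩ := (hg.mem_boundedJets hh.le x).2
  rw [Gevrey.jet_apply hh hA, wordDeriv_reflTranslate hg.contDiff]

/-- Taylor's formula of order two, uniformly for all derivatives. -/
theorem IsKernel.hasFDerivAt_jet (hg : IsKernel τ h g) (hh : 0 < h) (x : E m) :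
    HasFDerivAt (fun x => jet τ h (reflTranslate g x))
      (∑ i, (EuclideanSpace.proj i : E m →L[ℝ] ℝ).smulRight
        (jet τ h (reflTranslate (Gevrey.pderiv i g) x))) x := by
  choose A hA using hg.bound
  set S := (List.finite_length_eq (Fin m) 2).toFinset
  set B := ∑ u ∈ S, A u with hB
  have hA0 : ∀ u, 0 ≤ A u := fun u => (hA u 0).nonneg
  have hAB : ∀ u : List (Fin m), u.length = 2 → A u ≤ B := fun u hu =>
    Finset.single_le_sum (fun u _ => hA0 u) (by simpa [S] using hu)
  have hB0 : 0 ≤ B := Finset.sum_nonneg fun u _ => hA0 u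
  rw [hasFDerivAt_iff_isLittleO_nhds_zero]
  refine Asymptotics.IsBigO.trans_isLittleO (g := fun v : E m => ‖v‖ ^ 2) ?_
    (Asymptotics.isLittleO_norm_pow_id one_lt_two)
  refine Asymptotics.IsBigO.of_bound ((m : ℝ) ^ 2 * B) (Filter.Eventually.of_forall fun v => ?_)
  rw [norm_pow, norm_norm, BoundedContinuousFunction.norm_le (by positivity)]
  rintro ⟨w, y⟩
  have hw := factorial_rpow_pos w.length τ
  have h0 : 0 < h ^ w.length * (w.length.factorial : ℝ) ^ τ := by positivity
  have hev : ∀ u : Fin m → Jet m, (∑ i, u i) ⟨w, y⟩ = ∑ i, u i ⟨w, y⟩ := fun u => by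
    rw [BoundedContinuousFunction.coe_sum, Finset.sum_apply]
  have e : (jet τ h (reflTranslate g (x + v)) - jet τ h (reflTranslate g x) -
      (∑ i, (EuclideanSpace.proj i : E m →L[ℝ] ℝ).smulRight
        (jet τ h (reflTranslate (Gevrey.pderiv i g) x))) v) ⟨w, y⟩ =
      (-1) ^ w.length * (Gevrey.wordDeriv w g ((x - y) + v) - ∑ n ∈ Finset.range 2,
        ((n.factorial : ℂ))⁻¹ * taylorTerm n (Gevrey.wordDeriv w g) (x - y) v) *
      (((h ^ w.length * (w.length.factorial : ℝ) ^ τ)⁻¹ : ℝ) : ℂ) := by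
    rw [BoundedContinuousFunction.sub_apply, BoundedContinuousFunction.sub_apply,
      hg.jet_apply hh, hg.jet_apply hh, sum_apply, hev]
    simp only [ContinuousLinearMap.smulRight_apply, BoundedContinuousFunction.smul_apply,
      (hg.pderiv _).jet_apply hh, Finset.sum_range_succ, Finset.sum_range_zero, taylorTerm,
      wordDeriv_pderiv w _ hg.contDiff, PiLp.proj_apply, Complex.real_smul,
      Nat.factorial, Nat.cast_one, inv_one, one_mul, zero_add]
    have hsum : ∀ (a : Fin m → ℂ) (b c : ℂ),
        ∑ i, (v i : ℂ) * (b * a i * c) = b * (∑ i, (v i : ℂ) * a i) * c := fun a b c => by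
      rw [Finset.mul_sum, Finset.sum_mul]
      exact Finset.sum_congr rfl fun i _ => by ring
    rw [hsum, show x + v - y = x - y + v by abel]
    push_cast
    ring
  rw [e, norm_mul, norm_mul, norm_pow, norm_neg, norm_one, one_pow, one_mul, Complex.norm_real,
    Real.norm_eq_abs, abs_inv, abs_of_pos h0, ← div_eq_mul_inv, div_le_iff₀ h0]
  refine (norm_sub_taylorTerm_le 2 (contDiff_wordDeriv w hg.contDiff) (x - y) v
    (B := B * (h ^ w.length * (w.length.factorial : ℝ) ^ τ)) fun u hu z => ?_).trans ?_
  · rw [← wordDeriv_append, wordDeriv_perm' List.perm_append_comm hg.contDiff, wordDeriv_append]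
    refine (hA u z w).trans ?_
    rw [mul_assoc]
    exact mul_le_mul_of_nonneg_right (hAB u hu) h0.le
  · have h1 : (∑ i, |v i|) ^ 2 ≤ (m * ‖v‖) ^ 2 :=
      pow_le_pow_left₀ (Finset.sum_nonneg fun _ _ => abs_nonneg _) (sum_abs_le v) 2
    refine (div_le_self (by positivity) (by norm_num)).trans ?_
    calc _ ≤ (m * ‖v‖) ^ 2 * (B * (h ^ w.length * (w.length.factorial : ℝ) ^ τ)) := by gcongr
      _ = _ := by ring

theorem IsKernel.contDiff_jet (hg : IsKernel τ h g) (hh : 0 < h) :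
    ContDiff ℝ ∞ fun x => jet τ h (reflTranslate g x) := by
  rw [contDiff_infty]
  intro n
  induction n generalizing g with
  | zero =>
    exact contDiff_zero.mpr (continuous_iff_continuousAt.mpr fun x =>
      (hg.hasFDerivAt_jet hh x).continuousAt)
  | succ n ih =>
    rw [Nat.cast_succ, contDiff_succ_iff_hasFDerivAt]
    exact ⟨_, ContDiff.sum fun i _ => contDiff_const.smulRight (ih (hg.pderiv i)),
      hg.hasFDerivAt_jet hh⟩

/-- `T ∗ g` is smooth when `T` is given by a functional on jets. -/
theorem IsKernel.contDiff_functional (hg : IsKernel τ h g) (hh : 0 < h) (Λ : Jet m →L[ℂ] ℂ) :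
    ContDiff ℝ ∞ fun x => Λ (jet τ h (reflTranslate g x)) :=
  (Λ.restrictScalars ℝ).contDiff.comp (hg.contDiff_jet hh)

theorem IsKernel.wordDeriv_functional (hg : IsKernel τ h g) (hh : 0 < h) (Λ : Jet m →L[ℂ] ℂ)
    (w : List (Fin m)) : Gevrey.wordDeriv w (fun x => Λ (jet τ h (reflTranslate g x))) =
      fun x => Λ (jet τ h (reflTranslate (Gevrey.wordDeriv w g) x)) := by
  induction w generalizing g with
  | nil => rfl
  | cons i w ih =>
    have : Gevrey.pderiv i (fun x => Λ (jet τ h (reflTranslate g x))) =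
        fun x => Λ (jet τ h (reflTranslate (Gevrey.pderiv i g) x)) := by
      ext x
      have h1 : fderiv ℝ (fun x => Λ (jet τ h (reflTranslate g x))) x = _ :=
        ((Λ.restrictScalars ℝ).hasFDerivAt.comp x (hg.hasFDerivAt_jet hh x)).fderiv
      rw [Gevrey.pderiv, h1, ContinuousLinearMap.comp_apply, sum_apply,
        Finset.sum_eq_single i]
      · simp
      · intro j _ hj
        simp [hj.symm]
      · simp
    rw [wordDeriv_cons, this, ih (hg.pderiv i)]
    rfl

end jets

/-! ### Ultradistributions as functionals on jets -/

section functionals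

variable {m : ℕ} {σ τ h A : ℝ} {Ω : TopologicalSpace.Opens (E m)} {g : E m → ℂ}

theorem mem_gevrey_of_mem_boundedJets (hτ : 0 ≤ τ) {hh : 0 ≤ h}
    (hg : g ∈ boundedJets τ h hh m) : g ∈ gevrey τ Ω := by
  obtain ⟨A, hA⟩ := hg.2
  exact mem_gevrey_of_gevreyAt hτ hg.1.contDiffOn fun K _ _ => ⟨A, h, hh, fun x _ => hA x⟩

/-- For every step `h`, an element of `E'_τ(Ω)` acts on globally defined functions through jets.
The constant in the continuity estimate is available for every `h`, in particular for the one that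
translates words into multi-indices. -/
theorem exists_functional_of_compactUltradist (hτ : 0 ≤ τ) (hh : 0 < h)
    (T : compactUltradist τ Ω) : ∃ Λ : Jet m →L[ℂ] ℂ, ∀ (f : E m → ℂ) (hf : f ∈ gevrey τ Ω),
      f ∈ boundedJets τ h hh.le m → T.1 ⟨f, hf⟩ = Λ (jet τ h f) := by
  let V : Submodule ℂ (gevrey τ Ω) := (boundedJets τ h hh.le m).comap (gevrey τ Ω).subtype
  obtain ⟨L, _, _, hT⟩ := T.2
  obtain ⟨c, _, hc⟩ := hT (h * ((2 : ℝ) ^ m) ^ τ) (by positivity)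
  let i : V →ₗ[ℂ] (E m → ℂ) := (gevrey τ Ω).subtype ∘ₗ V.subtype
  obtain ⟨Λ, hΛ⟩ := exists_jet_functional (V := V) hh i (fun v : V => v.2) (T.1 ∘ₗ V.subtype) c
    fun (v : V) M hM H => hc v.1 M hM fun α x _ => GevreyAt.mderiv_le hτ hh.le (H x) α
  exact ⟨Λ, fun f hf hf' => hΛ ⟨⟨f, hf⟩, hf'⟩⟩

theorem exists_functional_of_ultradist (hτ : 0 ≤ τ) (hh : 0 < h) (T : ultradist τ Ω)
    {K : Set (E m)} (hK : IsCompact K) (hKΩ : K ⊆ Ω) : ∃ Λ : Jet m →L[ℂ] ℂ,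
      ∀ (f : E m → ℂ) (hf : f ∈ gevreyTest τ Ω), tsupport f ⊆ K → f ∈ boundedJets τ h hh.le m →
        T.1 ⟨f, hf⟩ = Λ (jet τ h f) := by
  let V : Submodule ℂ (gevreyTest τ Ω) :=
    { carrier := {f | (f : E m → ℂ) ∈ boundedJets τ h hh.le m ∧ ∀ x ∉ K, (f : E m → ℂ) x = 0}
      zero_mem' := ⟨zero_mem _, fun _ _ => rfl⟩
      add_mem' := fun {f g} hf hg => ⟨add_mem hf.1 hg.1, fun x hx => by
        rw [Submodule.coe_add, Pi.add_apply, hf.2 x hx, hg.2 x hx, add_zero]⟩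
      smul_mem' := fun a f hf => ⟨Submodule.smul_mem _ a hf.1, fun x hx => by
        rw [Submodule.coe_smul, Pi.smul_apply, hf.2 x hx, smul_zero]⟩ }
  obtain ⟨c, _, hc⟩ := T.2 K hK hKΩ (h * ((2 : ℝ) ^ m) ^ τ) (by positivity)
  have hV : ∀ v : V, tsupport (v.1 : E m → ℂ) ⊆ K := fun v =>
    closure_minimal (fun x hx => by_contra fun h => hx (v.2.2 x h)) hK.isClosed
  let i : V →ₗ[ℂ] (E m → ℂ) := (gevreyTest τ Ω).subtype ∘ₗ V.subtype
  obtain ⟨Λ, hΛ⟩ := exists_jet_functional hh i (fun v => v.2.1) (T.1 ∘ₗ V.subtype) c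
    fun v M hM H => hc v.1 M (hV v) hM fun α x => GevreyAt.mderiv_le hτ hh.le (H x) α
  exact ⟨Λ, fun f hf hfK hf' => hΛ ⟨⟨f, hf⟩, hf', fun x hx =>
    image_eq_zero_of_notMem_tsupport fun h => hx (hfK h)⟩⟩

theorem exists_compactConvNet_eq (hτ : 0 ≤ τ) (hh : 0 < h) (T : compactUltradist τ Ω) :
    ∃ Λ : Jet m →L[ℂ] ℂ, ∀ (g : Net m) (ε : Ioc (0 : ℝ) 1), IsKernel τ h (g ε) →
      compactConvNet T g ε = fun x => Λ (jet τ h (reflTranslate (g ε) x)) := by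
  obtain ⟨Λ, hΛ⟩ := exists_functional_of_compactUltradist hτ hh T
  refine ⟨Λ, fun g ε hg => funext fun x => ?_⟩
  have h1 := hg.mem_boundedJets hh.le x
  have h2 : reflTranslate (g ε) x ∈ gevrey τ Ω := mem_gevrey_of_mem_boundedJets hτ h1
  rw [← hΛ _ h2 h1]
  exact dif_pos h2

theorem reflTranslate_tsupport_subset {r : ℝ} (hg : ∀ z, r ≤ ‖z‖ → g z = 0) (x : E m) :
    tsupport (reflTranslate g x) ⊆ Metric.closedBall x r := by
  refine closure_minimal (fun y hy => ?_) Metric.isClosed_closedBall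
  rw [Metric.mem_closedBall, dist_comm, dist_eq_norm]
  by_contra h
  exact hy (hg _ (not_le.mp h).le)

theorem IsKernel.reflTranslate_mem_gevreyTest (hτ : 0 ≤ τ) (hh : 0 ≤ h) (hg : IsKernel τ h g)
    {r : ℝ} (hgr : ∀ z, r ≤ ‖z‖ → g z = 0) {x : E m} (hx : Metric.closedBall x r ⊆ Ω) :
    reflTranslate g x ∈ gevreyTest τ Ω :=
  ⟨mem_gevrey_of_mem_boundedJets hτ (hg.mem_boundedJets hh x),
    (isCompact_closedBall x r).of_isClosed_subset (isClosed_tsupport _)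
      (reflTranslate_tsupport_subset hgr x), (reflTranslate_tsupport_subset hgr x).trans hx⟩

/-- Derivatives of `T ∗ g` cost only a constant: they fall on `g`, and `T` is continuous for the
norm of step `2^τ`. -/
theorem norm_wordDeriv_functional_le (hτ : 0 ≤ τ) (hg : ContDiff ℝ ∞ g)
    (hgA : ∀ z, GevreyAt τ A 1 g z) (Λ : Jet m →L[ℂ] ℂ) (w : List (Fin m)) (x : E m) :
    ‖wordDeriv w (fun x => Λ (jet τ ((2 : ℝ) ^ τ) (reflTranslate g x))) x‖ ≤
      ‖Λ‖ * (A * ((2 : ℝ) ^ τ) ^ w.length * (w.length.factorial : ℝ) ^ τ) := by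
  have hk : IsKernel τ ((2 : ℝ) ^ τ) g := isKernel_of_gevreyAt hτ zero_le_one (by simp) hg hgA
  have h0 : (0 : ℝ) < 2 ^ τ := by positivity
  rw [hk.wordDeriv_functional h0]
  refine (Λ.le_opNorm _).trans (mul_le_mul_of_nonneg_left ?_ (norm_nonneg _))
  refine norm_jet_le h0 (gevreyAt_reflTranslate (contDiff_wordDeriv w hg) (fun z => ?_) x)
  simpa using (hgA z).wordDeriv hτ zero_le_one w

theorem IsModerateKernel.isKernel {g : Net m} (hg : IsModerateKernel σ τ g) (hτ : 0 ≤ τ)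
    (hh : (2 : ℝ) ^ τ ≤ h) (ε : Ioc (0 : ℝ) 1) : IsKernel τ h (g ε) := by
  obtain ⟨C, _, k, _, H⟩ := hg.bound
  exact isKernel_of_gevreyAt hτ zero_le_one (by simpa using hh) (hg.contDiff ε) (H ε)

/-- The derivatives of a functional applied to a moderate kernel are moderate. -/
theorem IsModerateKernel.exists_norm_le {g : Net m} (hg : IsModerateKernel σ τ g) (hτ : 0 ≤ τ)
    (Λ : Jet m →L[ℂ] ℂ) (w : List (Fin m)) : ∃ k > 0, ∃ c > 0, ∀ (ε : Ioc (0 : ℝ) 1) (x : E m),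
      ‖wordDeriv w (fun x => Λ (jet τ ((2 : ℝ) ^ τ) (reflTranslate (g ε) x))) x‖ ≤
        c * Real.exp (k * (ε : ℝ) ^ (-(1 / (2 * σ - 1)))) := by
  obtain ⟨C, hC, k, hk, H⟩ := hg.bound
  have hw := factorial_rpow_pos w.length τ
  refine ⟨k, hk, ‖Λ‖ * (C * ((2 : ℝ) ^ τ) ^ w.length * (w.length.factorial : ℝ) ^ τ) + 1,
    by positivity, fun ε x => ?_⟩
  refine (norm_wordDeriv_functional_le hτ (hg.contDiff ε) (H ε) Λ w x).trans ?_
  rw [add_mul, one_mul]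
  refine le_add_of_le_of_nonneg (le_of_eq (by ring)) (Real.exp_nonneg _)

end functionals

/-! ### Regularization of ultradistributions with compact support -/

section compact

variable {m : ℕ} {σ τ : ℝ} {Ω : TopologicalSpace.Opens (E m)} {φ : E m → ℂ} {χ : E m → ℝ}

theorem isModerate_compactConvNet (hτ : 0 ≤ τ) (T : compactUltradist τ Ω) {g : Net m}
    (hg : IsModerateKernel σ τ g) : IsModerate σ Ω (compactConvNet T g) := by
  have h0 : (0 : ℝ) < 2 ^ τ := by positivity
  obtain ⟨Λ, hΛ⟩ := exists_compactConvNet_eq hτ h0 T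
  have hk := fun ε => hg.isKernel hτ le_rfl ε
  refine ⟨fun ε => ?_, fun α K _ _ => ?_⟩
  · rw [hΛ g ε (hk ε)]
    exact ((hk ε).contDiff_functional h0 Λ).contDiffOn
  · obtain ⟨k, hk0, c, hc, H⟩ := hg.exists_norm_le hτ Λ (word α)
    refine ⟨k, hk0, c, hc, ⟨1, by simp⟩, fun ε _ x _ => ?_⟩
    change ‖wordDeriv (word α) (compactConvNet T g ε) x‖ ≤ _
    rw [hΛ g ε (hk ε)]
    exact H ε x

/-- The class of `T ∗ g_ε` depends on the kernel `g` only up to null nets. -/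
theorem isNull_compactConvNet_sub (hτ : 0 ≤ τ) (T : compactUltradist τ Ω) {g g' : Net m}
    (hg : IsModerateKernel σ τ g) (hg' : IsModerateKernel σ τ g')
    (H : ∀ k > 0, ∃ C ≥ 0, ∃ ε₀ : Ioc (0 : ℝ) 1, ∀ ε ≤ ε₀, ∀ x,
      GevreyAt τ (C * Real.exp (-k * (ε : ℝ) ^ (-(1 / (2 * σ - 1))))) 1 (g ε - g' ε) x) :
    IsNull σ Ω (compactConvNet T g - compactConvNet T g') := by
  have h0 : (0 : ℝ) < 2 ^ τ := by positivity
  obtain ⟨Λ, hΛ⟩ := exists_compactConvNet_eq hτ h0 T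
  refine ⟨fun ε => ((isModerate_compactConvNet hτ T hg).1 ε).sub
    ((isModerate_compactConvNet hτ T hg').1 ε), fun α K _ _ k hk => ?_⟩
  obtain ⟨C, hC, ε₀, hε₀⟩ := H k hk
  have hw := factorial_rpow_pos (word α).length τ
  refine ⟨‖Λ‖ * (C * ((2 : ℝ) ^ τ) ^ (word α).length * ((word α).length.factorial : ℝ) ^ τ) + 1,
    by positivity, ε₀, fun ε hε x _ => ?_⟩
  have hd : ContDiff ℝ ∞ (g ε - g' ε) := (hg.contDiff ε).sub (hg'.contDiff ε)
  have hk' := hg.isKernel hτ le_rfl ε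
  have hk'' := hg'.isKernel hτ le_rfl ε
  have e : (compactConvNet T g - compactConvNet T g') ε =
      fun x => Λ (jet τ (2 ^ τ) (reflTranslate (g ε - g' ε) x)) := by
    rw [Pi.sub_apply, hΛ g ε hk', hΛ g' ε hk'']
    ext y
    have e1 : reflTranslate (g ε - g' ε) y =
        reflTranslate (g ε) y + (-1 : ℂ) • reflTranslate (g' ε) y := by
      ext z; simp [reflTranslate, sub_eq_add_neg]
    rw [e1, jet_add h0 (hk'.mem_boundedJets h0.le y)
      (Submodule.smul_mem _ _ (hk''.mem_boundedJets h0.le y)),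
      jet_smul h0 _ (hk''.mem_boundedJets h0.le y)]
    simp [sub_eq_add_neg]
  change ‖wordDeriv (word α) ((compactConvNet T g - compactConvNet T g') ε) x‖ ≤ _
  rw [e]
  refine (norm_wordDeriv_functional_le hτ hd (hε₀ ε hε) Λ (word α) x).trans ?_
  rw [add_mul, one_mul]
  exact le_add_of_le_of_nonneg (le_of_eq (by ring)) (Real.exp_nonneg _)

/-- The map `T ↦ cl (T ∗ g_ε)_ε` on `E'_τ(Ω)`. -/
noncomputable def compactEmbedding (hτ : 0 ≤ τ) (Ω : TopologicalSpace.Opens (E m)) {g : Net m}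
    (hg : IsModerateKernel σ τ g) : compactUltradist τ Ω →ₗ[ℂ] GenGevrey σ Ω where
  toFun T := Ideal.Quotient.mk (nullIdeal σ Ω)
    ⟨compactConvNet T g, isModerate_compactConvNet hτ T hg⟩
  map_add' S T := congrArg (Ideal.Quotient.mk (nullIdeal σ Ω)) <| Subtype.ext <| by
    ext ε x
    change compactConvNet (S + T) g ε x = compactConvNet S g ε x + compactConvNet T g ε x
    unfold compactConvNet
    split_ifs <;> simp
  map_smul' a T := congrArg (Ideal.Quotient.mk (nullIdeal σ Ω)) <| Subtype.ext <| by
    ext ε x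
    change compactConvNet (a • T) g ε x = a * compactConvNet T g ε x
    unfold compactConvNet
    split_ifs <;> simp

theorem isClass_compactConvNet_iff (hτ : 0 ≤ τ) {g : Net m} (hg : IsModerateKernel σ τ g)
    (T : compactUltradist τ Ω) (u : GenGevrey σ Ω) :
    IsClass (compactConvNet T g) u ↔ u = compactEmbedding hτ Ω hg T :=
  ⟨fun ⟨_, h⟩ => h, fun h => ⟨isModerate_compactConvNet hτ T hg, h⟩⟩

theorem IsMollifier.compactEmbedding_eq (hφ : IsMollifier σ φ) (hχ : IsCutoff σ χ) (hσ : 1 < σ)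
    (hτ : 0 ≤ 3 * σ - 1) (Ω : TopologicalSpace.Opens (E m)) :
    compactEmbedding hτ Ω (hφ.isModerateKernel_mod hχ hσ) =
      compactEmbedding hτ Ω (hφ.isModerateKernel hσ) := by
  ext T
  symm
  refine Ideal.Quotient.eq.mpr ?_
  exact isNull_compactConvNet_sub hτ T (hφ.isModerateKernel hσ) (hφ.isModerateKernel_mod hχ hσ)
    fun k hk => hφ.exists_gevreyAt_sub hχ hσ hk

end compact

/-! ### Local classes and the regularization of ultradistributions -/

section localClasses

variable {m : ℕ} {σ τ h : ℝ} {Ω : TopologicalSpace.Opens (E m)} {φ : E m → ℂ} {χ : E m → ℝ}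

/-- The radius of a ball which supports the modified mollifier. -/
noncomputable def suppRadius (ε : Ioc (0 : ℝ) 1) : ℝ := 2 / |Real.log ε|

theorem suppRadius_pos {ε : Ioc (0 : ℝ) 1} (hε : (ε : ℝ) < 1) : 0 < suppRadius ε :=
  div_pos two_pos (abs_pos.mpr (Real.log_neg ε.2.1 hε).ne)

theorem exists_suppRadius_le {δ : ℝ} (hδ : 0 < δ) :
    ∃ ε₀ : Ioc (0 : ℝ) 1, ∀ ε ≤ ε₀, (ε : ℝ) < 1 ∧ suppRadius ε ≤ δ := by
  refine exists_forall_le_of_eventually (P := fun ε => ε < 1 ∧ 2 / |Real.log ε| ≤ δ) ?_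
  have h1 : Filter.Tendsto (fun ε : ℝ => |Real.log ε|) (nhdsWithin 0 (Ioi 0)) Filter.atTop :=
    Filter.tendsto_abs_atBot_atTop.comp Real.tendsto_log_nhdsGT_zero
  have h2 : ∀ᶠ ε : ℝ in nhdsWithin 0 (Ioi 0), ε < 1 :=
    (gt_mem_nhds one_pos).filter_mono nhdsWithin_le_nhds
  filter_upwards [h1.eventually_ge_atTop (2 / δ), h1.eventually_gt_atTop 0, h2] with ε h3 h4 h5
  exact ⟨h5, (div_le_comm₀ h4 hδ).mpr h3⟩

theorem modMollNet_eq_zero (hχ : IsCutoff σ χ) {ε : Ioc (0 : ℝ) 1} (hε : (ε : ℝ) < 1) {z : E m}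
    (hz : suppRadius ε ≤ ‖z‖) : modMollNet φ χ ε z = 0 := by
  have h0 : 0 < |Real.log ε| := abs_pos.mpr (Real.log_neg ε.2.1 hε).ne
  have : χ (|Real.log ε| • z) = 0 := hχ.eq_zero (by
    rw [norm_smul, Real.norm_eq_abs, abs_abs]
    rwa [suppRadius, div_le_iff₀' h0] at hz)
  simp [modMollNet, this]

theorem exists_compact_closedBall_subset {K : Set (E m)} (hK : IsCompact K) (hKΩ : K ⊆ Ω) :
    ∃ K', IsCompact K' ∧ K' ⊆ Ω ∧ K ⊆ K' ∧ ∃ ε₀ : Ioc (0 : ℝ) 1, ∀ ε ≤ ε₀, (ε : ℝ) < 1 ∧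
      ∀ x ∈ K, ∀ᶠ y in nhds x, Metric.closedBall y (suppRadius ε) ⊆ K' := by
  obtain ⟨δ, hδ, hδΩ⟩ := hK.exists_cthickening_subset_open Ω.isOpen hKΩ
  obtain ⟨ε₀, H⟩ := exists_suppRadius_le (half_pos hδ)
  refine ⟨Metric.cthickening δ K, hK.cthickening, hδΩ, Metric.self_subset_cthickening K, ε₀,
    fun ε hε => ⟨(H ε hε).1, fun x hx => ?_⟩⟩
  filter_upwards [Metric.ball_mem_nhds x (half_pos hδ)] with y hy z hz
  refine Metric.mem_cthickening_of_dist_le z x δ K hx ?_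
  rw [Metric.mem_ball] at hy
  rw [Metric.mem_closedBall] at hz
  linarith [dist_triangle z y x, (H ε hε).2]

/-- Uniqueness of local classes. The members of the net are smooth only near compact sets, so the
two differences are compared on a neighbourhood of `K`. -/
theorem eq_of_isLocalClass {f : Net m} {u v : GenGevrey σ Ω} (hu : IsLocalClass f u)
    (hv : IsLocalClass f v) : u = v := by
  obtain ⟨hf, g, rfl, hg⟩ := hu
  obtain ⟨-, g', rfl, hg'⟩ := hv
  refine Ideal.Quotient.eq.mpr ⟨fun ε => (g.2.1 ε).sub (g'.2.1 ε), fun α K hK hKΩ k hk => ?_⟩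
  obtain ⟨δ, hδ, hδΩ⟩ := hK.exists_cthickening_subset_open Ω.isOpen hKΩ
  obtain ⟨ε₁, h₁⟩ := hf _ hK.cthickening hδΩ
  obtain ⟨c, hc, ε₂, h₂⟩ := hg α K hK hKΩ k hk
  obtain ⟨d, hd, ε₃, h₃⟩ := hg' α K hK hKΩ k hk
  refine ⟨c + d, by positivity, min ε₁ (min ε₂ ε₃), fun ε hε x hx => ?_⟩
  let U : TopologicalSpace.Opens (E m) := ⟨Metric.thickening δ K, Metric.isOpen_thickening⟩
  have hUK : (U : Set (E m)) ⊆ Metric.cthickening δ K := Metric.thickening_subset_cthickening δ K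
  have hxU : x ∈ U := Metric.self_subset_thickening hδ K hx
  have hfU : ContDiffOn ℝ ∞ (f ε) U := fun y hy =>
    (h₁ ε (hε.trans (min_le_left _ _)) y (hUK hy)).contDiffWithinAt
  have hgU : ContDiffOn ℝ ∞ (g.1 ε) U := (g.2.1 ε).mono (hUK.trans hδΩ)
  have hgU' : ContDiffOn ℝ ∞ (g'.1 ε) U := (g'.2.1 ε).mono (hUK.trans hδΩ)
  have e : (g - g').1 ε = (f ε - g'.1 ε) - (f ε - g.1 ε) := (sub_sub_sub_cancel_left _ _ _).symm
  have e' : mderiv α ((g - g').1 ε) x = mderiv α (f ε - g'.1 ε) x - mderiv α (f ε - g.1 ε) x := by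
    rw [e]
    exact wordDeriv_sub (word α) (hfU.sub hgU') (hfU.sub hgU) hxU
  change ‖mderiv α ((g - g').1 ε) x‖ ≤ _
  rw [e', add_mul, add_comm]
  exact (norm_sub_le _ _).trans (add_le_add
    (h₃ ε (hε.trans ((min_le_right _ _).trans (min_le_right _ _))) x hx)
    (h₂ ε (hε.trans ((min_le_right _ _).trans (min_le_left _ _))) x hx))

/-- A net which coincides with a moderate net near every compact set, for small `ε`, has the same
class. -/
theorem isLocalClass_of_eventuallyEq {f : Net m} (g : moderate σ Ω)
    (H : ∀ K : Set (E m), IsCompact K → K ⊆ Ω → ∃ ε₀ : Ioc (0 : ℝ) 1, ∀ ε ≤ ε₀, ∀ x ∈ K,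
      f ε =ᶠ[nhds x] (g : Net m) ε) :
    IsLocalClass f (Ideal.Quotient.mk (nullIdeal σ Ω) g) := by
  refine ⟨fun K hK hKΩ => ?_, g, rfl, fun α K hK hKΩ k _ => ?_⟩
  · obtain ⟨ε₀, h₀⟩ := H K hK hKΩ
    exact ⟨ε₀, fun ε hε x hx =>
      ((g.2.1 ε).contDiffAt (Ω.isOpen.mem_nhds (hKΩ hx))).congr_of_eventuallyEq (h₀ ε hε x hx)⟩
  · obtain ⟨ε₀, h₀⟩ := H K hK hKΩ
    refine ⟨1, one_pos, ε₀, fun ε hε x hx => ?_⟩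
    change ‖wordDeriv (word α) (f ε - (g : Net m) ε) x‖ ≤ _
    rw [wordDeriv_eq_zero_of_eventuallyEq, norm_zero]
    · positivity
    · filter_upwards [h₀ ε hε x hx] with y hy
      simp [hy]

/-- Near a compact set, `T` and `T ∗ ρ_ε` are given by one functional on jets, for all small `ε`. -/
theorem exists_ultradistConvNet_eq (hτ : 0 ≤ τ) (hh : (2 : ℝ) ^ τ ≤ h)
    (hχ : IsCutoff σ χ) (hρ : IsModerateKernel σ τ (modMollNet φ χ)) (T : ultradist τ Ω)
    {K : Set (E m)} (hK : IsCompact K) (hKΩ : K ⊆ Ω) : ∃ Λ : Jet m →L[ℂ] ℂ,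
      (∀ (f : E m → ℂ) (hf : f ∈ gevreyTest τ Ω), tsupport f ⊆ K → ∀ A : ℝ,
        (∀ x, GevreyAt τ A h f x) → T.1 ⟨f, hf⟩ = Λ (jet τ h f)) ∧
      ∀ ε : Ioc (0 : ℝ) 1, (ε : ℝ) < 1 → ∀ x, Metric.closedBall x (suppRadius ε) ⊆ K →
        ultradistConvNet T (modMollNet φ χ) ε x =
          Λ (jet τ h (reflTranslate (modMollNet φ χ ε) x)) := by
  have h0 : 0 < h := lt_of_lt_of_le (by positivity) hh
  obtain ⟨Λ, hΛ⟩ := exists_functional_of_ultradist hτ h0 T hK hKΩ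
  refine ⟨Λ, fun f hf hfK A hA => hΛ f hf hfK ⟨contDiff_of_mem_gevreyTest hf, A, hA⟩,
    fun ε hε x hx => ?_⟩
  have hk := hρ.isKernel hτ hh ε
  have hz : ∀ z, suppRadius ε ≤ ‖z‖ → modMollNet φ χ ε z = 0 := fun z hz =>
    modMollNet_eq_zero hχ hε hz
  have h1 := hk.reflTranslate_mem_gevreyTest hτ h0.le hz (hx.trans hKΩ)
  rw [← hΛ _ h1 ((reflTranslate_tsupport_subset hz x).trans hx) (hk.mem_boundedJets h0.le x)]
  exact dif_pos h1

/-- A smooth function which lives where the distance to the complement of `Ω` exceeds `R`, and is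
`1` where this distance is at least `3 R`. -/
theorem exists_spatialCutoff (Ω : TopologicalSpace.Opens (E m)) {R : ℝ} (hR : 0 < R) :
    ∃ κ : E m → ℂ, ContDiff ℝ ∞ κ ∧
      (∀ x, κ =ᶠ[nhds x] 0 ∨ ∃ r > R, Metric.closedBall x r ⊆ Ω) ∧
      ∀ x, Metric.closedBall x (3 * R) ⊆ Ω → κ =ᶠ[nhds x] 1 := by
  set d : E m → ℝ≥0∞ := fun x => Metric.infEDist x (Ω : Set (E m))ᶜ with hd
  have hdc : Continuous d := Metric.continuous_infEDist
  have hs : IsClosed {x | ENNReal.ofReal (3 * R) ≤ d x} := isClosed_le continuous_const hdc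
  have ht : IsClosed {x | ENNReal.ofReal (2 * R) ≤ d x} := isClosed_le continuous_const hdc
  have hst : {x | ENNReal.ofReal (3 * R) ≤ d x} ⊆
      interior {x | ENNReal.ofReal (2 * R) ≤ d x} := by
    have h1 : {x | ENNReal.ofReal (2 * R) < d x} ⊆ {x | ENNReal.ofReal (2 * R) ≤ d x} :=
      fun y (hy : ENNReal.ofReal (2 * R) < d y) => hy.le
    refine subset_trans (fun x (hx : ENNReal.ofReal (3 * R) ≤ d x) => ?_)
      (interior_maximal h1 (isOpen_lt continuous_const hdc))
    refine lt_of_lt_of_le ?_ hx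
    exact (ENNReal.ofReal_lt_ofReal_iff (by positivity)).mpr (by linarith)
  obtain ⟨κ, h1, h2, -⟩ := exists_contMDiffMap_one_nhds_of_subset_interior
    (modelWithCornersSelf ℝ (E m)) (n := ⊤) hs hst
  refine ⟨fun x => (κ x : ℂ), Complex.ofRealCLM.contDiff.comp κ.contMDiff.contDiff,
    fun x => ?_, fun x hx => ?_⟩
  · by_cases hx : x ∈ {x | ENNReal.ofReal (2 * R) ≤ d x}
    · right
      refine ⟨3 / 2 * R, by linarith, fun y hy => ?_⟩
      by_contra hyΩ
      have h3 : d x ≤ edist x y := Metric.infEDist_le_edist_of_mem hyΩ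
      rw [edist_dist, dist_comm] at h3
      have h4 := (ENNReal.ofReal_le_ofReal_iff dist_nonneg).mp (le_trans hx h3)
      rw [Metric.mem_closedBall] at hy
      linarith
    · left
      filter_upwards [ht.isOpen_compl.mem_nhds hx] with y hy
      simp [h2 y hy]
  · have hx' : x ∈ {x | ENNReal.ofReal (3 * R) ≤ d x} := by
      refine Metric.le_infEDist.mpr fun y hy => ?_
      rw [edist_dist, dist_comm]
      refine ENNReal.ofReal_le_ofReal ?_
      by_contra h
      exact hy (hx (not_le.mp h).le)
    filter_upwards [h1.filter_mono (nhds_le_nhdsSet hx')] with y hy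
    simp [hy]

/-- Cutoff functions which restrict the net `T ∗ ρ_ε` to the set where it makes sense. -/
theorem exists_spatialCutoff_net (Ω : TopologicalSpace.Opens (E m)) : ∃ κ : Net m,
    (∀ ε, ContDiff ℝ ∞ (κ ε)) ∧
    (∀ ε x, κ ε =ᶠ[nhds x] 0 ∨ (ε : ℝ) < 1 ∧ ∃ r > suppRadius ε, Metric.closedBall x r ⊆ Ω) ∧
    ∀ K : Set (E m), IsCompact K → K ⊆ Ω → ∃ ε₀ : Ioc (0 : ℝ) 1, ∀ ε ≤ ε₀, ∀ x ∈ K,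
      κ ε =ᶠ[nhds x] 1 := by
  classical
  have H : ∀ ε : Ioc (0 : ℝ) 1, ∃ κ : E m → ℂ, ContDiff ℝ ∞ κ ∧
      (∀ x, κ =ᶠ[nhds x] 0 ∨ (ε : ℝ) < 1 ∧ ∃ r > suppRadius ε, Metric.closedBall x r ⊆ Ω) ∧
      ((ε : ℝ) < 1 → ∀ x, Metric.closedBall x (3 * suppRadius ε) ⊆ Ω → κ =ᶠ[nhds x] 1) := by
    intro ε
    by_cases hε : (ε : ℝ) < 1
    · obtain ⟨κ, h1, h2, h3⟩ := exists_spatialCutoff Ω (suppRadius_pos hε)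
      exact ⟨κ, h1, fun x => (h2 x).imp_right fun h => ⟨hε, h⟩, fun _ => h3⟩
    · exact ⟨0, contDiff_const, fun x => Or.inl Filter.EventuallyEq.rfl, fun h => absurd h hε⟩
  choose κ h1 h2 h3 using H
  refine ⟨κ, h1, h2, fun K hK hKΩ => ?_⟩
  obtain ⟨δ, hδ, hδΩ⟩ := hK.exists_cthickening_subset_open Ω.isOpen hKΩ
  obtain ⟨ε₀, h₀⟩ := exists_suppRadius_le (div_pos hδ three_pos)
  refine ⟨ε₀, fun ε hε x hx => h3 ε (h₀ ε hε).1 x fun y hy => hδΩ ?_⟩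
  refine Metric.mem_cthickening_of_dist_le y x δ K hx ?_
  rw [Metric.mem_closedBall] at hy
  linarith [(h₀ ε hε).2]

theorem isModerate_mul_ultradistConvNet (hτ : 0 ≤ τ) (hχ : IsCutoff σ χ)
    (hρ : IsModerateKernel σ τ (modMollNet φ χ)) (T : ultradist τ Ω) {κ : Net m}
    (h1 : ∀ ε, ContDiff ℝ ∞ (κ ε))
    (h2 : ∀ ε x, κ ε =ᶠ[nhds x] 0 ∨ (ε : ℝ) < 1 ∧ ∃ r > suppRadius ε, Metric.closedBall x r ⊆ Ω)
    (h3 : ∀ K : Set (E m), IsCompact K → K ⊆ Ω → ∃ ε₀ : Ioc (0 : ℝ) 1, ∀ ε ≤ ε₀, ∀ x ∈ K,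
      κ ε =ᶠ[nhds x] 1) : IsModerate σ Ω (κ * ultradistConvNet T (modMollNet φ χ)) := by
  have h0 : (0 : ℝ) < 2 ^ τ := by positivity
  have hk := fun ε => hρ.isKernel hτ le_rfl ε
  refine ⟨fun ε => ContDiff.contDiffOn (contDiff_iff_contDiffAt.mpr fun x => ?_),
    fun α K hK hKΩ => ?_⟩
  · rcases h2 ε x with h | ⟨hε, r, hr, hrΩ⟩
    · refine contDiffAt_const (c := (0 : ℂ)) |>.congr_of_eventuallyEq ?_
      filter_upwards [h] with y hy
      simp [hy]
    · obtain ⟨Λ, -, hΛ⟩ := exists_ultradistConvNet_eq hτ le_rfl hχ hρ T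
        (isCompact_closedBall x r) hrΩ
      refine (h1 ε).contDiffAt.mul ?_
      refine ((hk ε).contDiff_functional h0 Λ).contDiffAt.congr_of_eventuallyEq ?_
      filter_upwards [Metric.ball_mem_nhds x (sub_pos.mpr hr)] with y hy
      refine hΛ ε hε y (Metric.closedBall_subset_closedBall' ?_)
      rw [Metric.mem_ball] at hy
      linarith
  · obtain ⟨K', hK', hKΩ', -, ε₁, h₁⟩ := exists_compact_closedBall_subset hK hKΩ
    obtain ⟨Λ, -, hΛ⟩ := exists_ultradistConvNet_eq hτ le_rfl hχ hρ T hK' hKΩ'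
    obtain ⟨ε₂, h₂⟩ := h3 K hK hKΩ
    obtain ⟨k, hk0, c, hc, H⟩ := hρ.exists_norm_le hτ Λ (word α)
    refine ⟨k, hk0, c, hc, min ε₁ ε₂, fun ε hε x hx => ?_⟩
    have h4 := h₁ ε (hε.trans (min_le_left _ _))
    have e : (κ * ultradistConvNet T (modMollNet φ χ)) ε =ᶠ[nhds x]
        fun x => Λ (jet τ (2 ^ τ) (reflTranslate (modMollNet φ χ ε) x)) := by
      filter_upwards [h₂ ε (hε.trans (min_le_right _ _)) x hx, h4.2 x hx] with y hy1 hy2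
      rw [Pi.mul_apply, Pi.mul_apply, hy1, Pi.one_apply, one_mul, hΛ ε h4.1 y hy2]
    change ‖wordDeriv (word α) ((κ * ultradistConvNet T (modMollNet φ χ)) ε) x‖ ≤ _
    rw [(wordDeriv_eventuallyEq _ e).eq_of_nhds]
    exact H ε x

/-- The embedding `J` of `D'_τ(Ω)`: there is a linear map which sends `T` to the class of the
locally defined net `T ∗ ρ_ε`. -/
theorem exists_ultradist_embedding (hτ : 0 ≤ τ) (hχ : IsCutoff σ χ)
    (hρ : IsModerateKernel σ τ (modMollNet φ χ)) (Ω : TopologicalSpace.Opens (E m)) :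
    ∃ J : ultradist τ Ω →ₗ[ℂ] GenGevrey σ Ω, ∀ T u,
      IsLocalClass (ultradistConvNet T (modMollNet φ χ)) u ↔ u = J T := by
  obtain ⟨κ, h1, h2, h3⟩ := exists_spatialCutoff_net Ω
  let J : ultradist τ Ω →ₗ[ℂ] GenGevrey σ Ω :=
    { toFun := fun T => Ideal.Quotient.mk (nullIdeal σ Ω)
        ⟨κ * ultradistConvNet T (modMollNet φ χ),
          isModerate_mul_ultradistConvNet hτ hχ hρ T h1 h2 h3⟩
      map_add' := fun S T => congrArg (Ideal.Quotient.mk (nullIdeal σ Ω)) <| Subtype.ext <| by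
        ext ε x
        change κ ε x * ultradistConvNet (S + T) _ ε x =
          κ ε x * ultradistConvNet S _ ε x + κ ε x * ultradistConvNet T _ ε x
        rw [← mul_add]
        congr 1
        unfold ultradistConvNet
        split_ifs <;> simp
      map_smul' := fun a T => congrArg (Ideal.Quotient.mk (nullIdeal σ Ω)) <| Subtype.ext <| by
        ext ε x
        change κ ε x * ultradistConvNet (a • T) _ ε x = a * (κ ε x * ultradistConvNet T _ ε x)
        rw [mul_left_comm]
        congr 1
        unfold ultradistConvNet
        split_ifs <;> simp }
  have hJ : ∀ T, IsLocalClass (ultradistConvNet T (modMollNet φ χ)) (J T) := fun T => by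
    refine isLocalClass_of_eventuallyEq _ fun K hK hKΩ => ?_
    obtain ⟨ε₀, h₀⟩ := h3 K hK hKΩ
    refine ⟨ε₀, fun ε hε x hx => ?_⟩
    filter_upwards [h₀ ε hε x hx] with y hy
    rw [Pi.mul_apply, Pi.mul_apply, hy, Pi.one_apply, one_mul]
  exact ⟨J, fun T u => ⟨fun h => eq_of_isLocalClass h (hJ T), fun h => h ▸ hJ T⟩⟩

/-- Near a compact set, the translates of `ρ_ε` are test functions for small `ε`, and both
regularizations coincide. -/
theorem isLocalClass_compactToUltradist (hτ : 0 ≤ τ) (hχ : IsCutoff σ χ)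
    (hρ : IsModerateKernel σ τ (modMollNet φ χ)) (T : compactUltradist τ Ω) :
    IsLocalClass (ultradistConvNet (compactToUltradist τ Ω T) (modMollNet φ χ))
      (compactEmbedding hτ Ω hρ T) := by
  refine isLocalClass_of_eventuallyEq ⟨_, isModerate_compactConvNet hτ T hρ⟩ fun K hK hKΩ => ?_
  obtain ⟨K', hK', hKΩ', -, ε₀, h₀⟩ := exists_compact_closedBall_subset hK hKΩ
  refine ⟨ε₀, fun ε hε x hx => ?_⟩
  filter_upwards [(h₀ ε hε).2 x hx] with y hy
  have h1 : reflTranslate (modMollNet φ χ ε) y ∈ gevreyTest τ Ω :=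
    (hρ.isKernel hτ le_rfl ε).reflTranslate_mem_gevreyTest hτ (by positivity)
      (fun z hz => modMollNet_eq_zero hχ (h₀ ε hε).1 hz) (hy.trans hKΩ')
  have e1 : ultradistConvNet (compactToUltradist τ Ω T) (modMollNet φ χ) ε y =
      (compactToUltradist τ Ω T).1 ⟨_, h1⟩ := dif_pos h1
  have e2 : compactConvNet T (modMollNet φ χ) ε y = T.1 ⟨_, h1.1⟩ := dif_pos h1.1
  rw [e1]
  exact e2.symm

end localClasses

/-! ### Regularization of Gevrey functions -/

section gevreyFunctions

variable {m : ℕ} {σ τ : ℝ} {Ω : TopologicalSpace.Opens (E m)} {φ : E m → ℂ} {χ : E m → ℝ}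

theorem IsMollifier.exists_mderiv_convNet_sub_le (hφ : IsMollifier σ φ) (hσ : 1 < σ) {f : E m → ℂ}
    (hf : f ∈ gevreyTest σ Ω) {k : ℝ} (hk : 0 < k) :
    ∃ c > 0, ∀ α (ε : Ioc (0 : ℝ) 1) x, ‖mderiv α (convNet f (mollNet φ) ε - f) x‖ ≤
      c ^ (len α + 1) * mfact α ^ σ * Real.exp (-k * (ε : ℝ) ^ (-(1 / (2 * σ - 1)))) := by
  have hσ0 : 0 ≤ σ := by linarith
  obtain ⟨A, hA, HA⟩ := exists_gevreyAt_of_mem_gevreyTest hσ0 hf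
  obtain ⟨C, hC, H⟩ := hφ.exists_wordDeriv_convNet_sub_le hσ hA.le hk
  set b := (2 : ℝ) ^ σ * A * ((2 : ℝ) ^ m) ^ σ with hb
  have hb0 : 0 < b := by positivity
  refine ⟨A * C + b + 1, by positivity, fun α ε x => ?_⟩
  have h1 := H A f (contDiff_of_mem_gevreyTest hf) hf.2.1 HA (word α) ε x
  refine h1.trans (mul_le_mul_of_nonneg_right ?_ (Real.exp_nonneg _))
  have h2 := factorial_len_rpow_le α hσ0
  have h3 := mfact_rpow_nonneg α σ
  rw [length_word]
  calc _ ≤ A * ((2 : ℝ) ^ σ * A) ^ len α * ((((2 : ℝ) ^ m) ^ σ) ^ len α * mfact α ^ σ) * C := by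
        gcongr
    _ = (A * C) * b ^ len α * mfact α ^ σ := by rw [hb, mul_pow]; ring
    _ ≤ (A * C + b + 1) * (A * C + b + 1) ^ len α * mfact α ^ σ := by
        have : 0 ≤ A * C := by positivity
        gcongr <;> linarith
    _ = _ := by rw [pow_succ']

theorem IsMollifier.isNull_sub_convNet (hφ : IsMollifier σ φ) (hσ : 1 < σ) {f : E m → ℂ}
    (hf : f ∈ gevreyTest σ Ω) : IsNull σ Ω fun ε => f - convNet f (mollNet φ) ε := by
  have hfs := contDiff_of_mem_gevreyTest hf
  have hc := fun ε => contDiff_convNet hfs hf.2.1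
    (hφ.integrable_mollNet (by linarith) ε).locallyIntegrable
  refine ⟨fun ε => (hfs.sub (hc ε)).contDiffOn, fun α K _ _ k hk => ?_⟩
  obtain ⟨c, hc0, H⟩ := hφ.exists_mderiv_convNet_sub_le hσ hf hk
  have h0 := Real.rpow_pos_of_pos (mfact_pos α) σ
  refine ⟨c ^ (len α + 1) * mfact α ^ σ, by positivity, ⟨1, by simp⟩, fun ε _ x _ => ?_⟩
  refine le_trans (le_of_eq ?_) (H α ε x)
  change ‖wordDeriv (word α) _ x‖ = ‖wordDeriv (word α) _ x‖
  rw [wordDeriv_sub (Ω := ⊤) _ hfs.contDiffOn (hc ε).contDiffOn trivial,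
    wordDeriv_sub (Ω := ⊤) _ (hc ε).contDiffOn hfs.contDiffOn trivial]
  exact norm_sub_rev _ _

/-- Null estimates are a local property. -/
theorem nullBound_of_local {F : Net m} (H : ∀ x ∈ Ω, ∃ U ∈ nhds x, ∀ k > 0, ∃ c > 0,
    ∃ ε₀ : Ioc (0 : ℝ) 1, ∀ ε ≤ ε₀, ∀ y ∈ U,
      ‖F ε y‖ ≤ c * Real.exp (-k * (ε : ℝ) ^ (-(1 / (2 * σ - 1))))) : NullBound σ Ω F := by
  intro K hK hKΩ k hk
  refine hK.induction_on (p := fun S => ∃ c > 0, ∃ ε₀ : Ioc (0 : ℝ) 1, ∀ ε ≤ ε₀, ∀ y ∈ S,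
      ‖F ε y‖ ≤ c * Real.exp (-k * (ε : ℝ) ^ (-(1 / (2 * σ - 1))))) ?_ ?_ ?_ ?_
  · exact ⟨1, one_pos, ⟨1, by simp⟩, by simp⟩
  · rintro S S' hS ⟨c, hc, ε₀, h⟩
    exact ⟨c, hc, ε₀, fun ε hε y hy => h ε hε y (hS hy)⟩
  · rintro S S' ⟨c, hc, ε₁, h₁⟩ ⟨d, hd, ε₂, h₂⟩
    refine ⟨c + d, by positivity, min ε₁ ε₂, fun ε hε y hy => ?_⟩
    rw [add_mul]
    rcases hy with hy | hy
    · exact le_add_of_le_of_nonneg (h₁ ε (hε.trans (min_le_left _ _)) y hy) (by positivity)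
    · exact le_add_of_nonneg_of_le (by positivity) (h₂ ε (hε.trans (min_le_right _ _)) y hy)
  · intro x hx
    obtain ⟨U, hU, h⟩ := H x (hKΩ hx)
    exact ⟨U, mem_nhdsWithin_of_mem_nhds hU, h k hk⟩

/-- The translated and dilated cutoff function `x ↦ χ((x - x₀)/r)`. -/
noncomputable def ballCutoff {m : ℕ} (χ : E m → ℝ) (x₀ : E m) (r : ℝ) : E m → ℂ :=
  fun x => (χ (-(r⁻¹ • x₀) + r⁻¹ • x) : ℂ)

theorem norm_ballCutoff_arg {r : ℝ} (hr : 0 < r) (x₀ x : E m) :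
    ‖-(r⁻¹ • x₀) + r⁻¹ • x‖ = r⁻¹ * dist x x₀ := by
  rw [neg_add_eq_sub, ← smul_sub, norm_smul, norm_inv, Real.norm_eq_abs, abs_of_pos hr, dist_eq_norm]

theorem IsCutoff.ballCutoff_eq_one (hχ : IsCutoff σ χ) {r : ℝ} (hr : 0 < r) {x₀ x : E m}
    (hx : x ∈ Metric.ball x₀ r) : ballCutoff χ x₀ r x = 1 := by
  rw [ballCutoff, hχ.eq_one, Complex.ofReal_one]
  rw [mem_ball_zero_iff, norm_ballCutoff_arg hr, inv_mul_lt_iff₀ hr, mul_one]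
  exact hx

theorem IsCutoff.ballCutoff_eq_zero (hχ : IsCutoff σ χ) {r : ℝ} (hr : 0 < r) {x₀ x : E m}
    (hx : 2 * r ≤ dist x x₀) : ballCutoff χ x₀ r x = 0 := by
  rw [ballCutoff, hχ.eq_zero, Complex.ofReal_zero]
  rw [norm_ballCutoff_arg hr, le_inv_mul_iff₀ hr]
  linarith

/-- Multiplication by a cutoff function gives a globally defined test function. -/
theorem IsCutoff.exists_gevreyAt_mul_ballCutoff (hχ : IsCutoff σ χ) (hσ : 0 ≤ σ) {f : E m → ℂ}
    (hf : f ∈ gevrey σ Ω) {x₀ : E m} {r : ℝ} (hr : 0 < r)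
    (hrΩ : Metric.closedBall x₀ (2 * r) ⊆ Ω) :
    ContDiff ℝ ∞ (f * ballCutoff χ x₀ r) ∧ HasCompactSupport (f * ballCutoff χ x₀ r) ∧
      ∃ A h : ℝ, 0 ≤ h ∧ ∀ x, GevreyAt σ A h (f * ballCutoff χ x₀ r) x := by
  have hθ : ContDiff ℝ ∞ (ballCutoff χ x₀ r) :=
    hχ.contDiff.comp (contDiff_const.add (contDiff_id.const_smul _))
  have hz : ∀ x ∉ Metric.closedBall x₀ (2 * r), f * ballCutoff χ x₀ r =ᶠ[nhds x] 0 := by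
    intro x hx
    filter_upwards [Metric.isClosed_closedBall.isOpen_compl.mem_nhds hx] with y hy
    have hy' : 2 * r ≤ dist y x₀ := (not_le.mp (show ¬dist y x₀ ≤ 2 * r from hy)).le
    rw [Pi.mul_apply, hχ.ballCutoff_eq_zero hr hy', mul_zero, Pi.zero_apply]
  obtain ⟨A, hA, HA⟩ := exists_gevreyAt_of_mem_gevrey hσ hf (isCompact_closedBall x₀ (2 * r)) hrΩ
  obtain ⟨B, hB, HB⟩ := exists_gevreyAt_of_mem_gevreyTest hσ hχ.mem
  refine ⟨contDiff_iff_contDiffAt.mpr fun x => ?_, ?_, A * B, A + |r⁻¹| * B, by positivity,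
    fun x => ?_⟩
  · by_cases hx : x ∈ Metric.closedBall x₀ (2 * r)
    · exact (hf.1.contDiffAt (Ω.isOpen.mem_nhds (hrΩ hx))).mul hθ.contDiffAt
    · exact contDiffAt_const.congr_of_eventuallyEq (hz x hx)
  · exact HasCompactSupport.intro (isCompact_closedBall x₀ (2 * r)) fun x hx =>
      (hz x hx).eq_of_nhds
  · by_cases hx : x ∈ Metric.closedBall x₀ (2 * r)
    · exact (HA x hx).mul hσ hA.le (by positivity) hf.1 hθ.contDiffOn (hrΩ hx)
        (GevreyAt.comp_affine hχ.contDiff _ _ (HB _))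
    · exact gevreyAt_zero (by positivity) (by positivity) (hz x hx)

/-- For the ultradistribution given by a function, `T ∗ ρ_ε` is a convolution, which near a point
only involves the values of the function near that point. -/
theorem ultradistConvNet_gevreyToUltradist (hτ : 0 ≤ τ) (hχ : IsCutoff σ χ)
    (hρ : IsModerateKernel σ τ (modMollNet φ χ)) (f : gevrey σ Ω) {ε : Ioc (0 : ℝ) 1}
    (hε : (ε : ℝ) < 1) {x : E m} (hx : Metric.closedBall x (suppRadius ε) ⊆ Ω) {F : E m → ℂ}
    (hF : EqOn (f : E m → ℂ) F (Metric.closedBall x (suppRadius ε))) :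
    ultradistConvNet (gevreyToUltradist σ τ Ω f) (modMollNet φ χ) ε x =
      convNet F (modMollNet φ χ) ε x := by
  have hz : ∀ z, suppRadius ε ≤ ‖z‖ → modMollNet φ χ ε z = 0 := fun z hz =>
    modMollNet_eq_zero hχ hε hz
  have h1 : reflTranslate (modMollNet φ χ ε) x ∈ gevreyTest τ Ω :=
    (hρ.isKernel hτ le_rfl ε).reflTranslate_mem_gevreyTest hτ (by positivity) hz hx
  have hz' : ∀ y ∉ Metric.closedBall x (suppRadius ε), modMollNet φ χ ε (x - y) = 0 := fun y hy => by
    rw [Metric.mem_closedBall, dist_comm, dist_eq_norm, not_le] at hy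
    exact hz _ hy.le
  have e1 : ultradistConvNet (gevreyToUltradist σ τ Ω f) (modMollNet φ χ) ε x =
      ∫ y in (Ω : Set (E m)), (f : E m → ℂ) y * modMollNet φ χ ε (x - y) := dif_pos h1
  rw [e1, setIntegral_eq_integral_of_forall_compl_eq_zero fun y hy => by
    rw [hz' y fun h => hy (hx h), mul_zero]]
  refine integral_congr_ae (Filter.Eventually.of_forall fun y => ?_)
  change (f : E m → ℂ) y * modMollNet φ χ ε (x - y) = F y * modMollNet φ χ ε (x - y)
  by_cases hy : y ∈ Metric.closedBall x (suppRadius ε)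
  · rw [hF hy]
  · rw [hz' y hy, mul_zero, mul_zero]

/-- On Gevrey functions the regularization is, up to null nets, the identity. Locally, the function
may be replaced by a test function. -/
theorem IsMollifier.nullBound_ultradistConvNet_sub (hφ : IsMollifier σ φ) (hχ : IsCutoff σ χ)
    (hσ : 1 < σ) (hτ : 0 ≤ τ) (hρ : IsModerateKernel σ τ (modMollNet φ χ)) (f : gevrey σ Ω)
    (α : Fin m → ℕ) : NullBound σ Ω fun ε => mderiv α
      (ultradistConvNet (gevreyToUltradist σ τ Ω f) (modMollNet φ χ) ε - (f : E m → ℂ)) := by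
  have hσ0 : 0 ≤ σ := by linarith
  refine nullBound_of_local fun x₀ hx₀ => ?_
  obtain ⟨R, hR, hRΩ⟩ := Metric.nhds_basis_closedBall.mem_iff.mp (Ω.isOpen.mem_nhds hx₀)
  set r := R / 2 with hr
  have hr0 : 0 < r := half_pos hR
  have h2r : 2 * r = R := by rw [hr]; ring
  rw [← h2r] at hRΩ
  obtain ⟨hF, hFc, A, h, hh, HA⟩ := hχ.exists_gevreyAt_mul_ballCutoff hσ0 f.2 hr0 hRΩ
  set F : E m → ℂ := (f : E m → ℂ) * ballCutoff χ x₀ r with hFdef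
  have hfF : ∀ y ∈ Metric.ball x₀ r, (f : E m → ℂ) y = F y := fun y hy => by
    rw [hFdef, Pi.mul_apply, hχ.ballCutoff_eq_one hr0 hy, mul_one]
  refine ⟨Metric.ball x₀ (r / 2), Metric.ball_mem_nhds x₀ (half_pos hr0), fun k hk => ?_⟩
  obtain ⟨C, hC, ε₁, h₁⟩ := hφ.exists_wordDeriv_convNet_mod_sub_le hχ hσ hh hk
  obtain ⟨ε₂, h₂⟩ := exists_suppRadius_le (half_pos (half_pos hr0))
  have hw := factorial_rpow_pos (word α).length σ
  have hA := (HA 0).nonneg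
  refine ⟨A * ((2 : ℝ) ^ σ * h) ^ (word α).length * ((word α).length.factorial : ℝ) ^ σ * C + 1,
    by positivity, min ε₁ ε₂, fun ε hε x hx => ?_⟩
  have hε2 := h₂ ε (hε.trans (min_le_right _ _))
  have e : ultradistConvNet (gevreyToUltradist σ τ Ω f) (modMollNet φ χ) ε - (f : E m → ℂ)
      =ᶠ[nhds x] convNet F (modMollNet φ χ) ε - F := by
    filter_upwards [Metric.isOpen_ball.mem_nhds hx] with y hy
    have hy' : Metric.closedBall y (suppRadius ε) ⊆ Metric.ball x₀ r := fun z hz => by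
      rw [Metric.mem_closedBall] at hz
      rw [Metric.mem_ball] at hy ⊢
      linarith [dist_triangle z y x₀]
    have hyr : y ∈ Metric.ball x₀ r := Metric.ball_subset_ball (by linarith) hy
    rw [Pi.sub_apply, Pi.sub_apply, hfF y hyr, ultradistConvNet_gevreyToUltradist hτ hχ hρ f hε2.1
      (hy'.trans ((Metric.ball_subset_closedBall.trans
        (Metric.closedBall_subset_closedBall (by linarith))).trans hRΩ)) fun z hz => hfF z (hy' hz)]
  change ‖wordDeriv (word α) _ x‖ ≤ _
  rw [(wordDeriv_eventuallyEq _ e).eq_of_nhds, add_mul, one_mul]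
  exact le_add_of_le_of_nonneg (h₁ A F hF hFc HA (word α) ε (hε.trans (min_le_left _ _)) x)
    (Real.exp_nonneg _)

/-- Exponentially small quantities which do not depend on `ε` vanish. -/
theorem eq_zero_of_forall_le_exp {s a b X : ℝ} (hs : 0 < s) (hX : 0 ≤ X) (hb : 0 ≤ b)
    {ε₀ : Ioc (0 : ℝ) 1}
    (H : ∀ ε ≤ ε₀, X ≤ a * (ε : ℝ) + b * Real.exp (-1 * (ε : ℝ) ^ (-(1 / s)))) : X = 0 := by
  refine le_antisymm ?_ hX
  have h1 : Filter.Tendsto (fun ε : ℝ => a * ε + b * ε ^ (1 / s)) (nhdsWithin 0 (Ioi 0))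
      (nhds (a * 0 + b * 0 ^ (1 / s))) := by
    refine Filter.Tendsto.mono_left (Filter.Tendsto.add ?_ ?_) nhdsWithin_le_nhds
    · exact Filter.tendsto_id.const_mul a
    · exact ((Real.continuousAt_rpow_const 0 (1 / s) (Or.inr (by positivity))).tendsto).const_mul b
  rw [Real.zero_rpow (by positivity), mul_zero, mul_zero, add_zero] at h1
  refine ge_of_tendsto h1 ?_
  filter_upwards [Ioo_mem_nhdsGT ε₀.2.1] with ε hε
  refine (H ⟨ε, hε.1, hε.2.le.trans ε₀.2.2⟩ hε.2.le).trans ?_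
  refine add_le_add le_rfl (mul_le_mul_of_nonneg_left ?_ hb)
  have h2 : 0 < ε ^ (1 / s) := Real.rpow_pos_of_pos hε.1 _
  have h3 : ε ^ (-(1 / s)) ≤ Real.exp (ε ^ (-(1 / s))) := by
    linarith [Real.add_one_le_exp (ε ^ (-(1 / s)))]
  rw [Real.rpow_neg hε.1.le] at h3 ⊢
  rw [neg_one_mul, Real.exp_neg]
  exact inv_le_of_inv_le₀ h2 h3

theorem eqOn_of_gevreyToGen_eq (hσ : 1 < σ) {f g : gevrey σ Ω}
    (h : gevreyToGen σ Ω f = gevreyToGen σ Ω g) : EqOn (f : E m → ℂ) g Ω := by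
  intro x hx
  have h1 : IsNull σ Ω fun _ => (f : E m → ℂ) - g := Ideal.Quotient.eq.mp h
  obtain ⟨c, hc, ε₀, h₀⟩ := h1.2 0 {x} isCompact_singleton (singleton_subset_iff.mpr hx) 1 one_pos
  have e : word (0 : Fin m → ℕ) = [] := by simp [word]
  have h2 := eq_zero_of_forall_le_exp (s := 2 * σ - 1) (a := 0) (by linarith)
    (norm_nonneg (((f : E m → ℂ) - g) x)) hc.le (ε₀ := ε₀) fun ε hε => by
      have := h₀ ε hε x rfl
      rw [zero_mul, zero_add]
      simpa only [mderiv, e, wordDeriv, List.foldl_nil] using this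
  rw [norm_eq_zero, Pi.sub_apply, sub_eq_zero] at h2
  exact h2

end gevreyFunctions

/-! ### Injectivity of the embedding -/

section injectivity

variable {m : ℕ} {σ τ h : ℝ} {Ω : TopologicalSpace.Opens (E m)} {φ : E m → ℂ} {χ : E m → ℝ}

/-- Repeated integration by parts. -/
theorem integral_mul_wordDeriv_reflected (w : List (Fin m)) {ψ g : E m → ℂ}
    (hψ : ContDiff ℝ ∞ ψ) (hψc : HasCompactSupport ψ) (hg : ContDiff ℝ ∞ g) (y : E m) :
    ∫ x, ψ x * ((-1) ^ w.length * wordDeriv w g (x - y)) =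
      ∫ x, wordDeriv w ψ x * g (x - y) := by
  induction w generalizing g with
  | nil => simp [wordDeriv]
  | cons i w ih =>
    have hψw := contDiff_wordDeriv w hψ
    have hψwc : HasCompactSupport (wordDeriv w ψ) :=
      hψc.mono' ((subset_tsupport _).trans (tsupport_wordDeriv_subset w ψ))
    have hgy : ContDiff ℝ ∞ fun x => g (x - y) := hg.comp (contDiff_id.sub contDiff_const)
    have hd : ∀ x, fderiv ℝ (fun x => g (x - y)) x (EuclideanSpace.single i 1) =
        pderiv i g (x - y) := fun x => by
      rw [fderiv_comp_sub]
      rfl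
    have hc1 : Continuous (pderiv i (wordDeriv w ψ)) := (contDiff_pderiv i hψw).continuous
    have hc2 : Continuous fun x => pderiv i g (x - y) :=
      (contDiff_pderiv i hg).continuous.comp (by fun_prop)
    have hcs : HasCompactSupport (pderiv i (wordDeriv w ψ)) :=
      hψwc.mono' ((subset_tsupport _).trans (tsupport_wordDeriv_subset [i] (wordDeriv w ψ)))
    have h1 := integral_mul_fderiv_eq_neg_fderiv_mul_of_integrable (μ := volume)
      (f := wordDeriv w ψ) (g := fun x => g (x - y)) (v := EuclideanSpace.single i 1)
      ((hc1.mul hgy.continuous).integrable_of_hasCompactSupport hcs.mul_right)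
      (by
        simp only [hd]
        exact (hψw.continuous.mul hc2).integrable_of_hasCompactSupport hψwc.mul_right)
      ((hψw.continuous.mul hgy.continuous).integrable_of_hasCompactSupport hψwc.mul_right)
      (fun x _ => (hψw.differentiable (by simp)) x) (fun x _ => (hgy.differentiable (by simp)) x)
    simp only [hd] at h1
    have h2 := ih (contDiff_pderiv i hg)
    rw [h1] at h2
    have h3 : wordDeriv (i :: w) ψ = pderiv i (wordDeriv w ψ) := by
      rw [wordDeriv_cons, wordDeriv_pderiv w i hψ]
    rw [h3]
    calc _ = -∫ x, ψ x * ((-1) ^ w.length * wordDeriv w (pderiv i g) (x - y)) := by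
          rw [← integral_neg]
          congr 1
          ext x
          rw [List.length_cons, pow_succ, wordDeriv_cons]
          ring
      _ = _ := by rw [h2, neg_neg]; rfl

/-- The first absolute moment of `ρ_ε` is `O(ε)`. -/
theorem IsMollifier.integral_norm_mul_norm_mod_le (hφ : IsMollifier σ φ) (hχ : IsCutoff σ χ)
    (hσ : 0 ≤ σ) (ε : Ioc (0 : ℝ) 1) :
    Integrable (fun z => ‖z‖ * ‖modMollNet φ χ ε z‖) ∧
      ∫ z, ‖z‖ * ‖modMollNet φ χ ε z‖ ≤ ε * ∫ x, ‖x‖ ^ 1 * ‖φ x‖ := by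
  have h0 := ε.2.1
  have hi := hφ.integrable_pow_mul hσ 1
  have e : ∀ z, ‖z‖ * ‖mollNet φ ε z‖ =
      ((ε : ℝ) ^ m)⁻¹ • ((ε : ℝ) * (‖(ε : ℝ)⁻¹ • z‖ ^ 1 * ‖φ ((ε : ℝ)⁻¹ • z)‖)) := fun z => by
    rw [norm_mollNet, norm_smul, norm_inv, Real.norm_eq_abs, abs_of_pos h0, smul_eq_mul]
    field_simp
  have hi' : Integrable fun z => ‖z‖ * ‖mollNet φ ε z‖ := by
    simp only [e]
    exact (((integrable_comp_smul_iff volume (fun x : E m => ‖x‖ ^ 1 * ‖φ x‖)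
      (inv_ne_zero h0.ne')).mpr hi).const_mul _).smul (((ε : ℝ) ^ m)⁻¹)
  have hle : ∀ z, ‖z‖ * ‖modMollNet φ χ ε z‖ ≤ ‖z‖ * ‖mollNet φ ε z‖ := fun z =>
    mul_le_mul_of_nonneg_left (norm_modMollNet_le hχ ε z) (norm_nonneg _)
  have hc := (contDiff_modMollNet hφ.contDiff hχ ε).continuous
  have hi'' : Integrable fun z => ‖z‖ * ‖modMollNet φ χ ε z‖ :=
    hi'.mono' (Continuous.aestronglyMeasurable (by fun_prop))
      (Filter.Eventually.of_forall fun z => by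
        rw [Real.norm_of_nonneg (by positivity)]; exact hle z)
  refine ⟨hi'', (integral_mono hi'' hi' hle).trans_eq ?_⟩
  simp only [e]
  rw [integral_mollify (fun x : E m => (ε : ℝ) * (‖x‖ ^ 1 * ‖φ x‖)) ε, integral_const_mul]

/-- The averages `∫ ψ(x) ρ_ε(x - ·) dx` converge to `ψ` in the norm of jets. -/
theorem IsMollifier.exists_norm_integral_jet_sub_le (hφ : IsMollifier σ φ) (hχ : IsCutoff σ χ)
    (hσ : 1 < σ) (hτ : 0 ≤ τ) (hh0 : 0 < h)
    (hρ : ∀ ε, IsKernel τ h (modMollNet φ χ ε)) {ψ : E m → ℂ} (hψ : ContDiff ℝ ∞ ψ)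
    (hψc : HasCompactSupport ψ) {B : ℝ} (hB : 0 ≤ B) (hψB : ∀ x, GevreyAt τ B B ψ x)
    (hBh : (2 : ℝ) ^ τ * B ≤ h) :
    ∃ a b : ℝ, 0 ≤ b ∧ ∃ ε₀ : Ioc (0 : ℝ) 1, ∀ ε ≤ ε₀,
      ‖(∫ x, ψ x • jet τ h (reflTranslate (modMollNet φ χ ε) x)) - jet τ h ψ‖ ≤
        a * ε + b * Real.exp (-1 * (ε : ℝ) ^ (-(1 / (2 * σ - 1)))) := by
  have hσ0 : 0 ≤ σ := by linarith
  obtain ⟨C, hC, ε₀, HC⟩ := hφ.exists_integral_sub_le hχ hσ one_pos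
  set M₁ := ∫ x, ‖x‖ ^ 1 * ‖φ x‖ with hM₁
  have hM₁0 : 0 ≤ M₁ := integral_nonneg fun x => by positivity
  set B' := B * ((2 : ℝ) ^ τ * B) with hB'
  have hB'0 : 0 ≤ B' := by positivity
  have hBh' : B ≤ h := le_trans (le_mul_of_one_le_left hB (Real.one_le_rpow (by norm_num) hτ)) hBh
  refine ⟨B' * m * M₁, B * C, by positivity, ε₀, fun ε hε => ?_⟩
  have h0 := ε.2.1
  have hψh : ∀ x, GevreyAt τ B h ψ x := fun x => (hψB x).mono hB le_rfl hBh'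
  have hψ1 : ∀ (u : List (Fin m)), u.length = 1 → ∀ x, GevreyAt τ B' h (wordDeriv u ψ) x :=
    fun u hu x => ((hψB x).wordDeriv hτ hB u).mono (by positivity) (by simp [hu, hB']) hBh
  have hGc : Continuous fun x => ψ x • jet τ h (reflTranslate (modMollNet φ χ ε) x) :=
    hψ.continuous.smul ((hρ ε).contDiff_jet hh0).continuous
  have hGi : Integrable fun x => ψ x • jet τ h (reflTranslate (modMollNet φ χ ε) x) :=
    hGc.integrable_of_hasCompactSupport hψc.smul_right
  have hρi := hφ.integrable_modMollNet hχ hσ0 ε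
  have hρi' := hφ.integrable_mollNet hσ0 ε
  obtain ⟨hzi, hz⟩ := hφ.integral_norm_mul_norm_mod_le hχ hσ0 ε
  rw [BoundedContinuousFunction.norm_le (by positivity)]
  rintro ⟨w, y⟩
  have hw := factorial_rpow_pos w.length τ
  have hn : 0 < h ^ w.length * (w.length.factorial : ℝ) ^ τ := by positivity
  set N := h ^ w.length * (w.length.factorial : ℝ) ^ τ with hN
  set D := wordDeriv w ψ with hD
  have hDs : ContDiff ℝ ∞ D := contDiff_wordDeriv w hψ
  have hDB : ∀ x, ‖D x‖ ≤ B * N := fun x => (hψh x w).trans_eq (by rw [hN]; ring)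
  have hDi : Integrable fun z => D (y + z) * modMollNet φ χ ε z :=
    hρi.bdd_mul (hDs.continuous.comp (by fun_prop)).aestronglyMeasurable
      (Filter.Eventually.of_forall fun z => hDB (y + z))
  have e1 : (∫ x, ψ x • jet τ h (reflTranslate (modMollNet φ χ ε) x)) ⟨w, y⟩ =
      (∫ z, D (y + z) * modMollNet φ χ ε z) * ((N⁻¹ : ℝ) : ℂ) := by
    have h1 := (BoundedContinuousFunction.evalCLM ℂ (β := ℂ)
      (⟨w, y⟩ : JetIndex m)).integral_comp_comm hGi
    change _ = (∫ x, ψ x • jet τ h (reflTranslate (modMollNet φ χ ε) x)) ⟨w, y⟩ at h1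
    rw [← h1]
    have h2 := integral_mul_wordDeriv_reflected w hψ hψc (hρ ε).contDiff y
    have h3 := integral_sub_right_eq_self (μ := volume)
      (fun z => D (y + z) * modMollNet φ χ ε z) y
    simp only [add_sub_cancel] at h3
    rw [← h3, ← h2, ← integral_mul_const]
    congr 1
    ext x
    change ψ x * jet τ h (reflTranslate (modMollNet φ χ ε) x) ⟨w, y⟩ = _
    rw [(hρ ε).jet_apply hh0]
    ring
  -- The integral of `ρ_ε` differs from `1 = ∫ φ_ε` by an exponentially small quantity.
  have e2 : (∫ z, D (y + z) * modMollNet φ χ ε z) - D y =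
      (∫ z, (D (y + z) - D y) * modMollNet φ χ ε z) -
        D y * ∫ z, (mollNet φ ε z - modMollNet φ χ ε z) := by
    have h1 : ∫ z, mollNet φ ε z = 1 := by
      have := integral_mul_mollNet (φ := φ) (fun _ => 1) ε
      simpa [hφ.integral_eq_one] using this
    have h2 : ∫ z, (D (y + z) - D y) * modMollNet φ χ ε z =
        (∫ z, D (y + z) * modMollNet φ χ ε z) - D y * ∫ z, modMollNet φ χ ε z := by
      rw [← integral_const_mul, ← integral_sub hDi (hρi.const_mul _)]
      simp only [sub_mul]
    rw [h2, integral_sub hρi' hρi, h1]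
    ring
  have h3 : ‖∫ z, (D (y + z) - D y) * modMollNet φ χ ε z‖ ≤ B' * N * m * (ε * M₁) := by
    refine (norm_integral_le_of_norm_le (hzi.const_mul (B' * N * m))
      (Filter.Eventually.of_forall fun z => ?_)).trans ?_
    · rw [norm_mul, ← mul_assoc (B' * N * m)]
      refine mul_le_mul_of_nonneg_right ?_ (norm_nonneg _)
      have h4 := norm_sub_taylorTerm_le 1 hDs y z (B := B' * N) fun u hu x => by
        rw [hD, ← wordDeriv_append, wordDeriv_perm' List.perm_append_comm hψ, wordDeriv_append]
        exact (hψ1 u hu x w).trans_eq (by rw [hN]; ring)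
      have h5 : ‖D (y + z) - D y‖ ≤ (∑ i, |z i|) * (B' * N) := by simpa [taylorTerm] using h4
      refine h5.trans ?_
      calc _ ≤ m * ‖z‖ * (B' * N) := mul_le_mul_of_nonneg_right (sum_abs_le z) (by positivity)
        _ = _ := by ring
    · rw [integral_const_mul]
      gcongr
  have h4 : ‖D y * ∫ z, (mollNet φ ε z - modMollNet φ χ ε z)‖ ≤
      B * N * (C * Real.exp (-1 * (ε : ℝ) ^ (-(1 / (2 * σ - 1))))) := by
    rw [norm_mul]
    have := (norm_integral_le_integral_norm _).trans (HC ε hε)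
    gcongr
    exact hDB y
  rw [BoundedContinuousFunction.sub_apply, e1, jet_apply hh0 hψh, ← sub_mul, norm_mul,
    Complex.norm_real, Real.norm_eq_abs, abs_inv, abs_of_pos hn, ← div_eq_mul_inv, div_le_iff₀ hn,
    ← hD, e2]
  exact (norm_sub_le _ _).trans ((add_le_add h3 h4).trans_eq (by ring))

/-- An ultradistribution with vanishing regularization vanishes: `∫ (T ∗ ρ_ε) ψ` tends both to `0`
and to `T ψ`, as it is the value of `T` at an average of translates which tends to `ψ`. -/
theorem IsMollifier.eq_zero_of_isLocalClass_zero (hφ : IsMollifier σ φ) (hχ : IsCutoff σ χ)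
    (hσ : 1 < σ) (hτ : 0 ≤ τ) (hρ : IsModerateKernel σ τ (modMollNet φ χ)) {T : ultradist τ Ω}
    (hT : IsLocalClass (ultradistConvNet T (modMollNet φ χ)) (0 : GenGevrey σ Ω)) : T = 0 := by
  have hs : 0 < 2 * σ - 1 := by linarith
  refine Subtype.ext (LinearMap.ext fun ψ => ?_)
  obtain ⟨ψ, hψT⟩ := ψ
  have hψ := contDiff_of_mem_gevreyTest hψT
  have hψc := hψT.2.1
  obtain ⟨B, hB, hψB⟩ := exists_gevreyAt_of_mem_gevreyTest hτ hψT
  obtain ⟨K', hK', hKΩ', hKK', ε₁, h₁⟩ := exists_compact_closedBall_subset hψc hψT.2.2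
  have h2τ : (0 : ℝ) < 2 ^ τ := by positivity
  -- A step for which both `ψ` with its first derivatives and the kernels have bounded jets.
  set h := (2 : ℝ) ^ τ * (B + 1) with hh
  have hh0 : 0 < h := by positivity
  have hh1 : (2 : ℝ) ^ τ ≤ h := le_mul_of_one_le_right h2τ.le (by linarith)
  have hBh : (2 : ℝ) ^ τ * B ≤ h := mul_le_mul_of_nonneg_left (by linarith) h2τ.le
  have hBh' : B ≤ h :=
    le_trans (le_mul_of_one_le_left hB.le (Real.one_le_rpow (by norm_num) hτ)) hBh
  obtain ⟨Λ, hΛ1, hΛ2⟩ := exists_ultradistConvNet_eq hτ hh1 hχ hρ T hK' hKΩ'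
  have hk := fun ε => hρ.isKernel hτ hh1 ε
  obtain ⟨a, b, hb, ε₂, h₂⟩ := hφ.exists_norm_integral_jet_sub_le hχ hσ hτ hh0 hk hψ hψc hB.le
    hψB hBh
  obtain ⟨-, g, hg, hTg⟩ := hT
  have hg' : IsNull σ Ω g.1 := Ideal.Quotient.eq_zero_iff_mem.mp hg.symm
  obtain ⟨c, hc, ε₃, h₃⟩ := hTg 0 (tsupport ψ) hψc hψT.2.2 1 one_pos
  obtain ⟨d, hd, ε₄, h₄⟩ := hg'.2 0 (tsupport ψ) hψc hψT.2.2 1 one_pos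
  have ew : word (0 : Fin m → ℕ) = [] := by simp [word]
  simp only [mderiv, ew, wordDeriv, List.foldl_nil] at h₃ h₄
  have hψi : Integrable fun x => ‖ψ x‖ :=
    (hψ.continuous.integrable_of_hasCompactSupport hψc).norm
  set I := ∫ x, ‖ψ x‖ with hI
  have hI0 : 0 ≤ I := integral_nonneg fun x => norm_nonneg _
  have key : ∀ ε ≤ min (min ε₁ ε₂) (min ε₃ ε₄), ‖T.1 ⟨ψ, hψT⟩‖ ≤ (‖Λ‖ * a) * (ε : ℝ) +
      (‖Λ‖ * b + (c + d) * I) * Real.exp (-1 * (ε : ℝ) ^ (-(1 / (2 * σ - 1)))) := by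
    intro ε hε
    have hε1 := hε.trans ((min_le_left _ _).trans (min_le_left _ _))
    have hε2 := hε.trans ((min_le_left _ _).trans (min_le_right _ _))
    have hε3 := hε.trans ((min_le_right _ _).trans (min_le_left _ _))
    have hε4 := hε.trans ((min_le_right _ _).trans (min_le_right _ _))
    set X := Real.exp (-1 * (ε : ℝ) ^ (-(1 / (2 * σ - 1)))) with hX
    set U := ∫ x, ψ x • jet τ h (reflTranslate (modMollNet φ χ ε) x) with hU
    have hGi : Integrable fun x => ψ x • jet τ h (reflTranslate (modMollNet φ χ ε) x) :=
      (hψ.continuous.smul ((hk ε).contDiff_jet hh0).continuous).integrable_of_hasCompactSupport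
        hψc.smul_right
    have h5 : ‖Λ U‖ ≤ (c + d) * X * I := by
      rw [hU, ← Λ.integral_comp_comm hGi, hI, ← integral_const_mul]
      refine norm_integral_le_of_norm_le (hψi.const_mul _) (Filter.Eventually.of_forall fun x => ?_)
      rw [map_smul, smul_eq_mul, norm_mul, mul_comm]
      by_cases hx : x ∈ tsupport ψ
      · refine mul_le_mul_of_nonneg_right ?_ (norm_nonneg _)
        rw [← hΛ2 ε (h₁ ε hε1).1 x ((h₁ ε hε1).2 x hx).self_of_nhds]
        have h6 := h₃ ε hε3 x hx
        have h7 := h₄ ε hε4 x hx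
        calc _ = ‖(ultradistConvNet T (modMollNet φ χ) ε - g.1 ε) x + g.1 ε x‖ := by
              rw [Pi.sub_apply, sub_add_cancel]
          _ ≤ _ := (norm_add_le _ _).trans ((add_le_add h6 h7).trans_eq (by ring))
      · rw [image_eq_zero_of_notMem_tsupport hx, norm_zero, mul_zero, mul_zero]
    have h6 : T.1 ⟨ψ, hψT⟩ = Λ (jet τ h ψ) :=
      hΛ1 ψ hψT hKK' B fun x => (hψB x).mono hB.le le_rfl hBh'
    have h7 : ‖Λ (U - jet τ h ψ)‖ ≤ ‖Λ‖ * (a * ε + b * X) :=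
      (Λ.le_opNorm _).trans (mul_le_mul_of_nonneg_left (h₂ ε hε2) (norm_nonneg _))
    calc ‖T.1 ⟨ψ, hψT⟩‖ = ‖Λ U - Λ (U - jet τ h ψ)‖ := by rw [h6, map_sub, sub_sub_cancel]
      _ ≤ (c + d) * X * I + ‖Λ‖ * (a * ε + b * X) := (norm_sub_le _ _).trans (add_le_add h5 h7)
      _ = _ := by ring
  have := eq_zero_of_forall_le_exp hs (norm_nonneg _) (by positivity) key
  rw [norm_eq_zero] at this
  exact this

end injectivity

end Gevrey

theorem mainTheorem6 (m : ℕ) (σ : ℝ) (hσ : 1 < σ) (Ω : TopologicalSpace.Opens (Gevrey.E m))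
    (hΩ : (Ω : Set (Gevrey.E m)).Nonempty) (φ : Gevrey.E m → ℂ) (hφ : Gevrey.IsMollifier σ φ) :
    (∀ f ∈ Gevrey.gevreyTest σ Ω,
      Gevrey.IsNull σ Ω (fun ε => f - Gevrey.convNet f (Gevrey.mollNet φ) ε) ∧
      ∀ K : Set (Gevrey.E m), IsCompact K → K ⊆ Ω → ∀ k > (0 : ℝ), ∃ c > (0 : ℝ),
        ∃ ε₀ : Ioc (0 : ℝ) 1, ∀ α, ∀ ε ≤ ε₀, ∀ x ∈ K,
          ‖Gevrey.mderiv α (Gevrey.convNet f (Gevrey.mollNet φ) ε - f) x‖ ≤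
            c ^ (Gevrey.len α + 1) * Gevrey.mfact α ^ σ *
              Real.exp (-k * (ε : ℝ) ^ (-(1 / (2 * σ - 1))))) ∧
    ∃ J₀ : Gevrey.compactUltradist (3 * σ - 1) Ω →ₗ[ℂ] Gevrey.GenGevrey σ Ω,
      (∀ T u, Gevrey.IsClass (Gevrey.compactConvNet T (Gevrey.mollNet φ)) u ↔ u = J₀ T) ∧
      ∀ χ : Gevrey.E m → ℝ, Gevrey.IsCutoff σ χ →
        ∃ J : Gevrey.ultradist (3 * σ - 1) Ω →ₗ[ℂ] Gevrey.GenGevrey σ Ω,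
          (∀ T u, Gevrey.IsLocalClass
            (Gevrey.ultradistConvNet T (Gevrey.modMollNet φ χ)) u ↔ u = J T) ∧
          (∀ T, Gevrey.IsClass (Gevrey.compactConvNet T (Gevrey.modMollNet φ χ)) (J₀ T)) ∧
          (∀ T, J (Gevrey.compactToUltradist (3 * σ - 1) Ω T) = J₀ T) ∧
          (∀ f, J (Gevrey.gevreyToUltradist σ (3 * σ - 1) Ω f) = Gevrey.gevreyToGen σ Ω f) ∧
          Function.Injective J ∧
          (∀ f g : Gevrey.gevrey σ Ω, Gevrey.gevreyToGen σ Ω f = Gevrey.gevreyToGen σ Ω g →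
            EqOn (f : Gevrey.E m → ℂ) g Ω) ∧
          (∀ f g : Gevrey.gevrey σ Ω, Gevrey.gevreyToUltradist σ (3 * σ - 1) Ω f =
            Gevrey.gevreyToUltradist σ (3 * σ - 1) Ω g → EqOn (f : Gevrey.E m → ℂ) g Ω) := by
  have hτ : 0 ≤ 3 * σ - 1 := by linarith
  refine ⟨fun f hf => ⟨hφ.isNull_sub_convNet hσ hf, fun K _ _ k hk => ?_⟩,
    Gevrey.compactEmbedding hτ Ω (hφ.isModerateKernel hσ),
    Gevrey.isClass_compactConvNet_iff hτ (hφ.isModerateKernel hσ), fun χ hχ => ?_⟩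
  · obtain ⟨c, hc, h⟩ := hφ.exists_mderiv_convNet_sub_le hσ hf hk
    exact ⟨c, hc, ⟨1, by simp⟩, fun α ε _ x _ => h α ε x⟩
  have hρ := hφ.isModerateKernel_mod hχ hσ
  have hJ₀ := hφ.compactEmbedding_eq hχ hσ hτ Ω
  obtain ⟨J, hJ⟩ := Gevrey.exists_ultradist_embedding hτ hχ hρ Ω
  have hI : ∀ f, J (Gevrey.gevreyToUltradist σ (3 * σ - 1) Ω f) = Gevrey.gevreyToGen σ Ω f :=
    fun f => ((hJ _ _).mp ⟨((hJ _ _).mpr rfl).1, ⟨fun _ => f, Gevrey.IsModerate.of_const f.2.1⟩,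
      rfl, hφ.nullBound_ultradistConvNet_sub hχ hσ hτ hρ f⟩).symm
  refine ⟨J, hJ, fun T => ?_, fun T => ?_, hI, ?_, fun f g => Gevrey.eqOn_of_gevreyToGen_eq hσ,
    fun f g h => Gevrey.eqOn_of_gevreyToGen_eq hσ ?_⟩
  · rw [← hJ₀]
    exact (Gevrey.isClass_compactConvNet_iff hτ hρ T _).mpr rfl
  · rw [← hJ₀]
    exact ((hJ _ _).mp (Gevrey.isLocalClass_compactToUltradist hτ hχ hρ T)).symm
  · exact (injective_iff_map_eq_zero J).mpr fun T h =>
      hφ.eq_zero_of_isLocalClass_zero hχ hσ hτ hρ ((hJ T 0).mpr h.symm)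
  · -- `ι` is injective because `J ∘ ι = I` is.
    rw [← hI, ← hI, h]
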